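/- Let $0<\alpha\le 2$ and $0<\beta\le 1$. Notation. $E_\beta(z)=\sum_{k\ge0}\frac{z^k}{\Gamma(\beta k+1)}$ is the Mittag-Leffler function. For $0<\beta<1$, $g_\beta(s,t)=t^{-\beta}\,W_{-\beta,1-\beta}(-s\,t^{-\beta})$ with the Wright function $W_{a,b}(z)=\sum_{k\ge0}\frac{z^k}{k!\,\Gamma(ak+b)}$ (where $1/\Gamma=0$ at the poles of $\Gamma$); for $\beta=1$, $g_1(s,t)\,ds$ is the unit mass at $s=t$. Put $\psi_\gamma^\theta(y)=|y|^\gamma e^{i\,\mathrm{sign}(y)\theta\pi/2}$. $L_\gamma^\theta$ is the stable density with Fourier transform $\int_{\mathbb R} e^{ixy}L_\gamma^\theta(x)\,dx=e^{-\psi_\gamma^\theta(y)}$, and $L_\gamma^\theta(y,x)=x^{-1/\gamma}L_\gamma^\theta(y\,x^{-1/\gamma})$ for $x>0$; $L_1^{-1}(\tau,s)\,d\tau$ is the unit mass at $\tau=s$. In particular $L_2^0(x,\tau)=(4\pi\tau)^{-1/2}e^{-x^2/(4\tau)}$ is the kernel of the classical heat equation. For $t>0$ put $$u_{\alpha,\beta}(x,t)=\int_0^\infty\!\!\int_0^\infty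 L_2^0(x,\tau)\,L_{\alpha/2}^{-\alpha/2}(\tau,s)\,g_\beta(s,t)\,d\tau\,ds .$$ Let ${}_CD_t^\beta v(t)=\frac1{\Gamma(1-\beta)}\int_0^t (t-\tau)^{-\beta}v'(\tau)\,d\tau$ for $\beta<1$ and ${}_CD_t^1v=v'$; let ${}_{RF}D_x^{\alpha}w(x)=\frac{\Gamma(1+\alpha)}{\pi}\sin\frac{\alpha\pi}{2}\int_0^\infty\frac{w(x+y)-2w(x)+w(x-y)}{y^{1+\alpha}}\,dy$ for $\alpha<2$ and ${}_{RF}D_x^2w=w''$ (the symmetric Riesz–Feller derivative, $\theta=0$). Claims. 1. The function $u_{\alpha,\beta}$ is the Green function of ${}_CD_t^\beta u={}_{RF}D_x^{\alpha}u$: for all $t>0$ and all $x$ with $x\neq0$, or for all $x\in\mathbb R$ if $\alpha>1$ or $\beta=1$, the double integral converges absolutely and $$u_{\alpha,\beta}(x,t)=\lim_{R\to\infty}\frac1{2\pi}\int_{-R}^{R}e^{ikx}E_\beta\!\left(-|k|^\alpha t^\beta\right)dk .$$ For each $t>0$, $u_{\alpha,\beta}(\cdot,t)$ is a probability density. 2.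 Let $f:\mathbb R\to\mathbb R$ be continuous and integrable with $\int_{\mathbb R}(1+|k|^\alpha)\,|\widehat f(k)|\,dk<\infty$. Then the Cauchy problem ${}_CD_t^\beta u={}_{RF}D_x^{\alpha}u$ ($x\in\mathbb R$, $t>0$), $u(x,0)=f(x)$, $u(\pm\infty,t)=0$, has exactly one classical solution, namely $$u(x,t)=\int_{\mathbb R}u_{\alpha,\beta}(x-y,t)\,f(y)\,dy\qquad(t>0).$$ Here a classical solution is a continuous function on $\mathbb R\times[0,\infty)$ that tends to $0$ as $|x|\to\infty$ uniformly for $t$ in bounded intervals, is continuously differentiable in $t>0$ with $\partial_tu(x,\cdot)$ integrable on each $(0,T]$, is $C^2$ in $x$ for $t>0$ if $\alpha=2$, is such that the integral defining ${}_{RF}D^\alpha_xu$ converges absolutely for $t>0$ if $\alpha<2$, and satisfies the equation at every $(x,t)$ with $t>0$ and the initial condition. 3. Let $W$ be a standard Brownian motion, $B=\sqrt2\,W$, $\mathcal L$ an $\alpha/2$-stable subordinator with $\mathbb E e^{iy\mathcal L(t)}=e^{-t\psi_{\alpha/2}^{-\alpha/2}(y)}$, and $S$ a $\beta$-stable subordinator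 with $\mathbb E e^{iyS(t)}=e^{-t\psi_{\beta}^{-\beta}(y)}$, the three processes being independent. Let $\mathcal T_\beta(t)=\inf\{s\ge0: S(s)>t\}$ be the inverse of $S$. Then for every $t>0$ the random variable $B(\mathcal L(\mathcal T_\beta(t)))$ has the density $u_{\alpha,\beta}(\cdot,t)$, and $B(\mathcal L(\mathcal T_\beta(0)))=0$ almost surely. -/

import Mathlib

open MeasureTheory ProbabilityTheory Filter Topology Set
open scoped NNReal ENNReal

noncomputable section

namespace FracHeat

/-! ### Special functions and stable densities -/

/-- The Mittag-Leffler function `E_β(z) = ∑ z ^ k / Γ(β k + 1)` at a real argument. -/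
def mittagLeffler (β z : ℝ) : ℝ := ∑' k : ℕ, z ^ k / Real.Gamma (β * k + 1)

/-- The Wright function `W_{β,a}(z) = ∑ z ^ k / (k! Γ(β k + a))` at real arguments.  Mathlib sets
`Γ = 0` at the poles of `Γ`, so that `1 / Γ = 0` there, as it should be. -/
def wright (β a z : ℝ) : ℝ := ∑' k : ℕ, z ^ k / (k.factorial * Real.Gamma (β * k + a))

/-- `g_β(x; t) = t ^ (-β) W_{-β, 1-β}(-x / t ^ β)`, for `0 < β < 1`. -/
def wrightDensity (β x t : ℝ) : ℝ := 1 / t ^ β * wright (-β) (1 - β) (-(x / t ^ β))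

/-- The symbol `ψ_α^θ(y) = |y| ^ α exp(i sign(y) θ π / 2)`. -/
def stableSymbol (α θ y : ℝ) : ℂ :=
  ((|y| ^ α : ℝ) : ℂ) * Complex.exp (Complex.I * ((Real.sign y * θ * Real.pi / 2 : ℝ) : ℂ))

/-- The stable density `L_α^θ(x)`: the inverse Fourier transform
`(2π)⁻¹ ∫ exp(-i x y) exp(-ψ_α^θ(y)) dy`, which is a real number as
`ψ_α^θ(-y)` is the conjugate of `ψ_α^θ(y)`. -/
def stableDensity (α θ x : ℝ) : ℝ :=
  (1 / (2 * (Real.pi : ℂ)) * ∫ y : ℝ,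
    Complex.exp (-(Complex.I * (x : ℂ) * (y : ℂ))) * Complex.exp (-stableSymbol α θ y)).re

/-- `L_α^θ(y; x) = x ^ (-1/α) L_α^θ(y / x ^ (1/α))`, for `x > 0`. -/
def stableKernel (α θ y x : ℝ) : ℝ :=
  1 / x ^ (1 / α) * stableDensity α θ (y / x ^ (1 / α))

/-! ### The subordination formula -/

/-- `∫_0^∞ F(τ) L_γ^{-γ}(τ; s) dτ`, for `0 < γ ≤ 1`.  For `γ = 1` the stable law is
the unit mass at `s`, with Fourier transform `exp(i y s)`. -/
def stableAverage (γ s : ℝ) (F : ℝ → ℝ) : ℝ :=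
  if γ = 1 then F s else ∫ τ in Ioi (0 : ℝ), F τ * stableKernel γ (-γ) τ s

/-- `∫_0^∞ F(s) g_β(s; t) ds`, for `0 < β ≤ 1`.  For `β = 1` the law `g_β(s; t) ds` is
the unit mass at `t`, with Laplace transform `E_1(-λ t) = exp(-λ t)`. -/
def wrightAverage (β t : ℝ) (F : ℝ → ℝ) : ℝ :=
  if β = 1 then F t else ∫ s in Ioi (0 : ℝ), F s * wrightDensity β s t

/-- `u_{α,β}(x,t) = ∫_0^∞ ∫_0^∞ L_2^0(x; τ) L_{α/2}^{-α/2}(τ; s) g_β(s; t) dτ ds`. -/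
def subordinatedKernel (α β x t : ℝ) : ℝ :=
  wrightAverage β t fun s => stableAverage (α / 2) s fun τ => stableKernel 2 0 x τ

/-! ### The fractional heat equation -/

/-- The Caputo derivative of order `0 < β ≤ 1`, `J ^ (1-β) D f`. -/
def caputoDeriv (β : ℝ) (f : ℝ → ℝ) (t : ℝ) : ℝ :=
  if β = 1 then deriv f t
  else 1 / Real.Gamma (1 - β) * ∫ τ in (0 : ℝ)..t, (t - τ) ^ (-β) * deriv f τ

/-- The symmetric Riesz-Feller derivative (skewness `θ = 0`) of order `0 < α ≤ 2`, the operator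
with Fourier symbol `-|y| ^ α`.  For `α < 2` the two one-sided integrals, which have
the same coefficient, are written as one, so that it converges for `1 ≤ α` as well. -/
def rieszFellerDeriv (α : ℝ) (f : ℝ → ℝ) (x : ℝ) : ℝ :=
  if α = 2 then iteratedDeriv 2 f x
  else Real.Gamma (1 + α) / Real.pi * Real.sin (α * Real.pi / 2) *
    ∫ y in Ioi (0 : ℝ), ((f (x + y) - f x) + (f (x - y) - f x)) / y ^ (1 + α)

/-- `u` is a classical solution on `ℝ × [0,∞)` of `D_t^β u = D_x^α u`, `u(·,0) = f`,
`u(±∞, t) = 0`. -/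
structure IsSolution (α β : ℝ) (f : ℝ → ℝ) (u : ℝ → ℝ → ℝ) : Prop where
  continuousOn : ContinuousOn (fun p : ℝ × ℝ => u p.1 p.2) (univ ×ˢ Ici 0)
  initial : ∀ x, u x 0 = f x
  vanishing : ∀ T : ℝ, TendstoUniformlyOn (fun x t => u x t) 0 (cocompact ℝ) (Icc 0 T)
  differentiableAt : ∀ x t, 0 < t → DifferentiableAt ℝ (u x) t
  continuousOn_deriv : ∀ x, ContinuousOn (deriv (u x)) (Ioi 0)
  integrableOn_deriv : ∀ x T, IntegrableOn (deriv (u x)) (Ioc 0 T)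
  contDiff_space : α = 2 → ∀ t, 0 < t → ContDiff ℝ 2 fun x => u x t
  integrable_space : α < 2 → ∀ x t, 0 < t → IntegrableOn
    (fun y => ((u (x + y) t - u x t) + (u (x - y) t - u x t)) / y ^ (1 + α)) (Ioi 0)
  equation : ∀ x t, 0 < t → caputoDeriv β (u x) t = rieszFellerDeriv α (fun z => u z t) x

/-! ### Stable subordinators and their inverses -/

/-- `S` is a `γ`-stable subordinator, `0 < γ ≤ 1`: a Lévy process with nondecreasing
right-continuous paths, with `𝔼 exp(i y S_t) = exp(-t ψ_γ^{-γ}(y))`. -/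
structure IsStableSubordinator {Ω : Type*} [MeasurableSpace Ω] (γ : ℝ)
    (S : ℝ≥0 → Ω → ℝ≥0) (P : Measure Ω) : Prop where
  measurable : ∀ t, Measurable (S t)
  start_zero : ∀ᵐ ω ∂P, S 0 ω = 0
  monotone : ∀ᵐ ω ∂P, Monotone fun t => S t ω
  rightContinuous : ∀ᵐ ω ∂P, ∀ t, ContinuousWithinAt (fun s => S s ω) (Ici t) t
  indepIncrements : HasIndepIncrements (fun t ω => (S t ω : ℝ)) P
  stationaryIncrements : ∀ s t : ℝ≥0,
    IdentDistrib (fun ω => (S (s + t) ω : ℝ) - (S s ω : ℝ)) (fun ω => (S t ω : ℝ)) P P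
  charFun_eq : ∀ (t : ℝ≥0) (y : ℝ), charFun (P.map fun ω => (S t ω : ℝ)) y =
    Complex.exp (-(stableSymbol γ (-γ) y * ((t : ℝ) : ℂ)))

/-- The inverse (hitting time) `T(t) = inf {s ≥ 0 | S(s) > t}` of a subordinator. -/
def inverseSubordinator {Ω : Type*} (S : ℝ≥0 → Ω → ℝ≥0) (t : ℝ≥0) (ω : Ω) : ℝ≥0 :=
  sInf {s : ℝ≥0 | t < S s ω}

end FracHeat

end

noncomputable section

namespace FracHeat

/-! ### Integrals over the half-line -/

/-! Every kernel in the statement is the density of a power of a one-sided stable variable. Let X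
and Z be independent with Laplace transforms `exp (-l ^ β)` and `exp (-l ^ (α / 2))`. By scaling,
the stable kernel at time s is the law of `s ^ (2 / α) * Z`. Comparing power series, the Wright
kernel at time t is the law of `t ^ β * X ^ (-β)`. Hence u is the heat kernel averaged over the
random time `t ^ (2 β / α) * ζ`, where `ζ = X ^ (-2 β / α) * Z` has the law `mixLaw`. The degenerate
orders correspond to point masses and need no separate treatment after this translation.

The stable law rests on four facts: it exists as a limit of sums of Pareto variables
(`exists_stable_law`); its Fourier density vanishes on the negative axis (`stableDensity_of_nonpos`)
and is nonnegative (`stableDensity_nonneg`); and its Laplace transform follows from its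
characteristic function by Phragmén-Lindelöf (`integral_exp_neg_stableLaw`). Its negative moments
identify `mittagLeffler β` as the moment generating function of `X ^ (-β)`
(`integral_exp_mul_inverse`).

Consequently ζ has Laplace transform `E_β(-l ^ (α / 2))`. As the heat kernel has Fourier transform
`exp (-k ^ 2 τ)`, the average has characteristic function `E_β(-|k| ^ α t ^ β)`. Fourier inversion
is performed on the Gaussian for fixed ζ and then averaged (`tendsto_green`). Domination comes from
a bound of order `1 / |x|` uniform in ζ, or from `ζ ^ (-1/2)`, which has finite mean when `α > 1` or
`β = 1`.

For the Cauchy problem, f is a superposition of plane waves. Convolution with u multiplies the wave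
of frequency k by `E_β(-|k| ^ α t ^ β)`. Waves are eigenfunctions of the Riesz-Feller operator, and
this factor is an eigenfunction of the Caputo operator with the same eigenvalue `-|k| ^ α`
(`integral_relaxationDeriv`, `rieszFeller_integral_wave`). Uniqueness is a maximum principle: at a
positive maximum of `u - δ t` the Caputo derivative of u is positive while its Riesz-Feller
derivative is not (`IsSolution.nonpos`).

For the process, the events `S s > t` identify the law of the inverse subordinator as that of `t ^ β
* X ^ (-β)` (`map_firstPassage`). Conditioning twice on independent random times gives the
characteristic function of u (`hasLaw_subordinated`). -/

theorem integrable_of_integral_pos {X : Type*} [MeasurableSpace X] {μ : Measure X} {f : X → ℝ}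
    (h : 0 < ∫ x, f x ∂μ) : Integrable f μ := by
  by_contra hf
  -- The integral of a nonintegrable function is 0 by convention, so an explicit positive value
  -- certifies integrability.
  rw [integral_undef hf] at h
  exact lt_irrefl _ h

theorem setLIntegral_Ioi_ofReal_eq {f : ℝ → ℝ} {c : ℝ} (hc : 0 < c)
    (h : ∫ x in Ioi (0 : ℝ), f x = c) (hf : ∀ x ∈ Ioi (0 : ℝ), 0 ≤ f x) :
    ∫⁻ x in Ioi (0 : ℝ), ENNReal.ofReal (f x) = ENNReal.ofReal c := by
  rw [← h, ofReal_integral_eq_lintegral_ofReal (integrable_of_integral_pos (h ▸ hc))]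
  exact (ae_restrict_iff' measurableSet_Ioi).2 (ae_of_all _ hf)

theorem integrableOn_and_integral_of_lintegral {f : ℝ → ℝ} {c : ℝ} (hc : 0 ≤ c)
    (hm : AEStronglyMeasurable f (volume.restrict (Ioi 0)))
    (hf : ∀ x ∈ Ioi (0 : ℝ), 0 ≤ f x)
    (h : ∫⁻ x in Ioi (0 : ℝ), ENNReal.ofReal (f x) = ENNReal.ofReal c) :
    IntegrableOn f (Ioi 0) ∧ ∫ x in Ioi (0 : ℝ), f x = c := by
  have hf' : 0 ≤ᵐ[volume.restrict (Ioi 0)] f :=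
    (ae_restrict_iff' measurableSet_Ioi).2 (ae_of_all _ hf)
  refine ⟨⟨hm, ?_⟩, ?_⟩
  · rw [hasFiniteIntegral_iff_ofReal hf', h]
    exact ENNReal.ofReal_lt_top
  · rw [integral_eq_lintegral_of_nonneg_ae hf' hm, h, ENNReal.toReal_ofReal hc]

/-- Write `1 / (1 + s ^ 2)` as the integral of `exp (-(1 + s ^ 2) v)` over v and apply Tonelli. The
s-integral is a Gaussian moment, the v-integral is a Gamma integral, and the product `Γ(a/2) Γ(1 -
a/2)` is evaluated by reflection. -/
theorem lintegral_rpow_div_one_add_sq {a : ℝ} (ha : 0 < a) (ha2 : a < 2) :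
    ∫⁻ s in Ioi (0 : ℝ), ENNReal.ofReal (s ^ (a - 1) / (1 + s ^ 2)) =
      ENNReal.ofReal (Real.pi / (2 * Real.sin (Real.pi * a / 2))) := by
  have h1 : ∀ s ∈ Ioi (0 : ℝ), ENNReal.ofReal (s ^ (a - 1) / (1 + s ^ 2)) =
      ∫⁻ v in Ioi (0 : ℝ), ENNReal.ofReal (s ^ (a - 1) * Real.exp (-(1 + s ^ 2) * v)) := by
    intro s (hs : 0 < s)
    symm
    apply setLIntegral_Ioi_ofReal_eq
    · positivity
    · rw [integral_const_mul, integral_exp_mul_Ioi (by nlinarith)]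
      rw [mul_zero, Real.exp_zero, neg_div_neg_eq, mul_one_div]
    · intro x _
      positivity
  rw [setLIntegral_congr_fun measurableSet_Ioi h1, lintegral_lintegral_swap]
  swap
  · apply Measurable.aemeasurable
    fun_prop
  have h2 : ∀ v ∈ Ioi (0 : ℝ),
      ∫⁻ s in Ioi (0 : ℝ), ENNReal.ofReal (s ^ (a - 1) * Real.exp (-(1 + s ^ 2) * v)) =
      ENNReal.ofReal (Real.exp (-v) * v ^ ((1 - a / 2) - 1) * (1 / 2 * Real.Gamma (a / 2))) := by
    intro v (hv : 0 < v)
    have hG := Real.Gamma_pos_of_pos (show 0 < a / 2 by linarith)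
    apply setLIntegral_Ioi_ofReal_eq
    · positivity
    · have := integral_rpow_mul_exp_neg_mul_rpow (p := 2) (q := a - 1) (b := v) (by norm_num)
        (by linarith) hv
      calc ∫ s in Ioi (0 : ℝ), s ^ (a - 1) * Real.exp (-(1 + s ^ 2) * v)
          = ∫ s in Ioi (0 : ℝ), Real.exp (-v) * (s ^ (a - 1) * Real.exp (-v * s ^ (2 : ℝ))) := by
            congr 1 with s
            rw [show -(1 + s ^ 2) * v = -v + -v * s ^ (2 : ℝ) by
              rw [Real.rpow_two]; ring, Real.exp_add]
            ring
        _ = _ := by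
            rw [integral_const_mul, this]
            rw [show -(a - 1 + 1) / 2 = 1 - a / 2 - 1 by ring, show (a - 1 + 1) / 2 = a / 2 by ring]
            ring
    · intro x hx
      have : (0 : ℝ) < x := hx
      positivity
  rw [setLIntegral_congr_fun measurableSet_Ioi h2]
  have h3 := Real.Gamma_mul_Gamma_one_sub (a / 2)
  have hG := Real.Gamma_pos_of_pos (show 0 < a / 2 by linarith)
  have hG' := Real.Gamma_pos_of_pos (show 0 < 1 - a / 2 by linarith)
  have h4 : Real.pi / (2 * Real.sin (Real.pi * a / 2)) =
      Real.Gamma (1 - a / 2) * (1 / 2 * Real.Gamma (a / 2)) := by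
    rw [show Real.pi * a / 2 = Real.pi * (a / 2) by ring, mul_comm 2, ← div_div, ← h3]
    ring
  rw [h4]
  apply setLIntegral_Ioi_ofReal_eq
  · positivity
  · rw [integral_mul_const, ← Real.Gamma_eq_integral (by linarith)]
  · intro x hx
    have : (0 : ℝ) < x := hx
    positivity

theorem integral_one_sub_cos_mul_exp {s : ℝ} (hs : 0 < s) :
    ∫ u in Ioi (0 : ℝ), (1 - Real.cos u) * Real.exp (-s * u) = 1 / (s * (1 + s ^ 2)) := by
  have h1 := integral_exp_mul_complex_Ioi (a := -(s : ℂ) + Complex.I) (by simpa using hs) 0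
  have h1' := integrableOn_exp_mul_complex_Ioi (a := -(s : ℂ) + Complex.I) (by simpa using hs) 0
  have h2 := integral_exp_mul_Ioi (a := -s) (by linarith) 0
  have h2' := integrableOn_exp_mul_Ioi (a := -s) (by linarith) 0
  have h3 : ∀ u : ℝ, (Complex.exp ((-(s : ℂ) + Complex.I) * u)).re =
      Real.cos u * Real.exp (-s * u) := by
    intro u
    rw [Complex.exp_re]
    simp [mul_comm]
  have h4 : ∫ u in Ioi (0 : ℝ), Real.cos u * Real.exp (-s * u) = s / (1 + s ^ 2) := by
    simp_rw [← h3]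
    have := integral_re (𝕜 := ℂ) h1'
    simp only [RCLike.re_to_complex] at this
    rw [this, h1]
    simp [Complex.div_re, Complex.normSq_apply]
    field_simp
    ring
  have h5 : IntegrableOn (fun u => Real.cos u * Real.exp (-s * u)) (Ioi 0) := by
    simp_rw [← h3]
    exact h1'.re
  calc ∫ u in Ioi (0 : ℝ), (1 - Real.cos u) * Real.exp (-s * u)
      = ∫ u in Ioi (0 : ℝ), (Real.exp (-s * u) - Real.cos u * Real.exp (-s * u)) := by
        congr 1 with u
        ring
    _ = _ := by
        rw [integral_sub h2' h5, h2, h4]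
        simp
        field_simp
        ring

/-- The power `u ^ (-1-α)` is a Gamma integral of `s ^ α * exp (-s u)`. After Tonelli the u-integral
is elementary and leaves `s ^ (α - 1) / (1 + s ^ 2)`. Working with lower integrals gives
integrability and the value together. -/
theorem integral_one_sub_cos_div_rpow_aux {α : ℝ} (hα : 0 < α) (hα2 : α < 2) :
    IntegrableOn (fun u => (1 - Real.cos u) / u ^ (1 + α)) (Ioi 0) ∧
    ∫ u in Ioi (0 : ℝ), (1 - Real.cos u) / u ^ (1 + α) =
      Real.pi / (2 * Real.sin (Real.pi * α / 2)) / Real.Gamma (1 + α) := by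
  have hG := Real.Gamma_pos_of_pos (show 0 < 1 + α by linarith)
  have hsin : 0 < Real.sin (Real.pi * α / 2) := by
    apply Real.sin_pos_of_pos_of_lt_pi
    · have := Real.pi_pos
      positivity
    · nlinarith [Real.pi_pos]
  have hcos : ∀ u : ℝ, 0 ≤ 1 - Real.cos u := fun u => by linarith [Real.cos_le_one u]
  apply integrableOn_and_integral_of_lintegral
  · have := Real.pi_pos
    positivity
  · apply Measurable.aestronglyMeasurable
    fun_prop
  · intro u (hu : 0 < u)
    have := hcos u
    positivity
  have h1 : ∀ u ∈ Ioi (0 : ℝ), ENNReal.ofReal ((1 - Real.cos u) / u ^ (1 + α)) =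
      ENNReal.ofReal (1 / Real.Gamma (1 + α)) * ∫⁻ s in Ioi (0 : ℝ),
        ENNReal.ofReal ((1 - Real.cos u) * (s ^ α * Real.exp (-s * u))) := by
    intro u (hu : 0 < u)
    have : ∫⁻ s in Ioi (0 : ℝ), ENNReal.ofReal (s ^ α * Real.exp (-s * u)) =
        ENNReal.ofReal ((1 / u) ^ (1 + α) * Real.Gamma (1 + α)) := by
      apply setLIntegral_Ioi_ofReal_eq
      · positivity
      · rw [← Real.integral_rpow_mul_exp_neg_mul_Ioi (by linarith) hu]
        congr 1 with s
        rw [add_sub_cancel_left, show -s * u = -(u * s) by ring]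
      · intro s hs
        have : (0 : ℝ) < s := hs
        positivity
    simp_rw [ENNReal.ofReal_mul (hcos u)]
    rw [lintegral_const_mul' _ _ ENNReal.ofReal_ne_top, this, ← ENNReal.ofReal_mul (hcos u),
      ← ENNReal.ofReal_mul (by positivity), Real.div_rpow zero_le_one hu.le, Real.one_rpow]
    congr 1
    field_simp
  rw [setLIntegral_congr_fun measurableSet_Ioi h1, lintegral_const_mul' _ _ ENNReal.ofReal_ne_top,
    lintegral_lintegral_swap]
  swap
  · apply Measurable.aemeasurable
    fun_prop
  have h2 : ∀ s ∈ Ioi (0 : ℝ), ∫⁻ u in Ioi (0 : ℝ),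
      ENNReal.ofReal ((1 - Real.cos u) * (s ^ α * Real.exp (-s * u))) =
      ENNReal.ofReal (s ^ (α - 1) / (1 + s ^ 2)) := by
    intro s (hs : 0 < s)
    apply setLIntegral_Ioi_ofReal_eq
    · positivity
    · calc ∫ u in Ioi (0 : ℝ), (1 - Real.cos u) * (s ^ α * Real.exp (-s * u))
          = ∫ u in Ioi (0 : ℝ), s ^ α * ((1 - Real.cos u) * Real.exp (-s * u)) := by
            congr 1 with u
            ring
        _ = _ := by
            rw [integral_const_mul, integral_one_sub_cos_mul_exp hs, Real.rpow_sub_one hs.ne']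
            field_simp
    · intro u _
      have := hcos u
      positivity
  rw [setLIntegral_congr_fun measurableSet_Ioi h2, lintegral_rpow_div_one_add_sq hα hα2,
    ← ENNReal.ofReal_mul (by positivity)]
  congr 1
  ring

/-- `∫_0^∞ (1 - cos (y u)) u ^ (-1-α) du` for `0 < α < 2`. -/
theorem integral_one_sub_cos_div_rpow {α : ℝ} (hα : 0 < α) (hα2 : α < 2) (y : ℝ) :
    IntegrableOn (fun u => (1 - Real.cos (y * u)) / u ^ (1 + α)) (Ioi 0) ∧
    ∫ u in Ioi (0 : ℝ), (1 - Real.cos (y * u)) / u ^ (1 + α) =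
      |y| ^ α * (Real.pi / (2 * Real.sin (Real.pi * α / 2)) / Real.Gamma (1 + α)) := by
  obtain ⟨h1, h2⟩ := integral_one_sub_cos_div_rpow_aux hα hα2
  rcases eq_or_ne y 0 with rfl | hy
  · simp [Real.zero_rpow hα.ne']
  have hy' : 0 < |y| := abs_pos.2 hy
  have h3 : ∀ u ∈ Ioi (0 : ℝ), (1 - Real.cos (y * u)) / u ^ (1 + α) =
      |y| ^ (1 + α) * ((1 - Real.cos (|y| * u)) / (|y| * u) ^ (1 + α)) := by
    intro u (hu : 0 < u)
    rw [Real.mul_rpow hy'.le hu.le, ← Real.cos_abs (y * u), abs_mul, abs_of_pos hu]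
    have := Real.rpow_pos_of_pos hy' (1 + α)
    field_simp
  have h1' := (integrableOn_Ioi_comp_mul_left_iff (fun u => (1 - Real.cos u) / u ^ (1 + α)) 0
    hy').2 (by simpa using h1)
  have h2' := integral_comp_mul_left_Ioi (fun u => (1 - Real.cos u) / u ^ (1 + α)) 0 hy'
  constructor
  · exact (IntegrableOn.congr_fun (h1'.const_mul _) (fun u hu => (h3 u hu).symm) measurableSet_Ioi)
  · rw [setIntegral_congr_fun measurableSet_Ioi h3, integral_const_mul, h2', mul_zero, h2,
      smul_eq_mul, ← mul_assoc, ← Real.rpow_neg_one |y|, ← Real.rpow_add hy']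
    ring_nf

theorem integrableOn_sin_mul_rpow {γ : ℝ} (hγ : 0 < γ) (hγ1 : γ < 1) (y : ℝ) :
    IntegrableOn (fun u => Real.sin (y * u) * u ^ (-(1 + γ))) (Ioi 0) := by
  have hm : Measurable (fun u => Real.sin (y * u) * u ^ (-(1 + γ))) := by fun_prop
  rw [← Ioc_union_Ioi_eq_Ioi zero_le_one]
  refine IntegrableOn.union ?_ ?_
  · have h : IntegrableOn (fun u : ℝ => |y| * u ^ (-γ)) (Ioc 0 1) := by
      rw [← intervalIntegrable_iff_integrableOn_Ioc_of_le zero_le_one]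
      exact (intervalIntegral.intervalIntegrable_rpow' (by linarith)).const_mul _
    refine Integrable.mono' h hm.aestronglyMeasurable ?_
    refine (ae_restrict_iff' measurableSet_Ioc).2 (ae_of_all _ fun u hu => ?_)
    have hu0 : 0 < u := hu.1
    rw [norm_mul, Real.norm_eq_abs, Real.norm_eq_abs, abs_of_nonneg (Real.rpow_nonneg hu0.le _)]
    have h1 : |Real.sin (y * u)| ≤ |y| * u := by
      have := Real.abs_sin_le_abs (x := y * u)
      rwa [abs_mul, abs_of_pos hu0] at this
    calc |Real.sin (y * u)| * u ^ (-(1 + γ)) ≤ |y| * u * u ^ (-(1 + γ)) := by gcongr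
      _ = |y| * u ^ (-γ) := by
        rw [mul_assoc, show u * u ^ (-(1 + γ)) = u ^ (1 : ℝ) * u ^ (-(1 + γ)) by
          rw [Real.rpow_one], ← Real.rpow_add hu0]
        ring_nf
  · refine Integrable.mono' (integrableOn_Ioi_rpow_of_lt (a := -(1 + γ)) (by linarith) zero_lt_one)
      hm.aestronglyMeasurable ?_
    refine (ae_restrict_iff' measurableSet_Ioi).2 (ae_of_all _ fun u hu => ?_)
    have hu0 : 0 < u := zero_lt_one.trans hu
    rw [norm_mul, Real.norm_eq_abs, Real.norm_eq_abs, abs_of_nonneg (Real.rpow_nonneg hu0.le _)]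
    exact mul_le_of_le_one_left (Real.rpow_nonneg hu0.le _) (Real.abs_sin_le_one _)

theorem one_sub_cos_le_sq (x : ℝ) : 1 - Real.cos x ≤ x ^ 2 / 2 := by
  linarith [Real.one_sub_sq_div_two_le_cos (x := x)]

theorem integral_sin_mul_rpow {γ : ℝ} (hγ : 0 < γ) (hγ1 : γ < 1) (y : ℝ) :
    ∫ u in Ioi (0 : ℝ), Real.sin (y * u) * u ^ (-(1 + γ)) =
      Real.sign y * |y| ^ γ *
        (Real.pi / (2 * Real.cos (Real.pi * γ / 2)) / Real.Gamma (1 + γ)) := by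
  rcases eq_or_ne y 0 with rfl | hy
  · simp
  obtain ⟨h1, h2⟩ := integral_one_sub_cos_div_rpow (α := 1 + γ) (by linarith) (by linarith) y
  have e1 : ∀ u ∈ Ioi (0 : ℝ), (1 - Real.cos (y * u)) / u ^ (1 + (1 + γ)) =
      u ^ (-(1 + γ) - 1) * (1 - Real.cos (y * u)) := by
    intro u (hu : 0 < u)
    rw [show -(1 + γ) - 1 = -(1 + (1 + γ)) by ring, Real.rpow_neg hu.le, div_eq_inv_mul]
  rw [setIntegral_congr_fun measurableSet_Ioi e1] at h2
  replace h1 := h1.congr_fun e1 measurableSet_Ioi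
  -- Integration by parts reduces the sine integral to the cosine integral of order `1 + γ`, which
  -- lies in (1, 2). The boundary terms are of size `u ^ (1 - γ)` at 0 and `u ^ (-(1 + γ))` at
  -- infinity.
  have key := integral_Ioi_mul_deriv_eq_deriv_mul (a := (0 : ℝ)) (u := fun u => u ^ (-(1 + γ)))
    (u' := fun u => -(1 + γ) * u ^ (-(1 + γ) - 1)) (v := fun u => 1 - Real.cos (y * u))
    (v' := fun u => y * Real.sin (y * u)) (a' := 0) (b' := 0) ?_ ?_ ?_ ?_ ?_ ?_
  · have e2 : ∫ u in Ioi (0 : ℝ), u ^ (-(1 + γ)) * (y * Real.sin (y * u)) =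
        y * ∫ u in Ioi (0 : ℝ), Real.sin (y * u) * u ^ (-(1 + γ)) := by
      rw [← integral_const_mul]
      congr 1 with u
      ring
    have e3 : ∫ u in Ioi (0 : ℝ), -(1 + γ) * u ^ (-(1 + γ) - 1) * (1 - Real.cos (y * u)) =
        -(1 + γ) * ∫ u in Ioi (0 : ℝ), u ^ (-(1 + γ) - 1) * (1 - Real.cos (y * u)) := by
      rw [← integral_const_mul]
      congr 1 with u
      ring
    rw [e2, e3, h2] at key
    have hG := Real.Gamma_pos_of_pos (show 0 < 1 + γ by linarith)
    have hG2 : Real.Gamma (1 + (1 + γ)) = (1 + γ) * Real.Gamma (1 + γ) := by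
      rw [add_comm 1 (1 + γ), Real.Gamma_add_one (by linarith)]
    have hs : Real.sin (Real.pi * (1 + γ) / 2) = Real.cos (Real.pi * γ / 2) := by
      rw [← Real.sin_add_pi_div_two]
      congr 1
      ring
    have hc : 0 < Real.cos (Real.pi * γ / 2) := by
      apply Real.cos_pos_of_mem_Ioo
      constructor <;> nlinarith [Real.pi_pos]
    have hy2 : |y| ^ (1 + γ) = y * (Real.sign y * |y| ^ γ) := by
      rw [Real.rpow_add (abs_pos.2 hy), Real.rpow_one, ← mul_assoc]
      rcases lt_or_gt_of_ne hy with h | h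
      · rw [Real.sign_of_neg h, abs_of_neg h]; ring
      · rw [Real.sign_of_pos h, abs_of_pos h]; ring
    rw [hG2, hs, hy2] at key
    apply mul_left_cancel₀ hy
    rw [key]
    have : 1 + γ ≠ 0 := by linarith
    field_simp
    ring
  · intro x (hx : 0 < x)
    exact Real.hasDerivAt_rpow_const (Or.inl hx.ne')
  · intro x _
    have : HasDerivAt (fun u => 1 - Real.cos (y * u)) (-(-Real.sin (y * x) * (y * 1))) x :=
      (((hasDerivAt_id x).const_mul y).cos).const_sub 1
    exact this.congr_deriv (by ring)
  · refine ((integrableOn_sin_mul_rpow hγ hγ1 y).const_mul y).congr (ae_of_all _ fun u => ?_)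
    simp only [Pi.mul_apply]
    ring
  · refine (h1.const_mul (-(1 + γ))).congr (ae_of_all _ fun u => ?_)
    simp only [Pi.mul_apply]
    ring
  · have h0 : Tendsto (fun u : ℝ => y ^ 2 / 2 * u ^ (1 - γ)) (𝓝[>] 0) (𝓝 0) := by
      have : ContinuousAt (fun u : ℝ => y ^ 2 / 2 * u ^ (1 - γ)) 0 :=
        continuousAt_const.mul (Real.continuousAt_rpow_const _ _ (Or.inr (by linarith)))
      have h := this.tendsto
      simp only [Real.zero_rpow (show 1 - γ ≠ 0 by linarith), mul_zero] at h
      exact h.mono_left nhdsWithin_le_nhds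
    refine tendsto_of_tendsto_of_tendsto_of_le_of_le' tendsto_const_nhds h0 ?_ ?_
    · filter_upwards [self_mem_nhdsWithin] with u (hu : 0 < u)
      have := Real.cos_le_one (y * u)
      exact mul_nonneg (Real.rpow_nonneg hu.le _) (by linarith)
    · filter_upwards [self_mem_nhdsWithin] with u (hu : 0 < u)
      calc u ^ (-(1 + γ)) * (1 - Real.cos (y * u)) ≤ u ^ (-(1 + γ)) * ((y * u) ^ 2 / 2) := by
            gcongr
            exact one_sub_cos_le_sq _
        _ = y ^ 2 / 2 * (u ^ (-(1 + γ)) * u ^ (2 : ℝ)) := by rw [Real.rpow_two]; ring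
        _ = _ := by rw [← Real.rpow_add hu]; ring_nf
  · have h0 : Tendsto (fun u : ℝ => 2 * u ^ (-(1 + γ))) atTop (𝓝 0) := by
      simpa using (tendsto_rpow_neg_atTop (show 0 < 1 + γ by linarith)).const_mul 2
    refine tendsto_of_tendsto_of_tendsto_of_le_of_le' tendsto_const_nhds h0 ?_ ?_
    · filter_upwards [eventually_gt_atTop 0] with u hu
      have := Real.cos_le_one (y * u)
      exact mul_nonneg (Real.rpow_nonneg hu.le _) (by linarith)
    · filter_upwards [eventually_gt_atTop 0] with u hu
      have := Real.neg_one_le_cos (y * u)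
      rw [mul_comm 2]
      exact mul_le_mul_of_nonneg_left (by linarith) (Real.rpow_nonneg hu.le _)

/-- The Lévy-Khintchine representation of the symbol of the one-sided stable law. -/
theorem integral_one_sub_cexp {γ : ℝ} (hγ : 0 < γ) (hγ1 : γ < 1) (y : ℝ) :
    IntegrableOn (fun u : ℝ => ((u ^ (-(1 + γ)) : ℝ) : ℂ) * (1 - Complex.exp (y * u * Complex.I)))
      (Ioi 0) ∧
    ∫ u in Ioi (0 : ℝ), ((u ^ (-(1 + γ)) : ℝ) : ℂ) * (1 - Complex.exp (y * u * Complex.I)) =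
      ((Real.Gamma (1 - γ) / γ : ℝ) : ℂ) * stableSymbol γ (-γ) y := by
  obtain ⟨h1, h2⟩ := integral_one_sub_cos_div_rpow hγ (by linarith) y
  have h3 := integrableOn_sin_mul_rpow hγ hγ1 y
  have h4 := integral_sin_mul_rpow hγ hγ1 y
  have e : ∀ u ∈ Ioi (0 : ℝ), ((u ^ (-(1 + γ)) : ℝ) : ℂ) * (1 - Complex.exp (y * u * Complex.I)) =
      (((1 - Real.cos (y * u)) / u ^ (1 + γ) : ℝ) : ℂ) -
        ((Real.sin (y * u) * u ^ (-(1 + γ)) : ℝ) : ℂ) * Complex.I := by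
    intro u (hu : 0 < u)
    rw [Real.rpow_neg hu.le, Complex.exp_mul_I]
    push_cast
    ring
  have h1c : IntegrableOn (fun u : ℝ => (((1 - Real.cos (y * u)) / u ^ (1 + γ) : ℝ) : ℂ)) (Ioi 0) :=
    h1.ofReal
  have h3c : IntegrableOn (fun u : ℝ => ((Real.sin (y * u) * u ^ (-(1 + γ)) : ℝ) : ℂ) * Complex.I)
      (Ioi 0) := h3.ofReal.mul_const Complex.I
  constructor
  · exact IntegrableOn.congr_fun (h1c.sub h3c) (fun u hu => (e u hu).symm)
      measurableSet_Ioi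
  · rw [setIntegral_congr_fun measurableSet_Ioi e,
      integral_sub h1c h3c, integral_mul_const,
      integral_complex_ofReal, integral_complex_ofReal, h2, h4]
    have hsin : 0 < Real.sin (Real.pi * γ / 2) := by
      apply Real.sin_pos_of_pos_of_lt_pi
      · have := Real.pi_pos
        positivity
      · nlinarith [Real.pi_pos]
    have hc : 0 < Real.cos (Real.pi * γ / 2) := by
      apply Real.cos_pos_of_mem_Ioo
      constructor <;> nlinarith [Real.pi_pos]
    have hG := Real.Gamma_pos_of_pos hγ
    -- Reflection together with `sin (π γ) = 2 sin (π γ / 2) cos (π γ / 2)` turns the separate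
    -- constants of the real and imaginary parts into the single factor `Γ(1 - γ) / γ`.
    have href : Real.Gamma (1 - γ) =
        Real.pi / (2 * Real.sin (Real.pi * γ / 2) * Real.cos (Real.pi * γ / 2)) / Real.Gamma γ := by
      rw [← Real.sin_two_mul, eq_div_iff hG.ne', mul_comm, Real.Gamma_mul_Gamma_one_sub]
      ring_nf
    have hsym : stableSymbol γ (-γ) y = ((|y| ^ γ * Real.cos (Real.pi * γ / 2) : ℝ) : ℂ) -
        ((Real.sign y * |y| ^ γ * Real.sin (Real.pi * γ / 2) : ℝ) : ℂ) * Complex.I := by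
      rcases lt_trichotomy y 0 with h | rfl | h
      · rw [stableSymbol, Real.sign_of_neg h, mul_comm Complex.I, Complex.exp_mul_I,
          show -1 * -γ * Real.pi / 2 = Real.pi * γ / 2 by ring, ← Complex.ofReal_cos,
          ← Complex.ofReal_sin]
        push_cast
        ring
      · simp [stableSymbol, Real.zero_rpow hγ.ne']
      · rw [stableSymbol, Real.sign_of_pos h, mul_comm Complex.I, Complex.exp_mul_I,
          show 1 * -γ * Real.pi / 2 = -(Real.pi * γ / 2) by ring, ← Complex.ofReal_cos,
          ← Complex.ofReal_sin, Real.cos_neg, Real.sin_neg]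
        push_cast
        ring
    rw [hsym, href, add_comm 1 γ, Real.Gamma_add_one hγ.ne']
    rw [mul_sub, ← mul_assoc, ← Complex.ofReal_mul, ← Complex.ofReal_mul]
    congr 1
    · rw [Complex.ofReal_inj]
      field_simp
    · congr 1
      rw [Complex.ofReal_inj]
      field_simp

/-! ### Existence of the one-sided stable law -/

/-- The existence half of Lévy's continuity theorem: continuity of the limit at 0 gives tightness,
Prokhorov gives a cluster point, and its characteristic function must be the limit. -/
theorem exists_charFun_eq_of_tendsto {μ : ℕ → ProbabilityMeasure ℝ} {f : ℝ → ℂ}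
    (hf : ContinuousAt f 0)
    (h : ∀ t, Tendsto (fun n => charFun (μ n : Measure ℝ) t) atTop (𝓝 (f t))) :
    ∃ ν : ProbabilityMeasure ℝ, ∀ t, charFun (ν : Measure ℝ) t = f t := by
  have ht : IsTightMeasureSet {((μ n : ProbabilityMeasure ℝ) : Measure ℝ) | n} :=
    isTightMeasureSet_of_tendsto_charFun hf h
  have hc : IsCompact (closure {μ n | n}) :=
    isCompact_closure_of_isTightMeasureSet (by simpa using ht)
  -- A limit along an ultrafilter finer than `atTop` replaces the extraction of a subsequence.
  obtain ⟨ν, -, hν : Tendsto _ _ _⟩ := hc.ultrafilter_le_nhds ((hyperfilter ℕ).map μ)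
    (.trans (by simp) (Filter.monotone_principal subset_closure))
  refine ⟨ν, fun t => ?_⟩
  have hν' : Tendsto μ (hyperfilter ℕ : Filter ℕ) (𝓝 ν) := hν
  rw [ProbabilityMeasure.tendsto_iff_forall_integral_rclike_tendsto ℂ] at hν'
  have h1 := hν' (BoundedContinuousFunction.innerProbChar t)
  simp_rw [← charFun_eq_integral_innerProbChar] at h1
  exact tendsto_nhds_unique h1 ((h t).mono_left Nat.hyperfilter_le_atTop)

theorem exists_charFun_eq_pow (μ : ProbabilityMeasure ℝ) (n : ℕ) :
    ∃ ν : ProbabilityMeasure ℝ, ∀ t, charFun (ν : Measure ℝ) t = charFun (μ : Measure ℝ) t ^ n := by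
  induction n with
  | zero => exact ⟨⟨Measure.dirac 0, inferInstance⟩, fun t => by simp⟩
  | succ n ih =>
    obtain ⟨ν, hν⟩ := ih
    exact ⟨⟨(ν : Measure ℝ) ∗ (μ : Measure ℝ), inferInstance⟩, fun t => by
      simp [charFun_conv, hν, pow_succ]⟩

/-- The Pareto density is the stable Lévy measure `u ^ (-1-γ) du` cut off below t and normalised, so
this difference is a truncated Lévy-Khintchine integral. -/
theorem charFun_paretoMeasure_sub_one {t γ : ℝ} (ht : 0 < t) (hγ : 0 < γ) (y : ℝ) :
    charFun (paretoMeasure t γ) y - 1 = -((γ * t ^ γ : ℝ) : ℂ) *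
      ∫ u in Ici t, ((u ^ (-(1 + γ)) : ℝ) : ℂ) * (1 - Complex.exp (y * u * Complex.I)) := by
  have := isProbabilityMeasure_paretoMeasure ht hγ
  have h0 : Integrable (fun x : ℝ => Complex.exp (y * x * Complex.I)) (paretoMeasure t γ) := by
    refine (integrable_const (1 : ℝ)).mono' (by fun_prop) (ae_of_all _ fun x => ?_)
    rw [← Complex.ofReal_mul, Complex.norm_exp_ofReal_mul_I]
  have h1 : charFun (paretoMeasure t γ) y - 1 =
      ∫ u, (Complex.exp (y * u * Complex.I) - 1) ∂(paretoMeasure t γ) := by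
    rw [integral_sub h0 (integrable_const _), charFun_apply_real]
    simp
  rw [h1, paretoMeasure, integral_withDensity_eq_integral_toReal_smul]
  · rw [← integral_const_mul, ← integral_indicator measurableSet_Ici]
    congr 1 with u
    rw [paretoPDF, ENNReal.toReal_ofReal (paretoPDFReal_nonneg ht.le hγ.le u)]
    by_cases hu : t ≤ u
    · rw [indicator_of_mem (mem_Ici.2 hu), paretoPDFReal, if_pos hu, add_comm γ 1]
      simp only [Complex.real_smul]
      push_cast
      ring
    · rw [indicator_of_notMem (by simpa using hu), paretoPDFReal, if_neg hu, zero_smul]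
  · exact (measurable_paretoPDFReal t γ).ennreal_ofReal
  · exact ae_of_all _ fun x => by simp [paretoPDF]

/-- The jump of the sign at 0 is harmless: splitting y into positive and negative parts gives two
terms, each with a constant phase and a continuous modulus vanishing at 0. -/
theorem continuous_stableSymbol {γ : ℝ} (hγ : 0 < γ) (θ : ℝ) :
    Continuous (stableSymbol γ θ) := by
  have h1 : ∀ y, stableSymbol γ θ y =
      ((max y 0 ^ γ : ℝ) : ℂ) * Complex.exp (Complex.I * ((θ * Real.pi / 2 : ℝ) : ℂ)) +
      ((max (-y) 0 ^ γ : ℝ) : ℂ) * Complex.exp (Complex.I * ((-θ * Real.pi / 2 : ℝ) : ℂ)) := by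
    intro y
    rw [stableSymbol]
    rcases lt_trichotomy y 0 with h | rfl | h
    · rw [Real.sign_of_neg h, abs_of_neg h, max_eq_right h.le, max_eq_left (by linarith),
        Real.zero_rpow hγ.ne']
      simp
    · simp [Real.zero_rpow hγ.ne']
    · rw [Real.sign_of_pos h, abs_of_pos h, max_eq_left h.le, max_eq_right (by linarith),
        Real.zero_rpow hγ.ne']
      simp
  simp_rw [funext h1]
  have h2 : Continuous fun y : ℝ => max y 0 ^ γ :=
    (continuous_id.max continuous_const).rpow_const fun _ => Or.inr hγ.le
  have h3 : Continuous fun y : ℝ => max (-y) 0 ^ γ :=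
    (continuous_neg.max continuous_const).rpow_const fun _ => Or.inr hγ.le
  exact ((Complex.continuous_ofReal.comp h2).mul continuous_const).add
    ((Complex.continuous_ofReal.comp h3).mul continuous_const)

/-- The law of a sum of n + 1 independent Pareto variables with shrinking threshold has
characteristic function `(1 + z_n) ^ (n+1)`, where `(n+1) z_n` tends to minus the symbol as the
truncation disappears. -/
theorem exists_stable_law {γ : ℝ} (hγ : 0 < γ) (hγ1 : γ < 1) :
    ∃ ν : ProbabilityMeasure ℝ, ∀ y, charFun (ν : Measure ℝ) y =
      Complex.exp (-stableSymbol γ (-γ) y) := by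
  have hG := Real.Gamma_pos_of_pos (show 0 < 1 - γ by linarith)
  -- The threshold is fixed by `(n + 1) * t n ^ γ = 1 / Γ(1 - γ)`, which cancels the constant of the
  -- Lévy-Khintchine integral.
  set t : ℕ → ℝ := fun n => ((n : ℝ) + 1)⁻¹ ^ (1 / γ) * (Real.Gamma (1 - γ))⁻¹ ^ (1 / γ) with ht
  have htpos : ∀ n, 0 < t n := fun n => by positivity
  have htγ : ∀ n, t n ^ γ = ((n : ℝ) + 1)⁻¹ * (Real.Gamma (1 - γ))⁻¹ := by
    intro n
    rw [ht, Real.mul_rpow (by positivity) (by positivity), ← Real.rpow_mul (by positivity),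
      ← Real.rpow_mul (by positivity), one_div_mul_cancel hγ.ne', Real.rpow_one, Real.rpow_one]
  have htlim : Tendsto t atTop (𝓝 0) := by
    have h1 : Tendsto (fun n : ℕ => ((n : ℝ) + 1)⁻¹ ^ (1 / γ)) atTop (𝓝 0) := by
      have h2 : Tendsto (fun n : ℕ => ((n : ℝ) + 1)⁻¹) atTop (𝓝 0) := by
        simpa using tendsto_one_div_add_atTop_nhds_zero_nat (𝕜 := ℝ)
      have := h2.rpow_const (p := 1 / γ) (Or.inr (by positivity))
      rwa [Real.zero_rpow (by positivity)] at this
    have := h1.mul_const ((Real.Gamma (1 - γ))⁻¹ ^ (1 / γ))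
    rwa [zero_mul] at this
  choose ν hν using fun n => exists_charFun_eq_pow
    ⟨paretoMeasure (t n) γ, isProbabilityMeasure_paretoMeasure (htpos n) hγ⟩ (n + 1)
  refine exists_charFun_eq_of_tendsto (μ := ν)
    ((continuous_stableSymbol hγ _).neg.cexp.continuousAt) fun y => ?_
  obtain ⟨hi, he⟩ := integral_one_sub_cexp hγ hγ1 y
  have hcover := aecover_Ioi_of_Ici (μ := volume) (A := (0 : ℝ)) htlim
  have hlim := hcover.integral_tendsto_of_countably_generated hi
  have hrestr : ∀ n, (volume.restrict (Ioi (0 : ℝ))).restrict (Ici (t n)) =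
      volume.restrict (Ici (t n)) := fun n => by
    rw [Measure.restrict_restrict measurableSet_Ici, inter_eq_left.2]
    exact fun x hx => (htpos n).trans_le hx
  simp_rw [hrestr] at hlim
  rw [he] at hlim
  have hlim2 : Tendsto (fun n : ℕ => ((n + 1 : ℕ) : ℂ) *
      (charFun (paretoMeasure (t n) γ) y - 1)) atTop (𝓝 (-stableSymbol γ (-γ) y)) := by
    have := hlim.const_mul (-((γ / Real.Gamma (1 - γ) : ℝ) : ℂ))
    convert! this using 2 with n
    · rw [charFun_paretoMeasure_sub_one (htpos n) hγ, ← mul_assoc, htγ]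
      congr 1
      push_cast
      have : ((n : ℂ) + 1) ≠ 0 := by exact_mod_cast n.succ_ne_zero
      field_simp
    · rw [← mul_assoc, neg_mul, ← Complex.ofReal_mul, div_mul_div_cancel₀ hG.ne', div_self hγ.ne']
      simp
  simp_rw [hν]
  have h3 := Complex.tendsto_one_add_pow_exp_of_tendsto
    (g := fun n : ℕ => charFun (paretoMeasure (t (n - 1)) γ) y - 1) (t := -stableSymbol γ (-γ) y) ?_
  · have := h3.comp (tendsto_add_atTop_nat 1)
    refine this.congr fun n => ?_
    simp
  · rw [← tendsto_add_atTop_iff_nat 1]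
    simpa using hlim2

/-! ### The Gamma integral at a complex rate -/

theorem integrableOn_rpow_mul_exp_neg_mul {a r : ℝ} (ha : 0 < a) (hr : 0 < r) :
    IntegrableOn (fun y : ℝ => y ^ (a - 1) * Real.exp (-(r * y))) (Ioi 0) := by
  apply integrable_of_integral_pos
  rw [Real.integral_rpow_mul_exp_neg_mul_Ioi ha hr]
  have := Real.Gamma_pos_of_pos ha
  positivity

/-- Both sides are analytic on the right half-plane, the left one as the complex moment generating
function of `y ^ (a-1) dy`, and they agree at the real points `1 + 1/(n+1)`, which accumulate at 1.
-/
theorem integral_rpow_mul_cexp_neg_mul {a : ℝ} {p : ℂ} (ha : 0 < a) (hp : 0 < p.re) :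
    ∫ y in Ioi (0 : ℝ), ((y ^ (a - 1) : ℝ) : ℂ) * Complex.exp (-(p * y)) =
      (Real.Gamma a : ℂ) * p ^ (-(a : ℂ)) := by
  set μ : Measure ℝ := (volume.restrict (Ioi 0)).withDensity
    (fun y => ENNReal.ofReal (y ^ (a - 1))) with hμ
  have hmeas : Measurable fun y : ℝ => ENNReal.ofReal (y ^ (a - 1)) := by fun_prop
  have hset : Iio 0 ⊆ integrableExpSet (id : ℝ → ℝ) μ := by
    intro r (hr : r < 0)
    change Integrable _ _
    rw [hμ, integrable_withDensity_iff hmeas (ae_of_all _ fun _ => ENNReal.ofReal_lt_top)]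
    refine (integrableOn_rpow_mul_exp_neg_mul ha (neg_pos.2 hr)).congr_fun (fun y hy => ?_)
      measurableSet_Ioi
    rw [ENNReal.toReal_ofReal (Real.rpow_nonneg (le_of_lt hy) _)]
    simp [mul_comm]
  have hint : ∀ z : ℂ, complexMGF id μ (-z) =
      ∫ y in Ioi (0 : ℝ), ((y ^ (a - 1) : ℝ) : ℂ) * Complex.exp (-(z * y)) := by
    intro z
    rw [complexMGF, hμ, integral_withDensity_eq_integral_toReal_smul hmeas
      (ae_of_all _ fun _ => ENNReal.ofReal_lt_top)]
    refine setIntegral_congr_fun measurableSet_Ioi fun y hy => ?_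
    rw [ENNReal.toReal_ofReal (Real.rpow_nonneg (le_of_lt hy) _), Complex.real_smul]
    simp
  have hsub : ∀ z : ℂ, 0 < z.re → (-z).re ∈ interior (integrableExpSet (id : ℝ → ℝ) μ) := by
    intro z hz
    refine interior_mono hset ?_
    rw [interior_Iio]
    simpa using hz
  have hopen : IsOpen {z : ℂ | 0 < z.re} := isOpen_lt continuous_const Complex.continuous_re
  have h1 : AnalyticOnNhd ℂ (fun z => complexMGF id μ (-z)) {z : ℂ | 0 < z.re} := by
    apply DifferentiableOn.analyticOnNhd _ hopen
    intro z hz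
    have := (hasDerivAt_complexMGF (hsub z hz)).differentiableAt
    exact (this.comp z differentiableAt_id.neg).differentiableWithinAt
  have h2 : AnalyticOnNhd ℂ (fun z => (Real.Gamma a : ℂ) * z ^ (-(a : ℂ))) {z : ℂ | 0 < z.re} := by
    apply DifferentiableOn.analyticOnNhd _ hopen
    intro z hz
    exact ((differentiableAt_id.cpow_const (Or.inl hz)).const_mul _).differentiableWithinAt
  have hpre : IsPreconnected {z : ℂ | 0 < z.re} :=
    (convex_halfSpace_re_gt 0).isPreconnected
  have hfreq : ∃ᶠ z in 𝓝[≠] (1 : ℂ), complexMGF id μ (-z) = (Real.Gamma a : ℂ) * z ^ (-(a : ℂ)) := by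
    have ht : Tendsto (fun n : ℕ => ((1 + 1 / ((n : ℝ) + 1) : ℝ) : ℂ)) atTop (𝓝[≠] 1) := by
      rw [tendsto_nhdsWithin_iff]
      constructor
      · have := (tendsto_one_div_add_atTop_nhds_zero_nat (𝕜 := ℝ)).const_add 1
        rw [add_zero] at this
        exact (Complex.continuous_ofReal.tendsto' 1 1 (by simp)).comp this
      · refine Eventually.of_forall fun n => ?_
        have : (0 : ℝ) < 1 / ((n : ℝ) + 1) := by positivity
        simp only [mem_compl_iff, mem_singleton_iff]
        rw [← Complex.ofReal_one, Complex.ofReal_inj]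
        linarith
    refine ht.frequently (Frequently.of_forall fun n => ?_)
    set r : ℝ := 1 + 1 / ((n : ℝ) + 1) with hr
    have hr0 : 0 < r := by positivity
    rw [hint]
    have := Real.integral_rpow_mul_exp_neg_mul_Ioi ha hr0
    have e : ∀ y : ℝ, ((y ^ (a - 1) : ℝ) : ℂ) * Complex.exp (-((r : ℂ) * y)) =
        ((y ^ (a - 1) * Real.exp (-(r * y)) : ℝ) : ℂ) := by
      intro y
      push_cast
      rfl
    simp_rw [e]
    rw [integral_complex_ofReal, this, one_div, Real.inv_rpow hr0.le, ← Real.rpow_neg hr0.le,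
      Complex.ofReal_mul, Complex.ofReal_cpow hr0.le, mul_comm]
    simp
  rw [← hint]
  exact h1.eqOn_of_preconnected_of_frequently_eq h2 hpre (by simp) hfreq hp

/-! ### Growth of the Gamma function -/

/-- Log-convexity of Γ between the points 1 and k + 1. The resulting gain `(k!) ^ (γ - 1)` makes the
stable series converge for every argument. -/
theorem Gamma_mul_add_one_le {γ : ℝ} (hγ : 0 < γ) (hγ1 : γ < 1) (k : ℕ) :
    Real.Gamma (γ * k + 1) ≤ (k.factorial : ℝ) ^ γ := by
  have := Real.Gamma_mul_add_mul_le_rpow_Gamma_mul_rpow_Gamma (s := (k : ℝ) + 1) (t := 1)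
    (a := γ) (b := 1 - γ) (by positivity) one_pos hγ (by linarith) (by ring)
  rw [Real.Gamma_nat_eq_factorial, Real.Gamma_one, Real.one_rpow, mul_one, mul_one] at this
  rwa [show γ * k + 1 = γ * (k + 1) + (1 - γ) * 1 by ring, mul_one (1 - γ)]

theorem summable_Gamma_mul_pow_div_factorial {γ : ℝ} (hγ : 0 < γ) (hγ1 : γ < 1) (R : ℝ) :
    Summable fun k : ℕ => Real.Gamma (γ * k + 1) / k.factorial * |R| ^ k := by
  rcases eq_or_ne R 0 with rfl | hR
  · refine summable_of_ne_finset_zero (s := {0}) fun k hk => ?_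
    simp only [Finset.mem_singleton] at hk
    simp [hk]
  have hR' := abs_pos.2 hR
  have h : Summable fun k : ℕ => ((k.factorial : ℝ) ^ (1 - γ))⁻¹ * |R| ^ k := by
    refine summable_of_ratio_test_tendsto_lt_one (l := 0) one_pos
      (Eventually.of_forall fun k => by positivity) ?_
    have h1 : Tendsto (fun k : ℕ => |R| * ((k : ℝ) + 1) ^ (-(1 - γ))) atTop (𝓝 0) := by
      have h2 := (tendsto_rpow_neg_atTop (show 0 < 1 - γ by linarith)).comp
        (tendsto_atTop_add_const_right _ (1 : ℝ) tendsto_natCast_atTop_atTop)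
      simpa using h2.const_mul |R|
    refine h1.congr fun k => ?_
    rw [Real.norm_of_nonneg (by positivity), Real.norm_of_nonneg (by positivity),
      Nat.factorial_succ, Nat.cast_mul, Real.mul_rpow (by positivity) (by positivity), pow_succ,
      Real.rpow_neg (by positivity)]
    push_cast
    field_simp
  refine Summable.of_nonneg_of_le (fun k => ?_) (fun k => ?_) h
  · have := Real.Gamma_pos_of_pos (show 0 < γ * k + 1 by positivity)
    positivity
  · have := Gamma_mul_add_one_le hγ hγ1 k
    have hk : (0 : ℝ) < k.factorial := by positivity
    gcongr
    rw [div_le_iff₀ hk]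
    calc Real.Gamma (γ * k + 1) ≤ (k.factorial : ℝ) ^ γ := this
      _ = _ := by
        rw [← Real.rpow_neg hk.le]
        nth_rewrite 3 [← Real.rpow_one (k.factorial : ℝ)]
        rw [← Real.rpow_add hk]
        ring_nf

/-! ### Series expansion of the stable density -/

/-- Expand `exp (-c y ^ γ)` and integrate termwise. The real part of p controls every term, and `γ <
1` makes the norms summable. -/
theorem hasSum_integral_exp_rpow {γ : ℝ} (hγ : 0 < γ) (hγ1 : γ < 1) (c : ℂ) {p : ℂ}
    (hp : 0 < p.re) :
    HasSum (fun k : ℕ => (-c) ^ k / k.factorial *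
        ((Real.Gamma (γ * k + 1) : ℂ) * p ^ (-((γ * k + 1 : ℝ) : ℂ))))
      (∫ y in Ioi (0 : ℝ), Complex.exp (-(p * y)) * Complex.exp (-(c * ((y ^ γ : ℝ) : ℂ)))) := by
  have hpos : ∀ k : ℕ, 0 < γ * k + 1 := fun k => by positivity
  set F : ℕ → ℝ → ℂ := fun k y => (-c) ^ k / k.factorial *
    (((y ^ (γ * k + 1 - 1) : ℝ) : ℂ) * Complex.exp (-(p * y))) with hF
  have hnorm : ∀ k : ℕ, ∀ y ∈ Ioi (0 : ℝ), ‖F k y‖ = ‖c‖ ^ k / k.factorial *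
      (y ^ (γ * k + 1 - 1) * Real.exp (-(p.re * y))) := by
    intro k y hy
    have hy' : 0 ≤ y ^ (γ * k + 1 - 1) := Real.rpow_nonneg (le_of_lt hy) _
    simp only [hF, norm_mul, norm_div, norm_pow, norm_neg, Complex.norm_natCast,
      Complex.norm_real, Complex.norm_exp, Real.norm_of_nonneg hy']
    simp
  have hFi : ∀ k, IntegrableOn (F k) (Ioi 0) := by
    intro k
    refine ((integrableOn_rpow_mul_exp_neg_mul (hpos k) hp).const_mul
      (‖c‖ ^ k / k.factorial)).mono' ?_ ?_
    · apply Measurable.aestronglyMeasurable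
      simp only [hF]
      fun_prop
    · exact (ae_restrict_iff' measurableSet_Ioi).2 (ae_of_all _ fun y hy => (hnorm k y hy).le)
  have hsum : Summable fun k => ∫ y in Ioi (0 : ℝ), ‖F k y‖ := by
    have h1 : ∀ k : ℕ, ∫ y in Ioi (0 : ℝ), ‖F k y‖ = 1 / p.re *
        (Real.Gamma (γ * k + 1) / k.factorial * |‖c‖ * (1 / p.re) ^ γ| ^ k) := by
      intro k
      rw [setIntegral_congr_fun measurableSet_Ioi (hnorm k), integral_const_mul,
        Real.integral_rpow_mul_exp_neg_mul_Ioi (hpos k) hp, abs_of_nonneg (by positivity),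
        Real.rpow_add (by positivity), Real.rpow_one, mul_pow, Real.rpow_mul (by positivity),
        Real.rpow_natCast]
      ring
    simp_rw [h1]
    exact (summable_Gamma_mul_pow_div_factorial hγ hγ1 _).mul_left _
  have key := hasSum_integral_of_summable_integral_norm hFi hsum
  have e1 : ∀ k, ∫ y in Ioi (0 : ℝ), F k y = (-c) ^ k / k.factorial *
        ((Real.Gamma (γ * k + 1) : ℂ) * p ^ (-((γ * k + 1 : ℝ) : ℂ))) := by
    intro k
    simp only [hF]
    rw [integral_const_mul, integral_rpow_mul_cexp_neg_mul (hpos k) hp]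
  have e2 : ∫ y in Ioi (0 : ℝ), ∑' k, F k y = ∫ y in Ioi (0 : ℝ),
      Complex.exp (-(p * y)) * Complex.exp (-(c * ((y ^ γ : ℝ) : ℂ))) := by
    refine setIntegral_congr_fun measurableSet_Ioi fun y (hy : 0 < y) => ?_
    have h3 := (NormedSpace.expSeries_div_hasSum_exp (-(c * ((y ^ γ : ℝ) : ℂ)))).mul_left
      (Complex.exp (-(p * y)))
    rw [← Complex.exp_eq_exp_ℂ] at h3
    rw [← h3.tsum_eq]
    congr 1 with k
    simp only [hF]
    rw [add_sub_cancel_right, Real.rpow_mul hy.le, Real.rpow_natCast, ← neg_mul c, mul_pow]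
    push_cast
    ring
  simp_rw [e1] at key
  rwa [e2] at key

theorem integrableOn_exp_neg_mul_rpow {γ b : ℝ} (hγ : 0 < γ) (hb : 0 < b) :
    IntegrableOn (fun y : ℝ => Real.exp (-b * y ^ γ)) (Ioi 0) := by
  apply integrable_of_integral_pos
  rw [integral_exp_neg_mul_rpow hγ hb]
  have := Real.Gamma_pos_of_pos (show 0 < 1 / γ + 1 by positivity)
  positivity

/-- Limit of the preceding expansion as `p = 1/(n+1) + i x` approaches the imaginary axis. The
series is dominated since `‖p‖ ≥ |x|`; the integral is dominated because `Re c > 0` makes `exp (-c y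
^ γ)` integrable by itself. -/
theorem integral_cexp_rpow_eq_tsum {γ : ℝ} (hγ : 0 < γ) (hγ1 : γ < 1) {c : ℂ} (hc : 0 < c.re)
    {x : ℝ} (hx : x ≠ 0) :
    HasSum (fun k : ℕ => (-c) ^ k / k.factorial *
        ((Real.Gamma (γ * k + 1) : ℂ) * (x * Complex.I) ^ (-((γ * k + 1 : ℝ) : ℂ))))
    (∫ y in Ioi (0 : ℝ), Complex.exp (-(x * Complex.I * y)) *
      Complex.exp (-(c * ((y ^ γ : ℝ) : ℂ)))) := by
  have hpos : ∀ k : ℕ, 0 < γ * k + 1 := fun k => by positivity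
  have hx' := abs_pos.2 hx
  set p : ℕ → ℂ := fun n => ((1 / ((n : ℝ) + 1) : ℝ) : ℂ) + x * Complex.I with hpdef
  have hpre : ∀ n, 0 < (p n).re := by
    intro n
    simp only [hpdef, Complex.add_re, Complex.ofReal_re, Complex.mul_re, Complex.I_re,
      Complex.I_im, Complex.ofReal_im]
    have : (0 : ℝ) < 1 / ((n : ℝ) + 1) := by positivity
    linarith
  have hplim : Tendsto p atTop (𝓝 (x * Complex.I)) := by
    have h1 := (Complex.continuous_ofReal.tendsto' 0 0 (by simp)).comp
      (tendsto_one_div_add_atTop_nhds_zero_nat (𝕜 := ℝ))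
    have := h1.add_const (x * Complex.I)
    rwa [zero_add] at this
  have hpnorm : ∀ n, |x| ≤ ‖p n‖ := by
    intro n
    have := Complex.abs_im_le_norm (p n)
    simpa [hpdef] using this
  have hcpow : ∀ (q : ℂ) (k : ℕ), |x| ≤ ‖q‖ → ‖(-c) ^ k / (k.factorial : ℂ) *
      ((Real.Gamma (γ * k + 1) : ℂ) * q ^ (-((γ * k + 1 : ℝ) : ℂ)))‖ ≤
      1 / |x| * (Real.Gamma (γ * k + 1) / k.factorial * |‖c‖ * (1 / |x|) ^ γ| ^ k) := by
    intro q k hq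
    have hG := Real.Gamma_pos_of_pos (hpos k)
    rw [← Complex.ofReal_neg, norm_mul, norm_mul, norm_div, norm_pow, norm_neg,
      Complex.norm_natCast, Complex.norm_real, Real.norm_of_nonneg hG.le, Complex.norm_cpow_real]
    have h1 : ‖q‖ ^ (-(γ * k + 1)) ≤ (1 / |x|) ^ (γ * k + 1) := by
      rw [one_div, Real.inv_rpow hx'.le, ← Real.rpow_neg hx'.le]
      exact Real.rpow_le_rpow_of_nonpos hx' hq (by have := hpos k; linarith)
    calc _ ≤ ‖c‖ ^ k / k.factorial * (Real.Gamma (γ * k + 1) * (1 / |x|) ^ (γ * k + 1)) := by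
          gcongr
      _ = _ := by
        rw [abs_of_nonneg (a := ‖c‖ * (1 / |x|) ^ γ) (by positivity), Real.rpow_add (by positivity),
          Real.rpow_one, mul_pow, Real.rpow_mul (by positivity), Real.rpow_natCast]
        ring
  have hsum := (summable_Gamma_mul_pow_div_factorial hγ hγ1 (‖c‖ * (1 / |x|) ^ γ)).mul_left
    (1 / |x|)
  have hterm := tendsto_tsum_of_dominated_convergence (𝓕 := atTop) hsum
    (f := fun (n : ℕ) (k : ℕ) => (-c) ^ k / (k.factorial : ℂ) *
      ((Real.Gamma (γ * k + 1) : ℂ) * (p n) ^ (-((γ * k + 1 : ℝ) : ℂ))))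
    (g := fun (k : ℕ) => (-c) ^ k / (k.factorial : ℂ) *
      ((Real.Gamma (γ * k + 1) : ℂ) * (x * Complex.I) ^ (-((γ * k + 1 : ℝ) : ℂ))))
    (fun k => by
      refine Tendsto.const_mul _ (Tendsto.const_mul _ ?_)
      have hs : (x * Complex.I : ℂ) ∈ Complex.slitPlane := by
        right
        simpa using hx
      exact (continuousAt_cpow_const hs).tendsto.comp hplim)
    (Eventually.of_forall fun n k => hcpow _ k (hpnorm n))
  have hint : Tendsto (fun n => ∫ y in Ioi (0 : ℝ), Complex.exp (-(p n * y)) *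
      Complex.exp (-(c * ((y ^ γ : ℝ) : ℂ)))) atTop (𝓝 (∫ y in Ioi (0 : ℝ),
      Complex.exp (-(x * Complex.I * y)) * Complex.exp (-(c * ((y ^ γ : ℝ) : ℂ))))) := by
    refine tendsto_integral_of_dominated_convergence (fun y => Real.exp (-c.re * y ^ γ))
      (fun n => ?_) (integrableOn_exp_neg_mul_rpow hγ hc) (fun n => ?_) ?_
    · apply Measurable.aestronglyMeasurable
      fun_prop
    · refine (ae_restrict_iff' measurableSet_Ioi).2 (ae_of_all _ fun y (hy : 0 < y) => ?_)
      rw [norm_mul, Complex.norm_exp, Complex.norm_exp, Complex.neg_re, Complex.neg_re,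
        Complex.re_mul_ofReal, Complex.re_mul_ofReal, neg_mul c.re]
      refine mul_le_of_le_one_left (Real.exp_pos _).le (Real.exp_le_one_iff.2 ?_)
      nlinarith [hpre n]
    · refine ae_of_all _ fun y => Tendsto.mul_const _ ?_
      exact (Complex.continuous_exp.tendsto _).comp ((hplim.mul_const (y : ℂ)).neg)
  have heq : ∀ n, ∑' k : ℕ, (-c) ^ k / (k.factorial : ℂ) *
      ((Real.Gamma (γ * k + 1) : ℂ) * (p n) ^ (-((γ * k + 1 : ℝ) : ℂ))) = _ :=
    fun n => (hasSum_integral_exp_rpow hγ hγ1 c (hpre n)).tsum_eq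
  simp_rw [heq] at hterm
  rw [tendsto_nhds_unique hint hterm]
  refine (Summable.of_norm_bounded hsum fun k => hcpow _ k ?_).hasSum
  simp

/-! ### Fourier inversion with the kernel `exp (i k x)` -/

-- Fourier inversion, transported to the kernel `exp (i k x)` by the substitution `k = -2 π w`.
open scoped FourierTransform in
theorem eq_integral_of_integrable_fourier {g : ℝ → ℂ} (hc : Continuous g) (hi : Integrable g)
    (hf : Integrable fun k : ℝ => ∫ x : ℝ, Complex.exp (Complex.I * k * x) * g x) (x : ℝ) :
    g x = 1 / (2 * (Real.pi : ℂ)) * ∫ k : ℝ, Complex.exp (-(Complex.I * k * x)) *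
      ∫ z : ℝ, Complex.exp (Complex.I * k * z) * g z := by
  set G : ℝ → ℂ := fun k => ∫ x : ℝ, Complex.exp (Complex.I * k * x) * g x with hG
  have h1 : ∀ w : ℝ, 𝓕 g w = G (-(2 * Real.pi) * w) := by
    intro w
    rw [Real.fourier_real_eq_integral_exp_smul, hG]
    refine integral_congr_ae (ae_of_all _ fun v => ?_)
    simp only [smul_eq_mul]
    congr 2
    push_cast
    ring
  have hpi : -(2 * Real.pi) ≠ 0 := by
    have := Real.pi_pos
    linarith
  have h2 : Integrable (𝓕 g) := by
    rw [show 𝓕 g = fun w => G (-(2 * Real.pi) * w) from funext h1]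
    exact hf.comp_mul_left' hpi
  have h3 := congrFun (hc.fourierInv_fourier_eq hi h2) x
  rw [← h3, Real.fourierInv_eq']
  have h4 := Measure.integral_comp_mul_left
    (fun k : ℝ => Complex.exp (-(Complex.I * k * x)) * G k) (-(2 * Real.pi))
  have h5 : ∀ v : ℝ, Complex.exp (((2 * Real.pi * inner ℝ v x : ℝ) : ℂ) * Complex.I) • 𝓕 g v =
      Complex.exp (-(Complex.I * ((-(2 * Real.pi) * v : ℝ) : ℂ) * x)) *
        G (-(2 * Real.pi) * v) := by
    intro v
    rw [h1, smul_eq_mul]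
    congr 2
    simp
    ring
  simp_rw [h5]
  rw [h4, inv_neg, abs_neg, abs_of_pos (inv_pos.2 (by have := Real.pi_pos; linarith)),
    Complex.real_smul]
  push_cast
  ring

/-! ### The symbol -/

theorem stableSymbol_neg (γ θ y : ℝ) :
    stableSymbol γ θ (-y) = (starRingEnd ℂ) (stableSymbol γ θ y) := by
  rw [stableSymbol, stableSymbol, map_mul, ← Complex.exp_conj, map_mul, Complex.conj_I,
    Complex.conj_ofReal, Complex.conj_ofReal, abs_neg]
  congr 2
  rcases lt_trichotomy y 0 with h | rfl | h
  · rw [Real.sign_of_neg h, Real.sign_of_pos (neg_pos.2 h)]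
    push_cast
    ring
  · simp
  · rw [Real.sign_of_pos h, Real.sign_of_neg (neg_neg_of_pos h)]
    push_cast
    ring

theorem stableSymbol_of_pos {y : ℝ} (γ θ : ℝ) (hy : 0 < y) : stableSymbol γ θ y =
    Complex.exp (Complex.I * ((θ * Real.pi / 2 : ℝ) : ℂ)) * ((y ^ γ : ℝ) : ℂ) := by
  rw [stableSymbol, Real.sign_of_pos hy, abs_of_pos hy, one_mul, mul_comm]

theorem re_stableSymbol {γ : ℝ} (hγ : 0 < γ) (θ y : ℝ) :
    (stableSymbol γ θ y).re = |y| ^ γ * Real.cos (θ * Real.pi / 2) := by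
  rw [stableSymbol, Complex.re_ofReal_mul, mul_comm Complex.I, Complex.exp_ofReal_mul_I_re]
  rcases lt_trichotomy y 0 with h | rfl | h
  · rw [Real.sign_of_neg h, ← Real.cos_neg]
    ring_nf
  · simp [Real.zero_rpow hγ.ne']
  · rw [Real.sign_of_pos h, one_mul]

theorem norm_exp_neg_stableSymbol {γ : ℝ} (hγ : 0 < γ) (θ y : ℝ) :
    ‖Complex.exp (-stableSymbol γ θ y)‖ = Real.exp (-Real.cos (θ * Real.pi / 2) * |y| ^ γ) := by
  rw [Complex.norm_exp, Complex.neg_re, re_stableSymbol hγ]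
  ring_nf

theorem cos_mul_pi_div_two_pos {γ : ℝ} (hγ : 0 < γ) (hγ1 : γ < 1) :
    0 < Real.cos (-γ * Real.pi / 2) := by
  apply Real.cos_pos_of_mem_Ioo
  constructor <;> nlinarith [Real.pi_pos]

theorem integrable_of_even_of_Ioi {E : Type*} [NormedAddCommGroup E] {f : ℝ → E}
    (h1 : IntegrableOn f (Ioi 0)) (h2 : IntegrableOn (fun x => f (-x)) (Ioi 0)) :
    Integrable f := by
  rw [← integrableOn_univ, ← Iic_union_Ioi (a := (0 : ℝ))]
  refine IntegrableOn.union ?_ h1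
  rw [integrableOn_Iic_iff_integrableOn_Iio]
  have := (integrable_indicator_iff measurableSet_Ioi).2 h2
  have h3 := this.comp_neg
  rw [← integrable_indicator_iff measurableSet_Iio]
  refine h3.congr (ae_of_all _ fun x => ?_)
  by_cases hx : x < 0
  · simp [indicator, hx]
  · simp [indicator, hx]

theorem integrable_exp_neg_mul_abs_rpow {γ b : ℝ} (hγ : 0 < γ) (hb : 0 < b) :
    Integrable fun y : ℝ => Real.exp (-b * |y| ^ γ) := by
  have h : IntegrableOn (fun y : ℝ => Real.exp (-b * |y| ^ γ)) (Ioi 0) :=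
    (integrableOn_exp_neg_mul_rpow hγ hb).congr_fun
      (fun y hy => by simp only [abs_of_pos (mem_Ioi.1 hy)]) measurableSet_Ioi
  exact integrable_of_even_of_Ioi h (by simpa using h)

theorem integrable_exp_neg_stableSymbol {γ : ℝ} (hγ : 0 < γ) (hγ1 : γ < 1) :
    Integrable fun y : ℝ => Complex.exp (-stableSymbol γ (-γ) y) := by
  refine (integrable_exp_neg_mul_abs_rpow hγ (cos_mul_pi_div_two_pos hγ hγ1)).mono'
    (continuous_stableSymbol hγ _).neg.cexp.aestronglyMeasurable (ae_of_all _ fun y => ?_)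
  rw [norm_exp_neg_stableSymbol hγ]

/-! ### The stable density -/

theorem integral_stable_neg (γ θ x : ℝ) {s : Set ℝ} :
    ∫ y in s, Complex.exp (-(Complex.I * x * ((-y : ℝ) : ℂ))) *
      Complex.exp (-stableSymbol γ θ (-y)) = (starRingEnd ℂ)
    (∫ y in s, Complex.exp (-(Complex.I * x * y)) * Complex.exp (-stableSymbol γ θ y)) := by
  rw [← integral_conj]
  congr 1 with y
  rw [map_mul, ← Complex.exp_conj, ← Complex.exp_conj, stableSymbol_neg]
  congr 2
  simp

/-- The real part in the definition discards nothing: reversing y conjugates the integrand. -/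
theorem ofReal_stableDensity (γ θ x : ℝ) : (stableDensity γ θ x : ℂ) =
    1 / (2 * (Real.pi : ℂ)) * ∫ y : ℝ, Complex.exp (-(Complex.I * x * y)) *
      Complex.exp (-stableSymbol γ θ y) := by
  rw [stableDensity, ← Complex.conj_eq_iff_re, map_mul, ← setIntegral_univ, ← integral_stable_neg]
  congr 1
  · rw [map_div₀, map_one, map_mul, Complex.conj_ofReal, map_ofNat]
  · rw [setIntegral_univ, setIntegral_univ]
    exact integral_neg_eq_self (fun y : ℝ => Complex.exp (-(Complex.I * x * y)) *
      Complex.exp (-stableSymbol γ θ y)) volume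

theorem integrable_stable_integrand {γ : ℝ} (hγ : 0 < γ) (hγ1 : γ < 1) (x : ℝ) :
    Integrable fun y : ℝ => Complex.exp (-(Complex.I * x * y)) *
      Complex.exp (-stableSymbol γ (-γ) y) := by
  refine (integrable_exp_neg_stableSymbol hγ hγ1).bdd_mul (c := 1) (by fun_prop)
    (ae_of_all _ fun y => ?_)
  rw [Complex.norm_exp]
  simp

theorem stableDensity_eq_re {γ : ℝ} (hγ : 0 < γ) (hγ1 : γ < 1) (x : ℝ) :
    stableDensity γ (-γ) x = 1 / Real.pi * (∫ y in Ioi (0 : ℝ),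
      Complex.exp (-(x * Complex.I * y)) *
        Complex.exp (-(Complex.exp (Complex.I * ((-γ * Real.pi / 2 : ℝ) : ℂ)) *
          ((y ^ γ : ℝ) : ℂ)))).re := by
  have hi := integrable_stable_integrand hγ hγ1 x
  set J := ∫ y in Ioi (0 : ℝ), Complex.exp (-(Complex.I * x * y)) *
      Complex.exp (-stableSymbol γ (-γ) y) with hJ
  have h1 : ∫ y : ℝ, Complex.exp (-(Complex.I * x * y)) *
      Complex.exp (-stableSymbol γ (-γ) y) = J + (starRingEnd ℂ) J := by
    rw [hJ, ← integral_stable_neg, ← intervalIntegral.integral_Iic_add_Ioi (b := 0)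
      hi.integrableOn hi.integrableOn, add_comm]
    congr 1
    have := integral_comp_neg_Ioi (0 : ℝ) (fun y : ℝ => Complex.exp (-(Complex.I * x * y)) *
      Complex.exp (-stableSymbol γ (-γ) y))
    rw [neg_zero] at this
    exact this.symm
  have h2 : J = ∫ y in Ioi (0 : ℝ), Complex.exp (-(x * Complex.I * y)) *
        Complex.exp (-(Complex.exp (Complex.I * ((-γ * Real.pi / 2 : ℝ) : ℂ)) *
          ((y ^ γ : ℝ) : ℂ))) := by
    refine setIntegral_congr_fun measurableSet_Ioi fun y hy => ?_
    rw [stableSymbol_of_pos _ _ hy, mul_comm Complex.I (x : ℂ)]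
  rw [← h2, stableDensity, h1, Complex.add_conj,
    show (1 : ℂ) / (2 * (Real.pi : ℂ)) = ((1 / (2 * Real.pi) : ℝ) : ℂ) by push_cast; rfl,
    ← Complex.ofReal_mul, Complex.ofReal_re]
  field_simp

theorem continuous_stableDensity {γ : ℝ} (hγ : 0 < γ) (hγ1 : γ < 1) :
    Continuous (stableDensity γ (-γ)) := by
  refine Complex.continuous_re.comp (continuous_const.mul ?_)
  refine continuous_of_dominated (fun x => (integrable_stable_integrand hγ hγ1 x).1)
    (bound := fun y => ‖Complex.exp (-stableSymbol γ (-γ) y)‖) (fun x => ae_of_all _ fun y => ?_)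
    (integrable_exp_neg_stableSymbol hγ hγ1).norm (ae_of_all _ fun y => by fun_prop)
  rw [norm_mul]
  refine mul_le_of_le_one_left (norm_nonneg _) ?_
  rw [Complex.norm_exp]
  simp

theorem exp_re_pos {γ : ℝ} (hγ : 0 < γ) (hγ1 : γ < 1) :
    0 < (Complex.exp (Complex.I * ((-γ * Real.pi / 2 : ℝ) : ℂ))).re := by
  rw [mul_comm, Complex.exp_ofReal_mul_I_re]
  exact cos_mul_pi_div_two_pos hγ hγ1

/-- For negative x the phase of `(-c) ^ k` and the phase of `(i x) ^ (-(γ k + 1))` combine, apart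
from a sign, to exactly i. Every term of the series is purely imaginary, so the real part vanishes.
-/
theorem stableDensity_of_neg {γ : ℝ} (hγ : 0 < γ) (hγ1 : γ < 1) {x : ℝ} (hx : x < 0) :
    stableDensity γ (-γ) x = 0 := by
  have h := Complex.hasSum_re
    (integral_cexp_rpow_eq_tsum hγ hγ1 (exp_re_pos hγ hγ1) (x := x) hx.ne)
  rw [stableDensity_eq_re hγ hγ1, ← h.tsum_eq]
  convert mul_zero _
  convert tsum_zero with k
  have hx' : 0 < -x := by linarith
  have e1 : ((x : ℂ) * Complex.I) = ((-x : ℝ) : ℂ) * (-Complex.I) := by push_cast; ring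
  have hne : (x : ℂ) * Complex.I ≠ 0 := by simp [hx.ne]
  have e2 : (-Complex.exp (Complex.I * ((-γ * Real.pi / 2 : ℝ) : ℂ))) ^ k / (k.factorial : ℂ) *
      ((Real.Gamma (γ * k + 1) : ℂ) * (x * Complex.I) ^ (-((γ * k + 1 : ℝ) : ℂ))) =
      (((-1) ^ k / k.factorial * Real.Gamma (γ * k + 1) *
        Real.exp (Real.log (-x) * -(γ * k + 1)) : ℝ) : ℂ) * Complex.I := by
    rw [Complex.cpow_def_of_ne_zero hne, e1, Complex.log_ofReal_mul hx' (by simp),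
      Complex.log_neg_I, neg_pow, ← Complex.exp_nat_mul, add_mul, Complex.exp_add]
    have e3 : Complex.exp (k * (Complex.I * ((-γ * Real.pi / 2 : ℝ) : ℂ))) *
        Complex.exp (-(Real.pi / 2) * Complex.I * -((γ * k + 1 : ℝ) : ℂ)) = Complex.I := by
      rw [← Complex.exp_add]
      convert Complex.exp_pi_div_two_mul_I using 2
      push_cast
      ring
    calc _ = (-1) ^ k / (k.factorial : ℂ) * (Real.Gamma (γ * k + 1) : ℂ) *
        Complex.exp (Real.log (-x) * -((γ * k + 1 : ℝ) : ℂ)) *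
        (Complex.exp (k * (Complex.I * ((-γ * Real.pi / 2 : ℝ) : ℂ))) *
        Complex.exp (-(Real.pi / 2) * Complex.I * -((γ * k + 1 : ℝ) : ℂ))) := by ring
      _ = _ := by
        rw [e3]
        push_cast
        ring
  rw [e2, Complex.re_ofReal_mul, Complex.I_re, mul_zero]

/-- For positive x the two phases combine to the angle `-(π γ k) - π / 2`, whose cosine is `-sin (π
γ k)`. -/
theorem hasSum_stableDensity {γ : ℝ} (hγ : 0 < γ) (hγ1 : γ < 1) {x : ℝ} (hx : 0 < x) :
    HasSum (fun k : ℕ => -(1 / Real.pi) * ((-1) ^ k / k.factorial * Real.Gamma (γ * k + 1) *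
      Real.sin (Real.pi * (γ * k)) * x ^ (-(γ * k + 1)))) (stableDensity γ (-γ) x) := by
  have h := (Complex.hasSum_re
    (integral_cexp_rpow_eq_tsum hγ hγ1 (exp_re_pos hγ hγ1) (x := x) hx.ne')).mul_left (1 / Real.pi)
  rw [stableDensity_eq_re hγ hγ1]
  refine h.congr_fun fun k => ?_
  rw [neg_mul, ← mul_neg]
  congr 1
  have hne : (x : ℂ) * Complex.I ≠ 0 := by simp [hx.ne']
  rw [Complex.cpow_def_of_ne_zero hne, Complex.log_ofReal_mul hx (by simp),
      Complex.log_I, neg_pow (Complex.exp _), ← Complex.exp_nat_mul, add_mul, Complex.exp_add]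
  have e3 : Complex.exp (k * (Complex.I * ((-γ * Real.pi / 2 : ℝ) : ℂ))) *
      Complex.exp (Real.pi / 2 * Complex.I * -((γ * k + 1 : ℝ) : ℂ)) =
      Complex.exp (((-(Real.pi * (γ * k)) - Real.pi / 2 : ℝ) : ℂ) * Complex.I) := by
    rw [← Complex.exp_add]
    congr 1
    push_cast
    ring
  have e4 : (-1) ^ k * Complex.exp (k * (Complex.I * ((-γ * Real.pi / 2 : ℝ) : ℂ))) /
        (k.factorial : ℂ) * ((Real.Gamma (γ * k + 1) : ℂ) *
        (Complex.exp (Real.log x * -((γ * k + 1 : ℝ) : ℂ)) *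
        Complex.exp (Real.pi / 2 * Complex.I * -((γ * k + 1 : ℝ) : ℂ)))) =
      (((-1) ^ k / k.factorial * Real.Gamma (γ * k + 1) *
        x ^ (-(γ * k + 1)) : ℝ) : ℂ) *
        Complex.exp (((-(Real.pi * (γ * k)) - Real.pi / 2 : ℝ) : ℂ) * Complex.I) := by
    rw [← e3, Real.rpow_def_of_pos hx]
    push_cast
    ring
  rw [e4, Complex.re_ofReal_mul, Complex.exp_ofReal_mul_I_re, Real.cos_sub_pi_div_two, Real.sin_neg]
  ring

theorem stableDensity_of_nonpos {γ : ℝ} (hγ : 0 < γ) (hγ1 : γ < 1) {x : ℝ} (hx : x ≤ 0) :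
    stableDensity γ (-γ) x = 0 := by
  have hcl : IsClosed {x | stableDensity γ (-γ) x = 0} :=
    isClosed_eq (continuous_stableDensity hγ hγ1) continuous_const
  have : closure (Iio (0 : ℝ)) ⊆ {x | stableDensity γ (-γ) x = 0} :=
    hcl.closure_subset_iff.2 fun x hx => stableDensity_of_neg hγ hγ1 hx
  rw [closure_Iio] at this
  exact this hx

/-- The term k = 0 vanishes because of its sine factor, so for `x ≥ 1` the slowest decay is that of
k = 1. -/
theorem exists_abs_stableDensity_le {γ : ℝ} (hγ : 0 < γ) (hγ1 : γ < 1) :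
    ∃ C : ℝ, ∀ x, 1 ≤ x → |stableDensity γ (-γ) x| ≤ C * x ^ (-(1 + γ)) := by
  have hs := summable_Gamma_mul_pow_div_factorial hγ hγ1 1
  simp only [abs_one, one_pow, mul_one] at hs
  refine ⟨1 / Real.pi * ∑' k : ℕ, Real.Gamma (γ * k + 1) / k.factorial, fun x hx => ?_⟩
  have hx0 : 0 < x := by linarith
  rw [← (hasSum_stableDensity hγ hγ1 hx0).tsum_eq, mul_assoc, ← tsum_mul_right, ← tsum_mul_left]
  rw [← Real.norm_eq_abs]
  refine tsum_of_norm_bounded ((hs.mul_right (x ^ (-(1 + γ)))).mul_left (1 / Real.pi)).hasSum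
    fun k => ?_
  have hG := Real.Gamma_pos_of_pos (show 0 < γ * k + 1 by positivity)
  rw [Real.norm_eq_abs, abs_mul, abs_neg, abs_of_pos (by have := Real.pi_pos; positivity)]
  refine mul_le_mul_of_nonneg_left ?_ (by have := Real.pi_pos; positivity)
  rcases Nat.eq_zero_or_pos k with rfl | hk
  · simp
    positivity
  · have h1 : x ^ (-(γ * k + 1)) ≤ x ^ (-(1 + γ)) := by
      apply Real.rpow_le_rpow_of_exponent_le hx
      have : (1 : ℝ) ≤ k := by exact_mod_cast hk
      nlinarith
    have h2 := Real.abs_sin_le_one (Real.pi * (γ * k))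
    rw [abs_mul, abs_mul, abs_mul, abs_div, abs_pow, abs_neg, abs_one, one_pow, abs_of_pos hG,
      abs_of_nonneg (Real.rpow_nonneg hx0.le _), Nat.abs_cast]
    calc 1 / (k.factorial : ℝ) * Real.Gamma (γ * k + 1) * |Real.sin (Real.pi * (γ * k))| *
          x ^ (-(γ * k + 1)) ≤ 1 / (k.factorial : ℝ) * Real.Gamma (γ * k + 1) * 1 *
          x ^ (-(1 + γ)) := by gcongr
      _ = _ := by ring

theorem integrable_stableDensity {γ : ℝ} (hγ : 0 < γ) (hγ1 : γ < 1) :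
    Integrable (stableDensity γ (-γ)) := by
  have hc := continuous_stableDensity hγ hγ1
  obtain ⟨C, hC⟩ := exists_abs_stableDensity_le hγ hγ1
  refine integrable_of_even_of_Ioi ?_ ?_
  · rw [← Ioc_union_Ioi_eq_Ioi zero_le_one]
    refine IntegrableOn.union hc.integrableOn_Ioc ?_
    refine Integrable.mono' ((integrableOn_Ioi_rpow_of_lt (a := -(1 + γ)) (by linarith)
      zero_lt_one).const_mul C) hc.aestronglyMeasurable ?_
    exact (ae_restrict_iff' measurableSet_Ioi).2
      (ae_of_all _ fun x hx => hC x (le_of_lt hx))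
  · refine (integrableOn_zero (ε' := ℝ)).congr_fun (fun x (hx : 0 < x) => ?_) measurableSet_Ioi
    rw [stableDensity_of_nonpos hγ hγ1 (by linarith)]

/-- Fourier inversion applied to the reflected characteristic function: its transform is `2 π` times
the density, and that is integrable by the tail bound. -/
theorem integral_cexp_mul_stableDensity {γ : ℝ} (hγ : 0 < γ) (hγ1 : γ < 1) (y : ℝ) :
    ∫ x : ℝ, Complex.exp (y * x * Complex.I) * (stableDensity γ (-γ) x : ℂ) =
      Complex.exp (-stableSymbol γ (-γ) y) := by
  have hpi : (2 * (Real.pi : ℂ)) ≠ 0 := by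
    simp [Real.pi_ne_zero]
  have h1 : ∀ k : ℝ, ∫ x : ℝ, Complex.exp (Complex.I * k * x) *
      Complex.exp (-stableSymbol γ (-γ) (-x)) = 2 * (Real.pi : ℂ) * stableDensity γ (-γ) k := by
    intro k
    rw [ofReal_stableDensity, ← mul_assoc, mul_one_div_cancel hpi, one_mul,
      ← integral_neg_eq_self]
    congr 1 with x
    congr 2
    · push_cast
      ring
    · rw [neg_neg]
  have h2 := eq_integral_of_integrable_fourier
    (g := fun x => Complex.exp (-stableSymbol γ (-γ) (-x)))
    (((continuous_stableSymbol hγ _).comp continuous_neg).neg.cexp)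
    (integrable_exp_neg_stableSymbol hγ hγ1).comp_neg ?_ (-y)
  · simp_rw [h1, neg_neg] at h2
    rw [h2, ← integral_const_mul]
    congr 1 with x
    rw [show -(Complex.I * x * ((-y : ℝ) : ℂ)) = y * x * Complex.I by push_cast; ring]
    field_simp
  · simp_rw [h1]
    exact (integrable_stableDensity hγ hγ1).ofReal.const_mul _

theorem charFun_withDensity_ofReal {f : ℝ → ℝ} (hf : Measurable f) (y : ℝ) :
    charFun (volume.withDensity fun x => ENNReal.ofReal (f x)) y =
      ∫ x : ℝ, Complex.exp (y * x * Complex.I) * ((max (f x) 0 : ℝ) : ℂ) := by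
  rw [charFun_apply_real, integral_withDensity_eq_integral_toReal_smul hf.ennreal_ofReal
    (ae_of_all _ fun _ => ENNReal.ofReal_lt_top)]
  congr 1 with x
  rw [ENNReal.toReal_ofReal', Complex.real_smul, mul_comm]

/-- The existing stable law ν has the same Fourier transform as the signed density L, so `ν + L⁻ =
L⁺` as measures. On the open set `L < 0` the right side vanishes, hence so does `L⁻`; an open
Lebesgue-null set is empty. -/
theorem stableDensity_nonneg {γ : ℝ} (hγ : 0 < γ) (hγ1 : γ < 1) (x : ℝ) :
    0 ≤ stableDensity γ (-γ) x := by
  obtain ⟨ν, hν⟩ := exists_stable_law hγ hγ1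
  have hc := continuous_stableDensity hγ hγ1
  have hi := integrable_stableDensity hγ hγ1
  set L := stableDensity γ (-γ) with hL
  have hmn : Measurable fun x => -L x := hc.measurable.neg
  set p := volume.withDensity fun x => ENNReal.ofReal (L x) with hp
  set n := volume.withDensity fun x => ENNReal.ofReal (-L x) with hn
  have : IsFiniteMeasure p := isFiniteMeasure_withDensity_ofReal hi.2
  have : IsFiniteMeasure n := isFiniteMeasure_withDensity_ofReal hi.neg.2
  have hbdd : ∀ y : ℝ, ∀ᵐ x : ℝ, ‖Complex.exp (y * x * Complex.I)‖ ≤ 1 := fun y =>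
    ae_of_all _ fun x => by rw [← Complex.ofReal_mul, Complex.norm_exp_ofReal_mul_I]
  have heq : (ν : Measure ℝ) + n = p := by
    apply Measure.ext_of_charFun
    ext y
    have hadd : charFun ((ν : Measure ℝ) + n) y = charFun (ν : Measure ℝ) y + charFun n y := by
      rw [charFun_apply_real, charFun_apply_real, charFun_apply_real, integral_add_measure]
      · exact (integrable_const (1 : ℝ)).mono' (by fun_prop) (ae_of_all _ fun x => by
          rw [← Complex.ofReal_mul, Complex.norm_exp_ofReal_mul_I])
      · exact (integrable_const (1 : ℝ)).mono' (by fun_prop) (ae_of_all _ fun x => by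
          rw [← Complex.ofReal_mul, Complex.norm_exp_ofReal_mul_I])
    rw [hadd, hν, ← integral_cexp_mul_stableDensity hγ hγ1, hn, hp,
      charFun_withDensity_ofReal hmn, charFun_withDensity_ofReal hc.measurable,
      ← integral_add]
    · congr 1 with x
      rw [← mul_add, ← Complex.ofReal_add]
      congr 2
      rcases le_total 0 (L x) with h | h
      · rw [max_eq_left h, max_eq_right (by linarith), add_zero]
      · rw [max_eq_right h, max_eq_left (by linarith), add_neg_cancel]
    · exact hi.ofReal.bdd_mul (c := 1) (by fun_prop) (hbdd y)
    · exact (hi.neg.pos_part.ofReal).bdd_mul (c := 1) (by fun_prop) (hbdd y)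
  have hopen : IsOpen {x | L x < 0} := isOpen_lt hc continuous_const
  have hp0 : p {x | L x < 0} = 0 := by
    rw [hp, withDensity_apply _ hopen.measurableSet,
      setLIntegral_congr_fun hopen.measurableSet (g := fun _ => 0), lintegral_zero]
    exact fun x hx => ENNReal.ofReal_of_nonpos (le_of_lt hx)
  have hn0 : n {x | L x < 0} = 0 := by
    rw [← heq, Measure.add_apply] at hp0
    exact (add_eq_zero.1 hp0).2
  have hv0 : volume {x | L x < 0} = 0 := by
    rw [hn, withDensity_apply_eq_zero hmn.ennreal_ofReal] at hn0
    convert hn0 using 2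
    ext x
    simp
  have hempty := hopen.measure_eq_zero_iff volume |>.1 hv0
  by_contra h
  have : x ∈ {x | L x < 0} := not_le.1 h
  rw [hempty] at this
  exact this

/-! ### The stable law -/

/-- The one-sided `γ`-stable law with Laplace transform `exp (-l ^ γ)`, for `0 < γ ≤ 1`. -/
def stableLaw (γ : ℝ) : Measure ℝ :=
  if γ = 1 then Measure.dirac 1
  else volume.withDensity fun x => ENNReal.ofReal (stableDensity γ (-γ) x)

theorem charFun_stableLaw {γ : ℝ} (hγ : 0 < γ) (hγ1 : γ ≤ 1) (y : ℝ) :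
    charFun (stableLaw γ) y = Complex.exp (-stableSymbol γ (-γ) y) := by
  rcases hγ1.eq_or_lt with rfl | hγ1
  · rw [stableLaw, if_pos rfl, charFun_dirac, stableSymbol, Real.rpow_one]
    congr 1
    rcases lt_trichotomy y 0 with h | rfl | h
    · rw [Real.sign_of_neg h, abs_of_neg h, mul_comm Complex.I,
        show ((-1 * -1 * Real.pi / 2 : ℝ) : ℂ) = Real.pi / 2 by push_cast; ring,
        Complex.exp_pi_div_two_mul_I]
      simp
    · simp
    · rw [Real.sign_of_pos h, abs_of_pos h, mul_comm Complex.I,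
        show ((1 * -1 * Real.pi / 2 : ℝ) : ℂ) * Complex.I = -(Real.pi / 2 * Complex.I) by
          push_cast; ring, Complex.exp_neg, Complex.exp_pi_div_two_mul_I]
      simp
  · rw [stableLaw, if_neg hγ1.ne,
      charFun_withDensity_ofReal (continuous_stableDensity hγ hγ1).measurable,
      ← integral_cexp_mul_stableDensity hγ hγ1]
    congr 1 with x
    rw [max_eq_left (stableDensity_nonneg hγ hγ1 x)]

theorem isProbabilityMeasure_stableLaw {γ : ℝ} (hγ : 0 < γ) (hγ1 : γ ≤ 1) :
    IsProbabilityMeasure (stableLaw γ) := by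
  have hfin : IsFiniteMeasure (stableLaw γ) := by
    rcases hγ1.eq_or_lt with rfl | hγ1
    · rw [stableLaw, if_pos rfl]
      infer_instance
    · rw [stableLaw, if_neg hγ1.ne]
      exact isFiniteMeasure_withDensity_ofReal (integrable_stableDensity hγ hγ1).2
  have h := charFun_stableLaw hγ hγ1 0
  rw [charFun_zero, stableSymbol, abs_zero, Real.zero_rpow hγ.ne'] at h
  simp only [Complex.ofReal_zero, zero_mul, neg_zero, Complex.exp_zero] at h
  have h1 : (stableLaw γ).real univ = 1 := by exact_mod_cast h
  constructor
  rw [← ENNReal.toReal_eq_one_iff]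
  exact h1

theorem ae_pos_stableLaw {γ : ℝ} (hγ : 0 < γ) (hγ1 : γ ≤ 1) : ∀ᵐ x ∂(stableLaw γ), 0 < x := by
  rcases hγ1.eq_or_lt with rfl | hγ1
  · rw [stableLaw, if_pos rfl, ae_dirac_iff measurableSet_Ioi]
    exact one_pos
  · rw [stableLaw, if_neg hγ1.ne,
      ae_withDensity_iff (continuous_stableDensity hγ hγ1).measurable.ennreal_ofReal]
    refine ae_of_all _ fun x hx => ?_
    by_contra h
    rw [stableDensity_of_nonpos hγ hγ1 (not_lt.1 h)] at hx
    simp at hx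

/-! ### Laplace transform of the stable law -/

/-- The symbol is the boundary value on the imaginary axis of the principal branch of `z ^ γ`. This
is the link between the Fourier and the Laplace transform. -/
theorem stableSymbol_neg_eq_cpow {γ : ℝ} (hγ : 0 < γ) (x : ℝ) :
    stableSymbol γ (-γ) (-x) = (x * Complex.I) ^ (γ : ℂ) := by
  rcases lt_trichotomy x 0 with h | rfl | h
  · have h' : 0 < -x := by linarith
    have e1 : ((x : ℂ) * Complex.I) = ((-x : ℝ) : ℂ) * (-Complex.I) := by push_cast; ring
    have hne : (x : ℂ) * Complex.I ≠ 0 := by simp [h.ne]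
    rw [stableSymbol_of_pos _ _ h', Complex.cpow_def_of_ne_zero hne, e1,
      Complex.log_ofReal_mul h' (by simp), Complex.log_neg_I, add_mul, Complex.exp_add,
      Real.rpow_def_of_pos h', mul_comm]
    push_cast
    ring_nf
  · simp [stableSymbol, Real.zero_rpow hγ.ne', hγ.ne']
  · have hne : (x : ℂ) * Complex.I ≠ 0 := by simp [h.ne']
    rw [stableSymbol_neg, stableSymbol_of_pos _ _ h, Complex.cpow_def_of_ne_zero hne,
      Complex.log_ofReal_mul h (by simp), Complex.log_I, add_mul, Complex.exp_add,
      Real.rpow_def_of_pos h, mul_comm, map_mul, ← Complex.exp_conj, map_mul, Complex.conj_I,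
      Complex.conj_ofReal, Complex.conj_ofReal]
    push_cast
    ring_nf

/-- The difference of the Laplace transform and `exp (-z ^ γ)` is analytic and bounded on the right
half-plane, continuous up to the boundary, and zero on the imaginary axis. Phragmén-Lindelöf makes
it vanish everywhere. -/
theorem integral_exp_neg_stableLaw {γ : ℝ} (hγ : 0 < γ) (hγ1 : γ ≤ 1) {l : ℝ} (hl : 0 ≤ l) :
    ∫ x, Real.exp (-(l * x)) ∂(stableLaw γ) = Real.exp (-l ^ γ) := by
  have hprob := isProbabilityMeasure_stableLaw hγ hγ1
  have hae := ae_pos_stableLaw hγ hγ1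
  have hnorm : ∀ z : ℂ, 0 ≤ z.re → ∀ᵐ x : ℝ ∂(stableLaw γ), ‖Complex.exp (-(z * (x : ℂ)))‖ ≤ 1 := by
    intro z hz
    filter_upwards [hae] with x hx
    rw [Complex.norm_exp, Complex.neg_re, Complex.re_mul_ofReal]
    exact Real.exp_le_one_iff.2 (by nlinarith)
  set f : ℂ → ℂ := fun z => (∫ x, Complex.exp (-(z * (x : ℂ))) ∂(stableLaw γ)) -
    Complex.exp (-z ^ (γ : ℂ)) with hf
  have hset : Iio 0 ⊆ integrableExpSet (id : ℝ → ℝ) (stableLaw γ) := by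
    intro r (hr : r < 0)
    refine (integrable_const (1 : ℝ)).mono' (by fun_prop) ?_
    filter_upwards [hae] with x hx
    rw [Real.norm_of_nonneg (Real.exp_pos _).le]
    exact Real.exp_le_one_iff.2 (by simp only [id]; nlinarith)
  have hmgf : ∀ z : ℂ, (∫ x, Complex.exp (-(z * (x : ℂ))) ∂(stableLaw γ)) =
      complexMGF id (stableLaw γ) (-z) := by
    intro z
    simp [complexMGF]
  have hsub : ∀ z : ℂ, 0 < z.re →
      (-z).re ∈ interior (integrableExpSet (id : ℝ → ℝ) (stableLaw γ)) := by
    intro z hz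
    refine interior_mono hset ?_
    rw [interior_Iio]
    simpa using hz
  have hdiff : DiffContOnCl ℂ f {z | 0 < z.re} := by
    constructor
    · intro z (hz : 0 < z.re)
      simp only [hf, hmgf]
      have h1 := ((hasDerivAt_complexMGF (hsub z hz)).differentiableAt).comp z
        differentiableAt_id.neg
      have h2 : DifferentiableAt ℂ (fun z : ℂ => z ^ (γ : ℂ)) z :=
        differentiableAt_id.cpow_const (Or.inl hz)
      exact (h1.sub h2.neg.cexp).differentiableWithinAt
    · rw [Complex.closure_setOfPred_lt_re]
      intro z (hz : 0 ≤ z.re)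
      refine ContinuousWithinAt.sub ?_ ?_
      · refine continuousWithinAt_of_dominated (bound := fun _ => (1 : ℝ))
          (Eventually.of_forall fun _ => by fun_prop) ?_ (integrable_const _)
          (ae_of_all _ fun x => by fun_prop)
        filter_upwards [self_mem_nhdsWithin] with w hw using hnorm w hw
      · exact ((Complex.continuousAt_cpow_const_of_re_pos (Or.inl hz)
          (by simpa using hγ)).neg.cexp).continuousWithinAt
  have hbdd : ∀ z : ℂ, 0 ≤ z.re → ‖f z‖ ≤ 2 := by
    intro z hz
    have h1 : ‖∫ x, Complex.exp (-(z * (x : ℂ))) ∂(stableLaw γ)‖ ≤ 1 := by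
      refine (norm_integral_le_of_norm_le_const (hnorm z hz)).trans ?_
      simp
    have h2 : ‖Complex.exp (-z ^ (γ : ℂ))‖ ≤ 1 := by
      rw [Complex.norm_exp, Complex.neg_re]
      refine Real.exp_le_one_iff.2 (neg_nonpos.2 ?_)
      rw [Complex.cpow_ofReal_re]
      refine mul_nonneg (by positivity) (Real.cos_nonneg_of_mem_Icc ?_)
      have := abs_le.1 (Complex.abs_arg_le_pi_div_two_iff.2 hz)
      constructor <;> nlinarith [Real.pi_pos]
    calc ‖f z‖ ≤ _ := norm_sub_le _ _
      _ ≤ 2 := by linarith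
  have hzero : ∀ x : ℝ, ‖f (x * Complex.I)‖ ≤ 0 := by
    intro x
    have h1 := charFun_stableLaw hγ hγ1 (-x)
    rw [charFun_apply_real, stableSymbol_neg_eq_cpow hγ] at h1
    have h2 : ∫ y, Complex.exp (-(x * Complex.I * (y : ℂ))) ∂(stableLaw γ) =
        ∫ y, Complex.exp (((-x : ℝ) : ℂ) * y * Complex.I) ∂(stableLaw γ) := by
      congr 1 with y
      congr 1
      push_cast
      ring
    simp only [hf]
    rw [h2, h1, sub_self, norm_zero]
  -- Boundedness by 2 supplies the growth condition, with exponent 1 and exponential constant 0.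
  have key := PhragmenLindelof.right_half_plane_of_bounded_on_real (z := (l : ℂ)) hdiff
    ⟨1, by norm_num, 0, by
      refine Asymptotics.IsBigO.of_bound 2 ?_
      rw [eventually_inf_principal]
      refine Eventually.of_forall fun z (hz : 0 < z.re) => ?_
      simpa using hbdd z hz.le⟩
    (isBoundedUnder_of_eventually_le (a := 2) (by
      filter_upwards [eventually_ge_atTop 0] with x hx
      exact hbdd _ (by simpa using hx)))
    hzero (by simpa using hl)
  have h3 : f l = 0 := norm_le_zero_iff.1 key
  simp only [hf, sub_eq_zero] at h3
  have h4 : ∀ x : ℝ, Complex.exp (-((l : ℂ) * (x : ℂ))) = ((Real.exp (-(l * x)) : ℝ) : ℂ) := by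
    intro x
    push_cast
    rfl
  simp_rw [h4] at h3
  rw [integral_complex_ofReal, ← Complex.ofReal_cpow hl] at h3
  exact_mod_cast h3

/-! ### Averages against the stable and Wright kernels -/

theorem scale_Ioi (F L : ℝ → ℝ) {c : ℝ} (hc : 0 < c) :
    (IntegrableOn (fun x => F x * (1 / c * L (x / c))) (Ioi 0) ↔
      IntegrableOn (fun x => F (c * x) * L x) (Ioi 0)) ∧
    ∫ x in Ioi (0 : ℝ), F x * (1 / c * L (x / c)) = ∫ x in Ioi (0 : ℝ), F (c * x) * L x := by
  have e : ∀ x, F x * (1 / c * L (x / c)) = c⁻¹ * (F (c * (c⁻¹ * x)) * L (c⁻¹ * x)) := by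
    intro x
    rw [mul_inv_cancel_left₀ hc.ne', one_div, div_eq_inv_mul]
    ring
  simp_rw [e]
  have hc' : 0 < c⁻¹ := inv_pos.2 hc
  constructor
  · rw [IntegrableOn, integrable_const_mul_iff hc'.ne'.isUnit]
    have := integrableOn_Ioi_comp_mul_left_iff (fun x => F (c * x) * L x) 0 hc'
    rwa [mul_zero] at this
  · rw [integral_const_mul, integral_comp_mul_left_Ioi (fun x => F (c * x) * L x) 0 hc', mul_zero,
      inv_inv, smul_eq_mul, inv_mul_cancel_left₀ hc.ne']

theorem integral_stableLaw {γ : ℝ} (hγ : 0 < γ) (hγ1 : γ < 1) (G : ℝ → ℝ) :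
    (Integrable G (stableLaw γ) ↔
      IntegrableOn (fun x => G x * stableDensity γ (-γ) x) (Ioi 0)) ∧
    ∫ x, G x ∂(stableLaw γ) = ∫ x in Ioi (0 : ℝ), G x * stableDensity γ (-γ) x := by
  have hm := (continuous_stableDensity hγ hγ1).measurable.ennreal_ofReal
  have hz : ∀ x ∉ Ioi (0 : ℝ), G x * stableDensity γ (-γ) x = 0 := fun x hx => by
    rw [stableDensity_of_nonpos hγ hγ1 (not_lt.1 hx), mul_zero]
  rw [stableLaw, if_neg hγ1.ne]
  constructor
  · rw [integrable_withDensity_iff hm (ae_of_all _ fun _ => ENNReal.ofReal_lt_top),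
      integrableOn_iff_integrable_of_support_subset]
    · simp_rw [ENNReal.toReal_ofReal (stableDensity_nonneg hγ hγ1 _)]
    · intro x hx
      by_contra h
      exact hx (hz x h)
  · rw [integral_withDensity_eq_integral_toReal_smul hm
      (ae_of_all _ fun _ => ENNReal.ofReal_lt_top),
      setIntegral_eq_integral_of_forall_compl_eq_zero hz]
    simp_rw [ENNReal.toReal_ofReal (stableDensity_nonneg hγ hγ1 _), smul_eq_mul, mul_comm]

theorem integrableOn_mul_stableKernel_iff {γ s : ℝ} (hγ : 0 < γ) (hγ1 : γ < 1) (hs : 0 < s)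
    (F : ℝ → ℝ) : IntegrableOn (fun τ => F τ * stableKernel γ (-γ) τ s) (Ioi 0) ↔
      Integrable (fun z => F (s ^ (1 / γ) * z)) (stableLaw γ) := by
  rw [(integral_stableLaw hγ hγ1 _).1]
  exact (scale_Ioi F (stableDensity γ (-γ)) (Real.rpow_pos_of_pos hs _)).1

/-- Self-similarity of the stable kernel. In this form the case `γ = 1` is no longer exceptional,
since `stableLaw 1` is the point mass at 1. -/
theorem stableAverage_eq {γ s : ℝ} (hγ : 0 < γ) (hγ1 : γ ≤ 1) (hs : 0 < s) (F : ℝ → ℝ) :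
    stableAverage γ s F = ∫ z, F (s ^ (1 / γ) * z) ∂(stableLaw γ) := by
  rcases hγ1.eq_or_lt with rfl | hγ1
  · simp [stableAverage, stableLaw]
  · rw [stableAverage, if_neg hγ1.ne, (integral_stableLaw hγ hγ1 _).2]
    exact (scale_Ioi F (stableDensity γ (-γ)) (Real.rpow_pos_of_pos hs _)).2

/-- The reflection formula, read so that it also holds at the poles: there Γ is assigned the value
0, its inverse is 0, and the sine vanishes. -/
theorem inv_Gamma_one_sub {a : ℝ} (ha : 0 < a) :
    (Real.Gamma (1 - a))⁻¹ = Real.Gamma a * Real.sin (Real.pi * a) / Real.pi := by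
  have h := Real.Gamma_mul_Gamma_one_sub a
  have hG := Real.Gamma_pos_of_pos ha
  have hpi := Real.pi_pos
  rcases eq_or_ne (Real.sin (Real.pi * a)) 0 with hs | hs
  · rw [hs, div_zero] at h
    rw [(mul_eq_zero.1 h).resolve_left hG.ne', hs]
    simp
  · have h1 : Real.Gamma (1 - a) = Real.pi / Real.sin (Real.pi * a) / Real.Gamma a := by
      rw [← h]
      field_simp
    rw [h1]
    field_simp

/-- The substitution `x = r ^ (-1/β)` turns the stable series into the Wright series. The prefactor
is the absolute value of its Jacobian, and `inv_Gamma_one_sub` matches the coefficients. -/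
theorem wright_neg_eq {β r : ℝ} (hβ : 0 < β) (hβ1 : β < 1) (hr : 0 < r) :
    HasSum (fun k : ℕ => (-r) ^ k / (k.factorial * Real.Gamma (-β * k + (1 - β))))
      (|-(1 / β)| * r ^ (-(1 / β) - 1) * stableDensity β (-β) (r ^ (-(1 / β)))) := by
  have h := (hasSum_stableDensity hβ hβ1 (Real.rpow_pos_of_pos hr (-(1 / β)))).mul_left
    (|-(1 / β)| * r ^ (-(1 / β) - 1))
  -- The Wright series starts at the term k = 1 of the stable series; the dropped term k = 0 is
  -- zero.
  rw [← hasSum_nat_add_iff' 1] at h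
  simp only [Finset.range_one, Finset.sum_singleton, Nat.cast_zero, mul_zero, Real.sin_zero,
    zero_mul, sub_zero] at h
  refine h.congr_fun fun k => ?_
  have ha : 0 < β * ((k + 1 : ℕ) : ℝ) := by positivity
  have e1 : r ^ (-(1 / β) - 1) * (r ^ (-(1 / β))) ^ (-(β * ((k + 1 : ℕ) : ℝ) + 1)) = r ^ k := by
    rw [← Real.rpow_mul hr.le, ← Real.rpow_add hr, ← Real.rpow_natCast]
    congr 1
    push_cast
    field_simp
    ring_nf
  rw [show -β * (k : ℝ) + (1 - β) = 1 - β * ((k + 1 : ℕ) : ℝ) by push_cast; ring, ← div_div,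
    div_eq_mul_inv _ (Real.Gamma _), inv_Gamma_one_sub ha, Real.Gamma_add_one ha.ne', neg_pow,
    ← e1, abs_neg, abs_of_pos (by positivity : 0 < 1 / β), Nat.factorial_succ, pow_succ]
  push_cast
  have := Real.pi_pos
  field_simp

theorem wrightDensity_eq {β : ℝ} (hβ : 0 < β) (hβ1 : β < 1) {s t : ℝ} (hs : 0 < s) (ht : 0 < t) :
    wrightDensity β s t = 1 / t ^ β * (|-(1 / β)| * (s / t ^ β) ^ (-(1 / β) - 1) *
      stableDensity β (-β) ((s / t ^ β) ^ (-(1 / β)))) := by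
  rw [wrightDensity, wright, (wright_neg_eq hβ hβ1 (by positivity)).tsum_eq]

theorem wrightDensity_nonneg {β : ℝ} (hβ : 0 < β) (hβ1 : β < 1) {s t : ℝ} (hs : 0 < s)
    (ht : 0 < t) : 0 ≤ wrightDensity β s t := by
  rw [wrightDensity_eq hβ hβ1 hs ht]
  have := stableDensity_nonneg hβ hβ1 ((s / t ^ β) ^ (-(1 / β)))
  positivity

/-- The Wright kernel is the density of `t ^ β * X ^ (-β)`. The equivalence of integrability is kept
for the absolute convergence of the double integral. -/
theorem wright_change {β t : ℝ} (hβ : 0 < β) (hβ1 : β < 1) (ht : 0 < t) (F : ℝ → ℝ) :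
    (IntegrableOn (fun s => F s * wrightDensity β s t) (Ioi 0) ↔
      Integrable (fun x => F (t ^ β * x ^ (-β))) (stableLaw β)) ∧
    ∫ s in Ioi (0 : ℝ), F s * wrightDensity β s t =
      ∫ x, F (t ^ β * x ^ (-β)) ∂(stableLaw β) := by
  have htβ := Real.rpow_pos_of_pos ht β
  set M : ℝ → ℝ := fun r => |-(1 / β)| * r ^ (-(1 / β) - 1) *
      stableDensity β (-β) (r ^ (-(1 / β))) with hM
  have e1 : ∀ s ∈ Ioi (0 : ℝ), F s * wrightDensity β s t =
      F s * (1 / t ^ β * M (s / t ^ β)) := fun s hs => by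
    rw [wrightDensity_eq hβ hβ1 hs ht]
  have e2 : ∀ r ∈ Ioi (0 : ℝ), F (t ^ β * r) * M r = (|-(1 / β)| * r ^ (-(1 / β) - 1)) •
      (fun x => F (t ^ β * x ^ (-β)) * stableDensity β (-β) x) (r ^ (-(1 / β))) := by
    intro r (hr : 0 < r)
    simp only [hM, smul_eq_mul]
    rw [← Real.rpow_mul hr.le, show -(1 / β) * -β = 1 by field_simp, Real.rpow_one]
    ring
  have hp : -(1 / β) ≠ 0 := neg_ne_zero.2 (by positivity)
  obtain ⟨h1, h2⟩ := scale_Ioi F M htβ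
  obtain ⟨h3, h4⟩ := integral_stableLaw hβ hβ1 (fun x => F (t ^ β * x ^ (-β)))
  constructor
  · rw [integrableOn_congr_fun e1 measurableSet_Ioi, h1, h3,
      integrableOn_congr_fun e2 measurableSet_Ioi]
    exact integrableOn_Ioi_comp_rpow_iff
      (fun x => F (t ^ β * x ^ (-β)) * stableDensity β (-β) x) hp
  · rw [setIntegral_congr_fun measurableSet_Ioi e1, h2, h4,
      setIntegral_congr_fun measurableSet_Ioi e2]
    exact integral_comp_rpow_Ioi (fun x => F (t ^ β * x ^ (-β)) * stableDensity β (-β) x) hp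

theorem wrightAverage_eq {β t : ℝ} (hβ : 0 < β) (hβ1 : β ≤ 1) (ht : 0 < t) (F : ℝ → ℝ) :
    wrightAverage β t F = ∫ x, F (t ^ β * x ^ (-β)) ∂(stableLaw β) := by
  rcases hβ1.eq_or_lt with rfl | hβ1
  · simp [wrightAverage, stableLaw]
  · rw [wrightAverage, if_neg hβ1.ne, (wright_change hβ hβ1 ht F).2]

/-! ### Negative moments and the Mittag-Leffler function -/

/-- Write `x ^ (-q)` as a Gamma integral of `l ^ (q - 1) * exp (-x l)`; Tonelli leaves the Laplace
transform `exp (-l ^ γ)`, again integrated to a Gamma value. -/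
theorem lintegral_rpow_neg_stableLaw {γ q : ℝ} (hγ : 0 < γ) (hγ1 : γ ≤ 1) (hq : 0 < q) :
    ∫⁻ x, ENNReal.ofReal (x ^ (-q)) ∂(stableLaw γ) =
      ENNReal.ofReal (Real.Gamma (q / γ) / (γ * Real.Gamma q)) := by
  have hprob := isProbabilityMeasure_stableLaw hγ hγ1
  have hae := ae_pos_stableLaw hγ hγ1
  have hG := Real.Gamma_pos_of_pos hq
  have hG' := Real.Gamma_pos_of_pos (show 0 < q / γ by positivity)
  have h1 : ∀ᵐ x ∂(stableLaw γ), ENNReal.ofReal (x ^ (-q)) = ENNReal.ofReal (1 / Real.Gamma q) *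
      ∫⁻ l in Ioi (0 : ℝ), ENNReal.ofReal (l ^ (q - 1) * Real.exp (-(x * l))) := by
    filter_upwards [hae] with x hx
    rw [setLIntegral_Ioi_ofReal_eq (c := (1 / x) ^ q * Real.Gamma q) (by positivity)
      (Real.integral_rpow_mul_exp_neg_mul_Ioi hq hx), ← ENNReal.ofReal_mul (by positivity)]
    · congr 1
      rw [one_div x, Real.inv_rpow hx.le, Real.rpow_neg hx.le]
      field_simp
    · intro l (hl : 0 < l)
      positivity
  rw [lintegral_congr_ae h1, lintegral_const_mul' _ _ ENNReal.ofReal_ne_top,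
    lintegral_lintegral_swap]
  swap
  · apply Measurable.aemeasurable
    fun_prop
  have h2 : ∀ l ∈ Ioi (0 : ℝ), ∫⁻ x, ENNReal.ofReal (l ^ (q - 1) * Real.exp (-(x * l)))
      ∂(stableLaw γ) = ENNReal.ofReal (l ^ (q - 1) * Real.exp (-1 * l ^ γ)) := by
    intro l (hl : 0 < l)
    have hl' : 0 ≤ l ^ (q - 1) := by positivity
    have h3 := integral_exp_neg_stableLaw hγ hγ1 hl.le
    have h4 : Integrable (fun x => Real.exp (-(l * x))) (stableLaw γ) :=
      integrable_of_integral_pos (h3 ▸ Real.exp_pos _)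
    simp_rw [ENNReal.ofReal_mul hl']
    rw [lintegral_const_mul' _ _ ENNReal.ofReal_ne_top, neg_one_mul, ← h3,
      ofReal_integral_eq_lintegral_ofReal h4 (ae_of_all _ fun x => (Real.exp_pos _).le)]
    simp_rw [mul_comm l]
  rw [setLIntegral_congr_fun measurableSet_Ioi h2, setLIntegral_Ioi_ofReal_eq
    (c := 1 / γ * Real.Gamma (q / γ)) (by positivity), ← ENNReal.ofReal_mul (by positivity)]
  · congr 1
    field_simp
  · rw [integral_rpow_mul_exp_neg_mul_rpow hγ (by linarith) one_pos]
    simp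
  · intro l (hl : 0 < l)
    positivity

theorem integral_rpow_neg_stableLaw {γ q : ℝ} (hγ : 0 < γ) (hγ1 : γ ≤ 1) (hq : 0 < q) :
    Integrable (fun x => x ^ (-q)) (stableLaw γ) ∧
    ∫ x, x ^ (-q) ∂(stableLaw γ) = Real.Gamma (q / γ) / (γ * Real.Gamma q) := by
  have hae : 0 ≤ᵐ[stableLaw γ] fun x : ℝ => x ^ (-q) := by
    filter_upwards [ae_pos_stableLaw hγ hγ1] with x hx using Real.rpow_nonneg hx.le _
  have hm : AEStronglyMeasurable (fun x : ℝ => x ^ (-q)) (stableLaw γ) := by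
    apply Measurable.aestronglyMeasurable
    fun_prop
  have h := lintegral_rpow_neg_stableLaw hγ hγ1 hq
  have hG := Real.Gamma_pos_of_pos hq
  have hG' := Real.Gamma_pos_of_pos (show 0 < q / γ by positivity)
  refine ⟨⟨hm, ?_⟩, ?_⟩
  · rw [hasFiniteIntegral_iff_ofReal hae, h]
    exact ENNReal.ofReal_lt_top
  · rw [integral_eq_lintegral_of_nonneg_ae hae hm, h, ENNReal.toReal_ofReal (by positivity)]

theorem moment_inverse {β : ℝ} (hβ : 0 < β) (hβ1 : β ≤ 1) (n : ℕ) :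
    Integrable (fun x => (x ^ (-β)) ^ n) (stableLaw β) ∧
    ∫ x, (x ^ (-β)) ^ n ∂(stableLaw β) = n.factorial / Real.Gamma (β * n + 1) := by
  have hprob := isProbabilityMeasure_stableLaw hβ hβ1
  rcases Nat.eq_zero_or_pos n with rfl | hn
  · simp
  have hn' : (0 : ℝ) < n := by exact_mod_cast hn
  obtain ⟨h1, h2⟩ := integral_rpow_neg_stableLaw (q := β * n) hβ hβ1 (by positivity)
  have e : ∀ᵐ x ∂(stableLaw β), x ^ (-(β * n)) = (x ^ (-β)) ^ n := by
    filter_upwards [ae_pos_stableLaw hβ hβ1] with x hx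
    rw [← neg_mul, Real.rpow_mul hx.le, Real.rpow_natCast]
  refine ⟨h1.congr e, ?_⟩
  rw [← integral_congr_ae e, h2, mul_div_cancel_left₀ _ hβ.ne',
    Real.Gamma_add_one (by positivity)]
  obtain ⟨m, rfl⟩ := Nat.exists_eq_succ_of_ne_zero hn.ne'
  rw [Nat.factorial_succ, Nat.succ_eq_add_one, Nat.cast_add_one, Real.Gamma_nat_eq_factorial]
  push_cast
  have := Real.Gamma_pos_of_pos (show 0 < β * ((m : ℝ) + 1) by positivity)
  have h3 : (m : ℝ) + 1 ≠ 0 := by positivity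
  field_simp

/-- Log-convexity of Γ, with x written as a convex combination of `x + β - 1` and `x + β`. It
provides the limit 0 in the ratio test for the Mittag-Leffler series. -/
theorem Gamma_div_Gamma_add_le {x β : ℝ} (hβ : 0 < β) (hβ1 : β ≤ 1) (hx : 1 < x + β) :
    Real.Gamma x / Real.Gamma (x + β) ≤ (x + β - 1) ^ (-β) := by
  have hs : 0 < x + β - 1 := by linarith
  have hG := Real.Gamma_pos_of_pos hs
  have hG1 : Real.Gamma (x + β) = (x + β - 1) * Real.Gamma (x + β - 1) := by
    rw [← Real.Gamma_add_one hs.ne', sub_add_cancel]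
  have h : Real.Gamma x ≤ Real.Gamma (x + β - 1) ^ β * Real.Gamma (x + β) ^ (1 - β) := by
    rcases hβ1.eq_or_lt with rfl | hβ1
    · simp
    · have := Real.Gamma_mul_add_mul_le_rpow_Gamma_mul_rpow_Gamma (s := x + β - 1) (t := x + β)
        (a := β) (b := 1 - β) hs (by linarith) hβ (by linarith) (by ring)
      rwa [show β * (x + β - 1) + (1 - β) * (x + β) = x by ring] at this
  have hG2 : 0 < Real.Gamma (x + β) := Real.Gamma_pos_of_pos (by linarith)
  rw [div_le_iff₀ hG2]
  refine h.trans (le_of_eq ?_)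
  have e1 : Real.Gamma (x + β) ^ (1 - β) = Real.Gamma (x + β) * Real.Gamma (x + β) ^ (-β) := by
    rw [sub_eq_add_neg, Real.rpow_add hG2, Real.rpow_one]
  have e2 : Real.Gamma (x + β) ^ (-β) = (x + β - 1) ^ (-β) * Real.Gamma (x + β - 1) ^ (-β) := by
    rw [hG1, Real.mul_rpow hs.le hG.le]
  have e3 : Real.Gamma (x + β - 1) ^ β * Real.Gamma (x + β - 1) ^ (-β) = 1 := by
    rw [← Real.rpow_add hG, add_neg_cancel, Real.rpow_zero]
  rw [e1, e2]
  linear_combination (Real.Gamma (x + β) * (x + β - 1) ^ (-β)) * e3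

theorem summable_mittagLeffler {β : ℝ} (hβ : 0 < β) (hβ1 : β ≤ 1) (z : ℝ) :
    Summable fun k : ℕ => |z| ^ k / Real.Gamma (β * k + 1) := by
  rcases eq_or_ne z 0 with rfl | hz
  · refine summable_of_ne_finset_zero (s := {0}) fun k hk => ?_
    simp only [Finset.mem_singleton] at hk
    simp [hk]
  have hz' := abs_pos.2 hz
  have hG : ∀ k : ℕ, 0 < Real.Gamma (β * k + 1) := fun k => Real.Gamma_pos_of_pos (by positivity)
  refine summable_of_ratio_test_tendsto_lt_one (l := 0) one_pos
    (Eventually.of_forall fun k => by have := hG k; positivity) ?_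
  have h1 : Tendsto (fun k : ℕ => |z| * (β * ((k : ℝ) + 1)) ^ (-β)) atTop (𝓝 0) := by
    have h2 := (tendsto_rpow_neg_atTop hβ).comp ((tendsto_atTop_add_const_right _ (1 : ℝ)
      tendsto_natCast_atTop_atTop).const_mul_atTop hβ)
    simpa using h2.const_mul |z|
  refine squeeze_zero (fun k => by positivity) (fun k => ?_) h1
  have h3 := Gamma_div_Gamma_add_le (x := β * k + 1) hβ hβ1 (by nlinarith [k.cast_nonneg (α := ℝ)])
  rw [show β * (k : ℝ) + 1 + β - 1 = β * ((k : ℝ) + 1) by ring,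
    show β * (k : ℝ) + 1 + β = β * ((k + 1 : ℕ) : ℝ) + 1 by push_cast; ring] at h3
  have := hG k
  have := hG (k + 1)
  rw [Real.norm_of_nonneg (by positivity), Real.norm_of_nonneg (by positivity)]
  calc _ = |z| * (Real.Gamma (β * k + 1) / Real.Gamma (β * ((k + 1 : ℕ) : ℝ) + 1)) := by
        rw [pow_succ]
        field_simp
    _ ≤ _ := by gcongr

theorem hasSum_mittagLeffler {β : ℝ} (hβ : 0 < β) (hβ1 : β ≤ 1) (z : ℝ) :
    HasSum (fun k : ℕ => z ^ k / Real.Gamma (β * k + 1)) (mittagLeffler β z) := by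
  refine (Summable.of_norm_bounded (summable_mittagLeffler hβ hβ1 z) fun k => ?_).hasSum
  have hG : 0 < Real.Gamma (β * k + 1) := Real.Gamma_pos_of_pos (by positivity)
  rw [norm_div, norm_pow, Real.norm_eq_abs, Real.norm_of_nonneg hG.le]

/-- Termwise integration of the exponential series: the moments `n! / Γ(β n + 1)` of `X ^ (-β)` turn
it into the Mittag-Leffler series, which converges absolutely. -/
theorem integral_exp_mul_inverse {β : ℝ} (hβ : 0 < β) (hβ1 : β ≤ 1) (z : ℝ) :
    ∫ x, Real.exp (z * x ^ (-β)) ∂(stableLaw β) = mittagLeffler β z := by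
  have hG : ∀ k : ℕ, 0 < Real.Gamma (β * k + 1) := fun k => Real.Gamma_pos_of_pos (by positivity)
  have hF : ∀ k : ℕ, Integrable (fun x => z ^ k / k.factorial * (x ^ (-β)) ^ k) (stableLaw β) :=
    fun k => (moment_inverse hβ hβ1 k).1.const_mul _
  have hval : ∀ (c : ℝ) (k : ℕ), ∫ x, c ^ k / k.factorial * (x ^ (-β)) ^ k ∂(stableLaw β) =
      c ^ k / Real.Gamma (β * k + 1) := by
    intro c k
    rw [integral_const_mul, (moment_inverse hβ hβ1 k).2]
    have := (hG k).ne'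
    field_simp
  have hnorm : ∀ k : ℕ, ∫ x, ‖z ^ k / k.factorial * (x ^ (-β)) ^ k‖ ∂(stableLaw β) =
      |z| ^ k / Real.Gamma (β * k + 1) := by
    intro k
    rw [← hval]
    refine integral_congr_ae ?_
    filter_upwards [ae_pos_stableLaw hβ hβ1] with x hx
    rw [norm_mul, norm_div, norm_pow, Real.norm_eq_abs, Real.norm_natCast,
      Real.norm_of_nonneg (by positivity)]
  have key := hasSum_integral_of_summable_integral_norm hF (by
    simp_rw [hnorm]
    exact summable_mittagLeffler hβ hβ1 z)
  simp_rw [hval] at key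
  rw [(hasSum_mittagLeffler hβ hβ1 z).unique key]
  refine integral_congr_ae (ae_of_all _ fun x => ?_)
  simp only [Real.exp_eq_exp_ℝ, NormedSpace.exp_eq_tsum_div]
  exact tsum_congr fun k => by rw [mul_pow]; ring

/-! ### The heat kernel -/

theorem stableDensity_two (x : ℝ) :
    stableDensity 2 0 x = 1 / Real.sqrt (4 * Real.pi) * Real.exp (-x ^ 2 / 4) := by
  have hsym : ∀ y : ℝ, stableSymbol 2 0 y = (y : ℂ) ^ 2 := by
    intro y
    simp [stableSymbol]
  have h := fourierIntegral_gaussian (b := 1) (by simp) (-(x : ℂ))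
  have hpi := Real.pi_pos
  have e : ∀ y : ℝ, Complex.exp (-(Complex.I * (x : ℂ) * (y : ℂ))) *
      Complex.exp (-stableSymbol 2 0 y) =
      Complex.exp (Complex.I * (-(x : ℂ)) * y) * Complex.exp (-1 * (y : ℂ) ^ 2) := by
    intro y
    rw [hsym]
    ring_nf
  rw [stableDensity]
  simp_rw [e]
  rw [h]
  have e2 : (1 : ℂ) / (2 * (Real.pi : ℂ)) * (((Real.pi : ℂ) / 1) ^ (1 / 2 : ℂ) *
      Complex.exp (-(-(x : ℂ)) ^ 2 / (4 * 1))) =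
      ((1 / (2 * Real.pi) * (Real.sqrt Real.pi * Real.exp (-x ^ 2 / 4)) : ℝ) : ℂ) := by
    rw [Real.sqrt_eq_rpow]
    push_cast [Complex.ofReal_cpow hpi.le]
    simp
  rw [e2, Complex.ofReal_re, Real.sqrt_mul (by norm_num), show (4 : ℝ) = 2 ^ 2 by norm_num,
    Real.sqrt_sq (by norm_num)]
  have hs := Real.sqrt_pos.2 hpi
  have hs2 := Real.mul_self_sqrt hpi.le
  rw [← mul_assoc]
  congr 1
  rw [div_mul_eq_mul_div, one_mul, div_eq_div_iff (by positivity) (by positivity)]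
  nlinarith

theorem stableKernel_two {x τ : ℝ} (hτ : 0 < τ) : stableKernel 2 0 x τ =
    1 / Real.sqrt (4 * Real.pi * τ) * Real.exp (-x ^ 2 / (4 * τ)) := by
  have hpi := Real.pi_pos
  rw [stableKernel, stableDensity_two, ← Real.sqrt_eq_rpow, Real.sqrt_mul (by positivity : 0 ≤ 4 * Real.pi) τ, div_pow,
    Real.sq_sqrt hτ.le]
  have : -(x ^ 2 / τ) / 4 = -x ^ 2 / (4 * τ) := by field_simp
  rw [this]
  have hs := Real.sqrt_pos.2 hτ
  have hs' := Real.sqrt_pos.2 (show 0 < 4 * Real.pi by positivity)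
  rw [← mul_assoc, one_div_mul_one_div, mul_comm (√τ)]

/-- The tail `x ^ (-1-γ)` leaves moments of order below γ finite; the point mass at `γ = 1` has all
of them. -/
theorem integrable_rpow_stableLaw {γ p : ℝ} (hγ : 0 < γ) (hγ1 : γ ≤ 1) (hp : 0 ≤ p)
    (h : p < γ ∨ γ = 1) : Integrable (fun x => x ^ p) (stableLaw γ) := by
  by_cases h1 : γ = 1
  · rw [stableLaw, if_pos h1]
    exact integrable_dirac (by simp)
  have hpγ : p < γ := h.resolve_right h1
  have hγ1' : γ < 1 := lt_of_le_of_ne hγ1 h1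
  rw [(integral_stableLaw hγ hγ1' _).1, ← Ioc_union_Ioi_eq_Ioi zero_le_one]
  obtain ⟨C, hC⟩ := exists_abs_stableDensity_le hγ hγ1'
  have hm : Measurable fun x : ℝ => x ^ p * stableDensity γ (-γ) x :=
    (measurable_id.pow_const p).mul (continuous_stableDensity hγ hγ1').measurable
  refine IntegrableOn.union ?_ ?_
  · refine Integrable.mono (integrable_stableDensity hγ hγ1').integrableOn
      hm.aestronglyMeasurable ?_
    filter_upwards [ae_restrict_mem measurableSet_Ioc] with x hx
    rw [norm_mul, Real.norm_of_nonneg (Real.rpow_nonneg hx.1.le p)]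
    exact mul_le_of_le_one_left (norm_nonneg _) (Real.rpow_le_one hx.1.le hx.2 hp)
  · refine ((integrableOn_Ioi_rpow_of_lt (a := p + -(1 + γ)) (by linarith)
      one_pos).const_mul C).mono' hm.aestronglyMeasurable ?_
    filter_upwards [ae_restrict_mem measurableSet_Ioi] with x hx
    have hx0 : (0 : ℝ) < x := one_pos.trans hx
    rw [norm_mul, Real.norm_of_nonneg (Real.rpow_nonneg hx0.le p), Real.norm_eq_abs,
      Real.rpow_add hx0]
    calc _ ≤ x ^ p * (C * x ^ (-(1 + γ))) :=
          mul_le_mul_of_nonneg_left (hC x (le_of_lt hx)) (Real.rpow_nonneg hx0.le p)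
      _ = _ := by ring

/-! ### Estimates for the heat kernel -/

theorem stableKernel_two_nonneg (x : ℝ) {τ : ℝ} (hτ : 0 < τ) : 0 ≤ stableKernel 2 0 x τ := by
  rw [stableKernel_two hτ]
  positivity

theorem stableKernel_two_eq_gaussian (x : ℝ) {τ : ℝ} (hτ : 0 < τ) :
    stableKernel 2 0 x τ = gaussianPDFReal 0 (2 * τ).toNNReal x := by
  rw [stableKernel_two hτ, gaussianPDFReal, Real.coe_toNNReal _ (by positivity), one_div, sub_zero]
  ring_nf

theorem stableKernel_two_le_rpow (x : ℝ) {τ : ℝ} (hτ : 0 < τ) :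
    stableKernel 2 0 x τ ≤ τ ^ (-(1 / 2) : ℝ) := by
  rw [stableKernel_two hτ, Real.rpow_neg hτ.le, ← Real.sqrt_eq_rpow, one_div]
  have h1 : Real.exp (-x ^ 2 / (4 * τ)) ≤ 1 := by
    rw [Real.exp_le_one_iff, neg_div]
    exact neg_nonpos.2 (by positivity)
  have h2 : √τ ≤ √(4 * Real.pi * τ) := by
    refine Real.sqrt_le_sqrt ?_
    nlinarith [Real.pi_gt_three]
  have h3 : 0 < √τ := Real.sqrt_pos.2 hτ
  calc _ ≤ (√(4 * Real.pi * τ))⁻¹ * 1 := by gcongr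
    _ ≤ (√τ)⁻¹ := by rw [mul_one]; gcongr

/-- From `exp (-a) ≤ 1 / (1 + a)` and `2 p q ≤ p ^ 2 + q ^ 2`. The bound does not involve τ, so away
from x = 0 the kernel is integrable against any mixing law. -/
theorem stableKernel_two_le_inv_abs {x τ : ℝ} (hx : x ≠ 0) (hτ : 0 < τ) :
    stableKernel 2 0 x τ ≤ |x|⁻¹ := by
  rw [stableKernel_two hτ, one_div]
  have hx' := abs_pos.2 hx
  have h1 : Real.exp (-x ^ 2 / (4 * τ)) ≤ (1 + x ^ 2 / (4 * τ))⁻¹ := by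
    rw [neg_div, Real.exp_neg]
    gcongr
    linarith [Real.add_one_le_exp (x ^ 2 / (4 * τ))]
  have h2 : √(4 * τ) ≤ √(4 * Real.pi * τ) := by
    refine Real.sqrt_le_sqrt ?_
    nlinarith [Real.pi_gt_three]
  have h3 : 0 < √(4 * τ) := Real.sqrt_pos.2 (by positivity)
  have h4 : |x| ≤ √(4 * τ) * (1 + x ^ 2 / (4 * τ)) := by
    have h5 : √(4 * τ) * (1 + x ^ 2 / (4 * τ)) = (√(4 * τ) ^ 2 + |x| ^ 2) / √(4 * τ) := by
      rw [sq_abs]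
      nth_rewrite 2 [← Real.sq_sqrt (show 0 ≤ 4 * τ by positivity)]
      field_simp
    rw [h5, le_div_iff₀ h3]
    nlinarith [sq_nonneg (√(4 * τ) - |x|)]
  calc _ ≤ (√(4 * τ))⁻¹ * (1 + x ^ 2 / (4 * τ))⁻¹ := by gcongr
    _ = (√(4 * τ) * (1 + x ^ 2 / (4 * τ)))⁻¹ := by rw [mul_inv]
    _ ≤ |x|⁻¹ := by gcongr

theorem measurable_stableKernel_two :
    Measurable fun p : ℝ × ℝ => stableKernel 2 0 p.1 p.2 := by
  have h : Measurable (stableDensity 2 0) := by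
    have : stableDensity 2 0 =
        fun x => 1 / Real.sqrt (4 * Real.pi) * Real.exp (-x ^ 2 / 4) :=
      funext stableDensity_two
    rw [this]
    fun_prop
  unfold stableKernel
  fun_prop

theorem integral_stableKernel_two {τ : ℝ} (hτ : 0 < τ) :
    Integrable (fun x => stableKernel 2 0 x τ) ∧ ∫ x, stableKernel 2 0 x τ = 1 := by
  simp_rw [fun x => stableKernel_two_eq_gaussian x hτ]
  exact ⟨integrable_gaussianPDFReal _ _, integral_gaussianPDFReal_eq_one _ (by simpa)⟩

theorem integral_cexp_mul_stableKernel_two {τ : ℝ} (hτ : 0 < τ) (k : ℝ) :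
    ∫ x : ℝ, Complex.exp (k * x * Complex.I) * (stableKernel 2 0 x τ : ℂ) =
      (Real.exp (-(k ^ 2 * τ)) : ℂ) := by
  have h := charFun_gaussianReal (μ := 0) (v := (2 * τ).toNNReal) k
  rw [gaussianReal_of_var_ne_zero _ (by simpa), show gaussianPDF 0 (2 * τ).toNNReal =
    fun x => ENNReal.ofReal (gaussianPDFReal 0 (2 * τ).toNNReal x) from rfl,
    charFun_withDensity_ofReal (measurable_gaussianPDFReal _ _)] at h
  simp_rw [fun x => max_eq_left (gaussianPDFReal_nonneg 0 (2 * τ).toNNReal x),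
    ← fun x => stableKernel_two_eq_gaussian x hτ] at h
  rw [h]
  push_cast
  congr 1
  have : (((2 * τ).toNNReal : ℝ) : ℂ) = 2 * τ := by
    rw [Real.coe_toNNReal _ (by positivity)]
    push_cast
    rfl
  rw [this]
  ring

theorem integrable_exp_neg_sq_mul {τ : ℝ} (hτ : 0 < τ) :
    Integrable fun k : ℝ => (Real.exp (-(k ^ 2 * τ)) : ℂ) := by
  have h : Integrable fun k : ℝ => Real.exp (-(k ^ 2 * τ)) := by
    refine (integrable_exp_neg_mul_sq hτ).congr (ae_of_all _ fun k => ?_)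
    simp only
    ring_nf
  exact h.ofReal

theorem stableKernel_two_eq_integral (x : ℝ) {τ : ℝ} (hτ : 0 < τ) :
    (stableKernel 2 0 x τ : ℂ) = 1 / (2 * (Real.pi : ℂ)) *
      ∫ k : ℝ, Complex.exp (Complex.I * k * x) * (Real.exp (-(k ^ 2 * τ)) : ℂ) := by
  have hI : ∀ k : ℝ, ∫ z : ℝ, Complex.exp (Complex.I * k * z) * (stableKernel 2 0 z τ : ℂ) =
      (Real.exp (-(k ^ 2 * τ)) : ℂ) := by
    intro k
    rw [← integral_cexp_mul_stableKernel_two hτ k]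
    refine integral_congr_ae (ae_of_all _ fun z => ?_)
    simp only
    ring_nf
  have hc : Continuous fun z : ℝ => (stableKernel 2 0 z τ : ℂ) := by
    simp_rw [fun z => stableKernel_two (x := z) hτ]
    fun_prop
  have h := eq_integral_of_integrable_fourier hc (integral_stableKernel_two hτ).1.ofReal (by
    simp_rw [hI]
    exact integrable_exp_neg_sq_mul hτ) x
  rw [h]
  simp_rw [hI]
  rw [← integral_neg_eq_self]
  congr 2
  funext k
  push_cast
  ring_nf

/-- Integrate by parts. Two boundary terms and the total variation of the Gaussian each contribute
at most `1 / |x|`, whatever R and τ are. -/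
theorem norm_intervalIntegral_cexp_mul_exp_neg_sq_le {x τ R : ℝ} (hx : x ≠ 0) (hτ : 0 < τ)
    (hR : 0 ≤ R) :
    ‖∫ k in (0 : ℝ)..R, Complex.exp (Complex.I * k * x) * (Real.exp (-(k ^ 2 * τ)) : ℂ)‖ ≤
      3 / |x| := by
  have hx' := abs_pos.2 hx
  have hxc : (Complex.I * x : ℂ) ≠ 0 := by simp [hx]
  have hu : ∀ k ∈ uIcc 0 R, HasDerivAt (fun k : ℝ => (Real.exp (-(k ^ 2 * τ)) : ℂ))
      ((Real.exp (-(k ^ 2 * τ)) * (-(2 * k * τ)) : ℝ) : ℂ) k := by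
    intro k _
    refine HasDerivAt.ofReal_comp ?_
    exact (((hasDerivAt_pow 2 k).mul_const τ).neg.exp).congr_deriv (by simp)
  have hv : ∀ k ∈ uIcc 0 R, HasDerivAt
      (fun k : ℝ => Complex.exp (Complex.I * k * x) / (Complex.I * x))
      (Complex.exp (Complex.I * k * x)) k := by
    intro k _
    have h1 : HasDerivAt (fun k : ℝ => Complex.I * (k : ℂ) * x) (Complex.I * x) k :=
      (((Complex.ofRealCLM.hasDerivAt (x := k)).const_mul Complex.I).mul_const
        (x : ℂ)).congr_deriv (by simp)
    refine (h1.cexp.div_const (Complex.I * x)).congr_deriv ?_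
    rw [mul_div_cancel_right₀ _ hxc]
  have hn : ∀ k : ℝ, ‖Complex.exp (Complex.I * k * x)‖ = 1 := by
    intro k
    rw [show Complex.I * (k : ℂ) * x = ((k * x : ℝ) : ℂ) * Complex.I by push_cast; ring]
    exact Complex.norm_exp_ofReal_mul_I _
  have hn' : ∀ k : ℝ, ‖Complex.exp (Complex.I * k * x) / (Complex.I * x)‖ = 1 / |x| := by
    intro k
    rw [norm_div, hn, norm_mul, Complex.norm_I, one_mul, Complex.norm_real, Real.norm_eq_abs]
  have key := intervalIntegral.integral_mul_deriv_eq_deriv_mul hu hv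
    (Continuous.intervalIntegrable (by fun_prop) _ _)
    (Continuous.intervalIntegrable (by fun_prop) _ _)
  have e : ∫ k in (0 : ℝ)..R, Complex.exp (Complex.I * k * x) * (Real.exp (-(k ^ 2 * τ)) : ℂ) =
      ∫ k in (0 : ℝ)..R, (Real.exp (-(k ^ 2 * τ)) : ℂ) * Complex.exp (Complex.I * k * x) := by
    simp_rw [mul_comm]
  rw [e, key]
  have hd : ∫ k in (0 : ℝ)..R, (1 / |x|) * (Real.exp (-(k ^ 2 * τ)) * (2 * k * τ)) =
      (1 / |x|) * (1 - Real.exp (-(R ^ 2 * τ))) := by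
    rw [intervalIntegral.integral_const_mul]
    congr 1
    have := intervalIntegral.integral_eq_sub_of_hasDerivAt
      (f := fun k : ℝ => -Real.exp (-(k ^ 2 * τ)))
      (f' := fun k => Real.exp (-(k ^ 2 * τ)) * (2 * k * τ)) (a := 0) (b := R)
      (fun k _ => (((hasDerivAt_pow 2 k).mul_const τ).neg.exp).neg.congr_deriv (by simp))
      (Continuous.intervalIntegrable (by fun_prop) _ _)
    rw [this]
    simp
    ring
  have hb : ‖∫ k in (0 : ℝ)..R, ((Real.exp (-(k ^ 2 * τ)) * (-(2 * k * τ)) : ℝ) : ℂ) *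
      (Complex.exp (Complex.I * k * x) / (Complex.I * x))‖ ≤ 1 / |x| := by
    refine (intervalIntegral.norm_integral_le_of_norm_le hR
      (g := fun k => (1 / |x|) * (Real.exp (-(k ^ 2 * τ)) * (2 * k * τ))) ?_
      (Continuous.intervalIntegrable (by fun_prop) _ _)).trans ?_
    · refine ae_of_all _ fun k hk => ?_
      have hk0 : 0 ≤ 2 * k * τ := by have := hk.1; positivity
      rw [norm_mul, hn', Complex.norm_real, norm_mul, Real.norm_eq_abs, Real.abs_exp, norm_neg,
        Real.norm_of_nonneg hk0, mul_comm]
    · rw [hd]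
      refine mul_le_of_le_one_right (by positivity) ?_
      linarith [Real.exp_pos (-(R ^ 2 * τ))]
  have h1 : ‖(Real.exp (-(R ^ 2 * τ)) : ℂ) *
      (Complex.exp (Complex.I * R * x) / (Complex.I * x))‖ ≤ 1 / |x| := by
    rw [norm_mul, hn', Complex.norm_real, Real.norm_eq_abs, Real.abs_exp]
    refine mul_le_of_le_one_left (by positivity) ?_
    rw [Real.exp_le_one_iff]
    exact neg_nonpos.2 (by positivity)
  have h2 : ‖(Real.exp (-((0 : ℝ) ^ 2 * τ)) : ℂ) *
      (Complex.exp (Complex.I * (0 : ℝ) * x) / (Complex.I * x))‖ ≤ 1 / |x| := by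
    rw [norm_mul, hn']
    simp
  calc _ ≤ 1 / |x| + 1 / |x| + 1 / |x| :=
        (norm_sub_le _ _).trans (add_le_add ((norm_sub_le _ _).trans (add_le_add h1 h2)) hb)
    _ = 3 / |x| := by ring

theorem norm_intervalIntegral_symm_le {x τ : ℝ} (hx : x ≠ 0) (hτ : 0 < τ) {R : ℝ} (hR : 0 ≤ R) :
    ‖∫ k in (-R)..R, Complex.exp (Complex.I * k * x) * (Real.exp (-(k ^ 2 * τ)) : ℂ)‖ ≤
      6 / |x| := by
  have hi : ∀ a b : ℝ, IntervalIntegrable (fun k : ℝ => Complex.exp (Complex.I * k * x) *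
      (Real.exp (-(k ^ 2 * τ)) : ℂ)) volume a b :=
    fun a b => Continuous.intervalIntegrable (by fun_prop) _ _
  rw [← intervalIntegral.integral_add_adjacent_intervals (hi (-R) 0) (hi 0 R)]
  have h := norm_intervalIntegral_cexp_mul_exp_neg_sq_le (neg_ne_zero.2 hx) hτ hR
  have h' := norm_intervalIntegral_cexp_mul_exp_neg_sq_le hx hτ hR
  rw [abs_neg] at h
  have e : ∫ k in (-R)..0, Complex.exp (Complex.I * k * x) * (Real.exp (-(k ^ 2 * τ)) : ℂ) =
      ∫ k in (0 : ℝ)..R, Complex.exp (Complex.I * k * (-x : ℝ)) *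
        (Real.exp (-(k ^ 2 * τ)) : ℂ) := by
    rw [← neg_zero, ← intervalIntegral.integral_comp_neg]
    simp
  rw [e]
  calc _ ≤ 3 / |x| + 3 / |x| := (norm_add_le _ _).trans (add_le_add h h')
    _ = _ := by ring

/-- The bound that survives at x = 0: it comes from the full Gaussian integral and costs a factor `τ
^ (-1/2)`. -/
theorem norm_intervalIntegral_symm_le_rpow (x : ℝ) {τ : ℝ} (hτ : 0 < τ) {R : ℝ} (hR : 0 ≤ R) :
    ‖∫ k in (-R)..R, Complex.exp (Complex.I * k * x) * (Real.exp (-(k ^ 2 * τ)) : ℂ)‖ ≤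
      √Real.pi * τ ^ (-(1 / 2) : ℝ) := by
  have hn : ∀ k : ℝ, ‖Complex.exp (Complex.I * k * x) * (Real.exp (-(k ^ 2 * τ)) : ℂ)‖ =
      Real.exp (-τ * k ^ 2) := by
    intro k
    rw [norm_mul, show Complex.I * (k : ℂ) * x = ((k * x : ℝ) : ℂ) * Complex.I by push_cast; ring,
      Complex.norm_exp_ofReal_mul_I, one_mul, Complex.norm_real, Real.norm_eq_abs, Real.abs_exp]
    ring_nf
  rw [intervalIntegral.integral_of_le (by linarith)]
  refine (norm_integral_le_integral_norm _).trans ?_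
  simp_rw [hn]
  calc _ ≤ ∫ k, Real.exp (-τ * k ^ 2) :=
        setIntegral_le_integral (integrable_exp_neg_mul_sq hτ) (ae_of_all _ fun k => by positivity)
    _ = _ := by
        rw [integral_gaussian, Real.sqrt_div Real.pi_pos.le, Real.rpow_neg hτ.le,
          ← Real.sqrt_eq_rpow, div_eq_mul_inv]

/-- The law of `Y ^ (1 / γ) * Z`, with `Y` inverse `β`-stable at time one and `Z` positive
`γ`-stable, independent, `γ = α / 2`. -/
def mixLaw (α β : ℝ) : Measure ℝ :=
  ((stableLaw β).prod (stableLaw (α / 2))).map fun p => (p.1 ^ (-β)) ^ (1 / (α / 2)) * p.2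

/-! ### The mixed law of the random heat time and absolute convergence of the subordination
integrals -/

section mix

variable {α β : ℝ}

theorem measurable_mixFun (α β : ℝ) :
    Measurable fun p : ℝ × ℝ => (p.1 ^ (-β)) ^ (1 / (α / 2)) * p.2 := by fun_prop

theorem isProbabilityMeasure_mixLaw (hα : 0 < α) (hα2 : α ≤ 2) (hβ : 0 < β) (hβ1 : β ≤ 1) :
    IsProbabilityMeasure (mixLaw α β) := by
  have := isProbabilityMeasure_stableLaw hβ hβ1
  have := isProbabilityMeasure_stableLaw (γ := α / 2) (by linarith) (by linarith)
  exact Measure.isProbabilityMeasure_map (measurable_mixFun α β).aemeasurable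

theorem ae_pos_prod (hα : 0 < α) (hα2 : α ≤ 2) (hβ : 0 < β) (hβ1 : β ≤ 1) :
    ∀ᵐ p ∂((stableLaw β).prod (stableLaw (α / 2))), 0 < p.1 ∧ 0 < p.2 := by
  have := isProbabilityMeasure_stableLaw hβ hβ1
  have := isProbabilityMeasure_stableLaw (γ := α / 2) (by linarith) (by linarith)
  filter_upwards [Measure.quasiMeasurePreserving_fst.ae (ae_pos_stableLaw hβ hβ1),
    Measure.quasiMeasurePreserving_snd.ae
      (ae_pos_stableLaw (γ := α / 2) (by linarith) (by linarith))] with p h1 h2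
  exact ⟨h1, h2⟩

theorem ae_pos_mixLaw (hα : 0 < α) (hα2 : α ≤ 2) (hβ : 0 < β) (hβ1 : β ≤ 1) :
    ∀ᵐ ζ ∂(mixLaw α β), 0 < ζ := by
  rw [mixLaw, ae_map_iff (measurable_mixFun α β).aemeasurable measurableSet_Ioi]
  filter_upwards [ae_pos_prod hα hα2 hβ hβ1] with p hp
  have := hp.1
  have := hp.2
  positivity

/-- Conditioning on the first factor, the stable Laplace transform gives `exp (-l ^ (α/2) * X ^
(-β))`, whose mean is a Mittag-Leffler value. -/
theorem integral_exp_neg_mixLaw (hα : 0 < α) (hα2 : α ≤ 2) (hβ : 0 < β) (hβ1 : β ≤ 1) {l : ℝ}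
    (hl : 0 ≤ l) :
    ∫ ζ, Real.exp (-(l * ζ)) ∂(mixLaw α β) = mittagLeffler β (-l ^ (α / 2)) := by
  have hγ : 0 < α / 2 := by linarith
  have := isProbabilityMeasure_stableLaw hβ hβ1
  have := isProbabilityMeasure_stableLaw (γ := α / 2) hγ (by linarith)
  have hm : Measurable fun ζ : ℝ => Real.exp (-(l * ζ)) := by fun_prop
  rw [mixLaw, integral_map (measurable_mixFun α β).aemeasurable hm.aestronglyMeasurable,
    integral_prod _ ?_, ← integral_exp_mul_inverse hβ hβ1]
  · refine integral_congr_ae ?_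
    filter_upwards [ae_pos_stableLaw hβ hβ1] with x hx
    have h := integral_exp_neg_stableLaw (γ := α / 2) (l := l * (x ^ (-β)) ^ (1 / (α / 2))) hγ
      (by linarith) (by positivity)
    simp_rw [← mul_assoc]
    rw [h, Real.mul_rpow hl (by positivity), ← Real.rpow_mul (by positivity),
      one_div_mul_cancel hγ.ne', Real.rpow_one, neg_mul]
  · refine Integrable.of_bound (C := 1) ((hm.comp (measurable_mixFun α β)).aestronglyMeasurable) ?_
    filter_upwards [ae_pos_prod hα hα2 hβ hβ1] with p hp
    have := hp.1
    have := hp.2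
    rw [Real.norm_eq_abs, Real.abs_exp, Real.exp_le_one_iff]
    exact neg_nonpos.2 (by positivity)

/-- The moment of order `-1/2` factors into a moment of X of order `β / α` and one of Z of order
`-1/2`. The first is finite when `β / α < β`, that is `α > 1`, or when X is constant; this is the
origin of the condition at x = 0. -/
theorem integrable_rpow_mixLaw (hα : 0 < α) (hα2 : α ≤ 2) (hβ : 0 < β) (hβ1 : β ≤ 1)
    (h : 1 < α ∨ β = 1) : Integrable (fun ζ => ζ ^ (-(1 / 2) : ℝ)) (mixLaw α β) := by
  have hγ : 0 < α / 2 := by linarith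
  have := isProbabilityMeasure_stableLaw hβ hβ1
  have := isProbabilityMeasure_stableLaw (γ := α / 2) hγ (by linarith)
  have hm : Measurable fun ζ : ℝ => ζ ^ (-(1 / 2) : ℝ) := by fun_prop
  rw [mixLaw, integrable_map_measure hm.aestronglyMeasurable (measurable_mixFun α β).aemeasurable]
  have h1 : Integrable (fun x => x ^ (β / α)) (stableLaw β) := by
    refine integrable_rpow_stableLaw hβ hβ1 (by positivity) (h.imp_left fun h => ?_)
    exact div_lt_self hβ h
  have h2 := (integral_rpow_neg_stableLaw (γ := α / 2) (q := 1 / 2) hγ (by linarith)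
    (by norm_num)).1
  refine (h1.mul_prod h2).congr ?_
  filter_upwards [ae_pos_prod hα hα2 hβ hβ1] with p hp
  have := hp.1
  have := hp.2
  rw [Function.comp, Real.mul_rpow (by positivity) (by positivity), ← Real.rpow_mul (by positivity),
    ← Real.rpow_mul (by positivity)]
  congr 2
  field_simp

theorem integrable_stableKernel_mixLaw (hα : 0 < α) (hα2 : α ≤ 2) (hβ : 0 < β) (hβ1 : β ≤ 1)
    {x c : ℝ} (hc : 0 < c) (h : x ≠ 0 ∨ 1 < α ∨ β = 1) :
    Integrable (fun ζ => stableKernel 2 0 x (c * ζ)) (mixLaw α β) := by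
  have := isProbabilityMeasure_mixLaw hα hα2 hβ hβ1
  have hm : Measurable fun ζ => stableKernel 2 0 x (c * ζ) :=
    measurable_stableKernel_two.comp (by fun_prop : Measurable fun ζ : ℝ => (x, c * ζ))
  rcases h with h | h
  · refine Integrable.of_bound (C := |x|⁻¹) hm.aestronglyMeasurable ?_
    filter_upwards [ae_pos_mixLaw hα hα2 hβ hβ1] with ζ hζ
    have hp : 0 < c * ζ := by positivity
    rw [Real.norm_of_nonneg (stableKernel_two_nonneg x hp)]
    exact stableKernel_two_le_inv_abs h hp
  · refine ((integrable_rpow_mixLaw hα hα2 hβ hβ1 h).const_mul (c ^ (-(1 / 2) : ℝ))).mono'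
      hm.aestronglyMeasurable ?_
    filter_upwards [ae_pos_mixLaw hα hα2 hβ hβ1] with ζ hζ
    have hp : 0 < c * ζ := by positivity
    rw [Real.norm_of_nonneg (stableKernel_two_nonneg x hp), ← Real.mul_rpow hc.le hζ.le]
    exact stableKernel_two_le_rpow x hp

/-- The scale `t ^ (2 β / α)`. -/
def timeScale (α β t : ℝ) : ℝ := (t ^ β) ^ (1 / (α / 2))

theorem timeScale_pos (α β : ℝ) {t : ℝ} (ht : 0 < t) : 0 < timeScale α β t := by
  unfold timeScale
  positivity

theorem timeScale_rpow (hα : 0 < α) {t : ℝ} (ht : 0 ≤ t) : timeScale α β t ^ (α / 2) = t ^ β := by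
  rw [timeScale, ← Real.rpow_mul (by positivity), one_div_mul_cancel (by linarith), Real.rpow_one]

theorem mixFun_scale {t : ℝ} (ht : 0 < t) {p : ℝ × ℝ} (hp : 0 < p.1) :
    (t ^ β * p.1 ^ (-β)) ^ (1 / (α / 2)) * p.2 =
      timeScale α β t * ((p.1 ^ (-β)) ^ (1 / (α / 2)) * p.2) := by
  rw [timeScale, Real.mul_rpow (by positivity) (by positivity), mul_assoc]

theorem integrable_stableKernel_prod (hα : 0 < α) (hα2 : α ≤ 2) (hβ : 0 < β) (hβ1 : β ≤ 1)
    {x t : ℝ} (ht : 0 < t) (h : x ≠ 0 ∨ 1 < α ∨ β = 1) :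
    Integrable (fun p : ℝ × ℝ => stableKernel 2 0 x ((t ^ β * p.1 ^ (-β)) ^ (1 / (α / 2)) * p.2))
      ((stableLaw β).prod (stableLaw (α / 2))) := by
  have h1 := integrable_stableKernel_mixLaw hα hα2 hβ hβ1 (timeScale_pos α β ht) h
  rw [mixLaw] at h1
  refine (h1.comp_measurable (measurable_mixFun α β)).congr ?_
  filter_upwards [ae_pos_prod hα hα2 hβ hβ1] with p hp
  rw [Function.comp, mixFun_scale ht hp.1]

theorem subordinatedKernel_eq (hα : 0 < α) (hα2 : α ≤ 2) (hβ : 0 < β) (hβ1 : β ≤ 1) {x t : ℝ}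
    (ht : 0 < t) : subordinatedKernel α β x t = ∫ y, (∫ z, stableKernel 2 0 x
      ((t ^ β * y ^ (-β)) ^ (1 / (α / 2)) * z) ∂(stableLaw (α / 2))) ∂(stableLaw β) := by
  rw [subordinatedKernel, wrightAverage_eq hβ hβ1 ht]
  refine integral_congr_ae ?_
  filter_upwards [ae_pos_stableLaw hβ hβ1] with y hy
  exact stableAverage_eq (by linarith) (by linarith) (by positivity) _

/-- Passing from the iterated integral to a single integral over `mixLaw` is Fubini, so it needs the
condition for absolute convergence. -/
theorem subordinatedKernel_eq_mix (hα : 0 < α) (hα2 : α ≤ 2) (hβ : 0 < β) (hβ1 : β ≤ 1) {x t : ℝ}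
    (ht : 0 < t) (h : x ≠ 0 ∨ 1 < α ∨ β = 1) : subordinatedKernel α β x t =
      ∫ ζ, stableKernel 2 0 x (timeScale α β t * ζ) ∂(mixLaw α β) := by
  have := isProbabilityMeasure_stableLaw hβ hβ1
  have := isProbabilityMeasure_stableLaw (γ := α / 2) (by linarith) (by linarith)
  have hm : Measurable fun ζ => stableKernel 2 0 x (timeScale α β t * ζ) :=
    measurable_stableKernel_two.comp (by fun_prop : Measurable fun ζ : ℝ => (x, _ * ζ))
  rw [subordinatedKernel_eq hα hα2 hβ hβ1 ht,
    ← integral_prod _ (integrable_stableKernel_prod hα hα2 hβ hβ1 ht h), mixLaw,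
    integral_map (measurable_mixFun α β).aemeasurable hm.aestronglyMeasurable]
  refine integral_congr_ae ?_
  filter_upwards [ae_pos_prod hα hα2 hβ hβ1] with p hp
  rw [mixFun_scale ht hp.1]

theorem subordinatedKernel_nonneg (hα : 0 < α) (hα2 : α ≤ 2) (hβ : 0 < β) (hβ1 : β ≤ 1)
    (x : ℝ) {t : ℝ} (ht : 0 < t) : 0 ≤ subordinatedKernel α β x t := by
  rw [subordinatedKernel_eq hα hα2 hβ hβ1 ht]
  refine integral_nonneg_of_ae ?_
  filter_upwards [ae_pos_stableLaw hβ hβ1] with y hy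
  refine integral_nonneg_of_ae ?_
  filter_upwards [ae_pos_stableLaw (γ := α / 2) (by linarith) (by linarith)] with z hz
  exact stableKernel_two_nonneg x (by positivity)

/-! ### Absolute convergence -/

theorem integrable_stableKernel_stableLaw {γ c : ℝ} (hγ : 0 < γ) (hγ1 : γ ≤ 1) (x : ℝ)
    (hc : 0 < c) : Integrable (fun z => stableKernel 2 0 x (c * z)) (stableLaw γ) := by
  have hm : Measurable fun ζ => stableKernel 2 0 x (c * ζ) :=
    measurable_stableKernel_two.comp (by fun_prop : Measurable fun ζ : ℝ => (x, c * ζ))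
  refine ((integral_rpow_neg_stableLaw (q := 1 / 2) hγ hγ1 (by norm_num)).1.const_mul
    (c ^ (-(1 / 2) : ℝ))).mono' hm.aestronglyMeasurable ?_
  filter_upwards [ae_pos_stableLaw hγ hγ1] with ζ hζ
  have hp : 0 < c * ζ := by positivity
  rw [Real.norm_of_nonneg (stableKernel_two_nonneg x hp), ← Real.mul_rpow hc.le hζ.le]
  exact stableKernel_two_le_rpow x hp

theorem integrableOn_kernel_subordinator (hα : 0 < α) (hα2 : α < 2) (x : ℝ) {t : ℝ} (ht : 0 < t) :
    IntegrableOn (fun τ => stableKernel 2 0 x τ * stableKernel (α / 2) (-(α / 2)) τ t)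
      (Ioi 0) := by
  rw [integrableOn_mul_stableKernel_iff (by linarith) (by linarith) ht]
  exact integrable_stableKernel_stableLaw (by linarith) (by linarith) x (by positivity)

theorem integrable_stableAverage_kernel (hα : 0 < α) (hα2 : α ≤ 2) (hβ : 0 < β) (hβ1 : β ≤ 1)
    {x t : ℝ} (ht : 0 < t) (h : x ≠ 0 ∨ 1 < α ∨ β = 1) :
    Integrable (fun y => stableAverage (α / 2) (t ^ β * y ^ (-β)) fun τ => stableKernel 2 0 x τ)
      (stableLaw β) := by
  have := isProbabilityMeasure_stableLaw hβ hβ1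
  have := isProbabilityMeasure_stableLaw (γ := α / 2) (by linarith) (by linarith)
  refine (integrable_stableKernel_prod hα hα2 hβ hβ1 ht h).integral_prod_left.congr ?_
  filter_upwards [ae_pos_stableLaw hβ hβ1] with y hy
  exact (stableAverage_eq (by linarith) (by linarith) (by positivity) _).symm

theorem integrableOn_kernel_wright (hβ : 0 < β) (hβ1 : β < 1) {x t : ℝ} (ht : 0 < t) :
    IntegrableOn (fun s => stableKernel 2 0 x s * wrightDensity β s t) (Ioi 0) := by
  rw [(wright_change hβ hβ1 ht _).1]
  have h := integrable_stableAverage_kernel (α := 2) (x := x) two_pos le_rfl hβ hβ1.le ht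
    (Or.inr (Or.inl one_lt_two))
  refine h.congr (ae_of_all _ fun y => ?_)
  simp [stableAverage]

theorem measurable_stableKernel {γ : ℝ} (hγ : 0 < γ) (hγ1 : γ < 1) :
    Measurable fun p : ℝ × ℝ => stableKernel γ (-γ) p.1 p.2 := by
  have h := (continuous_stableDensity hγ hγ1).measurable
  unfold stableKernel
  fun_prop

theorem aestronglyMeasurable_wrightDensity (hβ : 0 < β) (hβ1 : β < 1) {t : ℝ} (ht : 0 < t) :
    AEStronglyMeasurable (fun s => wrightDensity β s t) (volume.restrict (Ioi 0)) := by
  have h := (continuous_stableDensity hβ hβ1).measurable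
  have hm : Measurable fun s : ℝ => 1 / t ^ β * (|-(1 / β)| * (s / t ^ β) ^ (-(1 / β) - 1) *
      stableDensity β (-β) ((s / t ^ β) ^ (-(1 / β)))) := by fun_prop
  refine hm.aestronglyMeasurable.congr ?_
  filter_upwards [ae_restrict_mem measurableSet_Ioi] with s hs
  exact (wrightDensity_eq hβ hβ1 hs ht).symm

theorem stableKernel_nonneg {γ : ℝ} (hγ : 0 < γ) (hγ1 : γ < 1) (τ : ℝ) {s : ℝ} (hs : 0 < s) :
    0 ≤ stableKernel γ (-γ) τ s :=
  mul_nonneg (by positivity) (stableDensity_nonneg hγ hγ1 _)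

/-- The integrand is nonnegative, so by Tonelli it suffices that the inner average be integrable
against the Wright density. -/
theorem integrableOn_triple (hα : 0 < α) (hα2 : α < 2) (hβ : 0 < β) (hβ1 : β < 1)
    {x t : ℝ} (ht : 0 < t) (h : x ≠ 0 ∨ 1 < α ∨ β = 1) :
    IntegrableOn (fun p : ℝ × ℝ => stableKernel 2 0 x p.1 *
      stableKernel (α / 2) (-(α / 2)) p.1 p.2 * wrightDensity β p.2 t) (Ioi 0 ×ˢ Ioi 0) := by
  have hγ : 0 < α / 2 := by linarith
  have hγ1 : α / 2 < 1 := by linarith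
  have hm1 : Measurable fun p : ℝ × ℝ => stableKernel 2 0 x p.1 *
      stableKernel (α / 2) (-(α / 2)) p.1 p.2 :=
    (measurable_stableKernel_two.comp
      (by fun_prop : Measurable fun p : ℝ × ℝ => (x, p.1))).mul (measurable_stableKernel hγ hγ1)
  rw [IntegrableOn, Measure.volume_eq_prod, ← Measure.prod_restrict]
  have hm2 : AEStronglyMeasurable (fun p : ℝ × ℝ => stableKernel 2 0 x p.1 *
      stableKernel (α / 2) (-(α / 2)) p.1 p.2 * wrightDensity β p.2 t)
      ((volume.restrict (Ioi 0)).prod (volume.restrict (Ioi 0))) :=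
    hm1.aestronglyMeasurable.mul (aestronglyMeasurable_wrightDensity hβ hβ1 ht).comp_snd
  refine (integrable_prod_iff' hm2).2 ?_
  refine ⟨?_, ?_⟩
  · filter_upwards [ae_restrict_mem measurableSet_Ioi] with s hs
    exact (integrableOn_kernel_subordinator hα hα2 x hs).mul_const _
  · have h1 := (wright_change hβ hβ1 ht
      fun s => stableAverage (α / 2) s fun τ => stableKernel 2 0 x τ).1.2
      (integrable_stableAverage_kernel hα hα2.le hβ hβ1.le ht h)
    refine IntegrableOn.congr_fun h1 (fun s (hs : 0 < s) => ?_) measurableSet_Ioi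
    rw [stableAverage, if_neg hγ1.ne, ← integral_mul_const]
    refine setIntegral_congr_fun measurableSet_Ioi fun τ (hτ : 0 < τ) => ?_
    exact (Real.norm_of_nonneg (mul_nonneg (mul_nonneg (stableKernel_two_nonneg x hτ)
      (stableKernel_nonneg hγ hγ1 τ hs)) (wrightDensity_nonneg hβ hβ1 hs ht))).symm

end mix

/-! ### Fourier transform of the subordinated kernel, Green function and self-similarity -/

section green

variable {α β : ℝ}

theorem measurable_subordinatedKernel (hα : 0 < α) (hα2 : α ≤ 2) (hβ : 0 < β)
    (hβ1 : β ≤ 1) {t : ℝ} (ht : 0 < t) :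
    Measurable fun x => subordinatedKernel α β x t := by
  have := isProbabilityMeasure_stableLaw hβ hβ1
  have := isProbabilityMeasure_stableLaw (γ := α / 2) (by linarith) (by linarith)
  have hm : Measurable fun q : (ℝ × ℝ) × ℝ => stableKernel 2 0 q.1.1
      ((t ^ β * q.1.2 ^ (-β)) ^ (1 / (α / 2)) * q.2) :=
    measurable_stableKernel_two.comp (by fun_prop : Measurable fun q : (ℝ × ℝ) × ℝ =>
      (q.1.1, (t ^ β * q.1.2 ^ (-β)) ^ (1 / (α / 2)) * q.2))
  simp_rw [fun x => subordinatedKernel_eq (x := x) hα hα2 hβ hβ1 ht]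
  exact (hm.stronglyMeasurable.integral_prod_right'
    (ν := stableLaw (α / 2))).integral_prod_right' (ν := stableLaw β) |>.measurable

theorem integrable_prod_kernel_mixLaw (hα : 0 < α) (hα2 : α ≤ 2) (hβ : 0 < β)
    (hβ1 : β ≤ 1) {c : ℝ} (hc : 0 < c) :
    Integrable (fun p : ℝ × ℝ => stableKernel 2 0 p.1 (c * p.2))
      (volume.prod (mixLaw α β)) := by
  have := isProbabilityMeasure_mixLaw hα hα2 hβ hβ1
  have hm : Measurable fun p : ℝ × ℝ => stableKernel 2 0 p.1 (c * p.2) :=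
    measurable_stableKernel_two.comp (by fun_prop : Measurable fun p : ℝ × ℝ => (p.1, c * p.2))
  refine (integrable_prod_iff' hm.aestronglyMeasurable).2 ⟨?_, ?_⟩
  · filter_upwards [ae_pos_mixLaw hα hα2 hβ hβ1] with ζ hζ
    exact (integral_stableKernel_two (by positivity)).1
  · refine (integrable_const (1 : ℝ)).congr ?_
    filter_upwards [ae_pos_mixLaw hα hα2 hβ hβ1] with ζ hζ
    have hp : 0 < c * ζ := by positivity
    simp_rw [fun x => Real.norm_of_nonneg (stableKernel_two_nonneg x hp)]
    exact (integral_stableKernel_two hp).2.symm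

/-- Only x = 0 may fail, and it is a null set, so integrals over x need no restriction on the
orders. -/
theorem ae_subordinatedKernel_eq (hα : 0 < α) (hα2 : α ≤ 2) (hβ : 0 < β) (hβ1 : β ≤ 1) {t : ℝ}
    (ht : 0 < t) : ∀ᵐ x, subordinatedKernel α β x t =
      ∫ ζ, stableKernel 2 0 x (timeScale α β t * ζ) ∂(mixLaw α β) := by
  filter_upwards [compl_mem_ae_iff.2 (measure_singleton (0 : ℝ))] with x hx
  exact subordinatedKernel_eq_mix hα hα2 hβ hβ1 ht (Or.inl hx)

theorem integrable_subordinatedKernel (hα : 0 < α) (hα2 : α ≤ 2) (hβ : 0 < β) (hβ1 : β ≤ 1)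
    {t : ℝ} (ht : 0 < t) : Integrable fun x => subordinatedKernel α β x t := by
  have := isProbabilityMeasure_mixLaw hα hα2 hβ hβ1
  refine (integrable_prod_kernel_mixLaw hα hα2 hβ hβ1
    (timeScale_pos α β ht)).integral_prod_left.congr ?_
  filter_upwards [ae_subordinatedKernel_eq hα hα2 hβ hβ1 ht] with x hx
  exact hx.symm

theorem mittagLeffler_eq_integral_mixLaw (hα : 0 < α) (hα2 : α ≤ 2) (hβ : 0 < β) (hβ1 : β ≤ 1)
    {t : ℝ} (ht : 0 < t) (k : ℝ) : mittagLeffler β (-(|k| ^ α * t ^ β)) =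
      ∫ ζ, Real.exp (-(k ^ 2 * (timeScale α β t * ζ))) ∂(mixLaw α β) := by
  have hc := timeScale_pos α β ht
  have h := integral_exp_neg_mixLaw (l := k ^ 2 * timeScale α β t) hα hα2 hβ hβ1 (by positivity)
  rw [Real.mul_rpow (by positivity) hc.le, timeScale_rpow hα ht.le, ← sq_abs,
    ← Real.rpow_natCast, ← Real.rpow_mul (abs_nonneg k), Nat.cast_two,
    mul_div_cancel₀ _ (two_ne_zero' ℝ)] at h
  rw [← h]
  simp_rw [mul_assoc]
  simp

theorem integral_cexp_mul_subordinatedKernel (hα : 0 < α) (hα2 : α ≤ 2) (hβ : 0 < β) (hβ1 : β ≤ 1)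
    {t : ℝ} (ht : 0 < t) (k : ℝ) :
    ∫ x : ℝ, Complex.exp (k * x * Complex.I) * (subordinatedKernel α β x t : ℂ) =
      (mittagLeffler β (-(|k| ^ α * t ^ β)) : ℂ) := by
  have := isProbabilityMeasure_mixLaw hα hα2 hβ hβ1
  have hc := timeScale_pos α β ht
  have hn : ∀ x : ℝ, ‖Complex.exp (k * x * Complex.I)‖ = 1 := by
    intro x
    rw [show (k * x * Complex.I : ℂ) = ((k * x : ℝ) : ℂ) * Complex.I by push_cast; ring]
    exact Complex.norm_exp_ofReal_mul_I _
  have hi : Integrable (fun p : ℝ × ℝ => Complex.exp (k * p.1 * Complex.I) *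
      (stableKernel 2 0 p.1 (timeScale α β t * p.2) : ℂ)) (volume.prod (mixLaw α β)) := by
    refine (integrable_prod_kernel_mixLaw hα hα2 hβ hβ1 hc).ofReal.bdd_mul (c := 1)
      (Measurable.aestronglyMeasurable (by fun_prop)) (ae_of_all _ fun p => (hn p.1).le)
  calc _ = ∫ x : ℝ, ∫ ζ, Complex.exp (k * x * Complex.I) *
        (stableKernel 2 0 x (timeScale α β t * ζ) : ℂ) ∂(mixLaw α β) := by
        refine integral_congr_ae ?_
        filter_upwards [ae_subordinatedKernel_eq hα hα2 hβ hβ1 ht] with x hx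
        rw [hx, integral_const_mul, integral_complex_ofReal]
    _ = ∫ ζ, (∫ x : ℝ, Complex.exp (k * x * Complex.I) *
        (stableKernel 2 0 x (timeScale α β t * ζ) : ℂ)) ∂(mixLaw α β) :=
        integral_integral_swap hi
    _ = ∫ ζ, (Real.exp (-(k ^ 2 * (timeScale α β t * ζ))) : ℂ) ∂(mixLaw α β) := by
        refine integral_congr_ae ?_
        filter_upwards [ae_pos_mixLaw hα hα2 hβ hβ1] with ζ hζ
        exact integral_cexp_mul_stableKernel_two (by positivity) k
    _ = _ := by
        rw [integral_complex_ofReal, mittagLeffler_eq_integral_mixLaw hα hα2 hβ hβ1 ht]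

theorem mittagLeffler_zero (hβ : 0 < β) (hβ1 : β ≤ 1) : mittagLeffler β 0 = 1 := by
  have := isProbabilityMeasure_stableLaw hβ hβ1
  rw [← integral_exp_mul_inverse hβ hβ1]
  simp

theorem integral_subordinatedKernel (hα : 0 < α) (hα2 : α ≤ 2) (hβ : 0 < β) (hβ1 : β ≤ 1)
    {t : ℝ} (ht : 0 < t) : ∫ x, subordinatedKernel α β x t = 1 := by
  have h := integral_cexp_mul_subordinatedKernel hα hα2 hβ hβ1 ht 0
  simp only [Complex.ofReal_zero, zero_mul, Complex.exp_zero, one_mul, abs_zero,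
    Real.zero_rpow hα.ne', neg_zero, mittagLeffler_zero hβ hβ1] at h
  rw [integral_complex_ofReal] at h
  exact_mod_cast h

/-- On a bounded frequency interval the mixing integral can be exchanged with the frequency
integral. Gaussian inversion then holds for each ζ, and the limit in R passes under the mixing
integral by one of two dominations: the constant `6 / |x|`, or a multiple of `ζ ^ (-1/2)`. -/
theorem tendsto_green (hα : 0 < α) (hα2 : α ≤ 2) (hβ : 0 < β) (hβ1 : β ≤ 1) {x t : ℝ}
    (ht : 0 < t) (h : x ≠ 0 ∨ 1 < α ∨ β = 1) :
    Tendsto (fun R : ℝ => 1 / (2 * (Real.pi : ℂ)) * ∫ k in (-R)..R,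
      Complex.exp (Complex.I * (k : ℂ) * (x : ℂ)) *
        (mittagLeffler β (-(|k| ^ α * t ^ β)) : ℂ))
      atTop (𝓝 (subordinatedKernel α β x t : ℂ)) := by
  have := isProbabilityMeasure_mixLaw hα hα2 hβ hβ1
  have hc := timeScale_pos α β ht
  set c := timeScale α β t
  have hn : ∀ k : ℝ, ‖Complex.exp (Complex.I * k * x)‖ = 1 := by
    intro k
    rw [show Complex.I * (k : ℂ) * x = ((k * x : ℝ) : ℂ) * Complex.I by push_cast; ring]
    exact Complex.norm_exp_ofReal_mul_I _
  have hswap : ∀ R : ℝ, 0 ≤ R → ∫ k in (-R)..R, Complex.exp (Complex.I * (k : ℂ) * (x : ℂ)) *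
      (mittagLeffler β (-(|k| ^ α * t ^ β)) : ℂ) = ∫ ζ, (∫ k in (-R)..R,
        Complex.exp (Complex.I * k * x) * (Real.exp (-(k ^ 2 * (c * ζ))) : ℂ)) ∂(mixLaw α β) := by
    intro R hR
    simp_rw [intervalIntegral.integral_of_le (show -R ≤ R by linarith)]
    rw [integral_integral_swap]
    · congr 1
      funext k
      rw [integral_const_mul, integral_complex_ofReal,
        mittagLeffler_eq_integral_mixLaw hα hα2 hβ hβ1 ht]
    · refine Integrable.of_bound (C := 1) (Measurable.aestronglyMeasurable ?_) ?_
      · refine Measurable.mul (f := fun p : ℝ × ℝ => Complex.exp (Complex.I * p.2 * x))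
          (by fun_prop) (Complex.measurable_ofReal.comp (by fun_prop))
      · have hp : ∀ᵐ p : ℝ × ℝ ∂((mixLaw α β).prod (volume.restrict (Ioc (-R) R))), 0 < p.1 :=
          Measure.quasiMeasurePreserving_fst.ae (ae_pos_mixLaw hα hα2 hβ hβ1)
        filter_upwards [hp] with p hp
        simp only [Function.uncurry_def]
        rw [norm_mul, hn, one_mul, Complex.norm_real, Real.norm_eq_abs, Real.abs_exp,
          Real.exp_le_one_iff]
        exact neg_nonpos.2 (by positivity)
  have hlim : Tendsto (fun R : ℝ => ∫ ζ, (∫ k in (-R)..R, Complex.exp (Complex.I * k * x) *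
      (Real.exp (-(k ^ 2 * (c * ζ))) : ℂ)) ∂(mixLaw α β)) atTop
      (𝓝 (∫ ζ, (∫ k : ℝ, Complex.exp (Complex.I * k * x) *
        (Real.exp (-(k ^ 2 * (c * ζ))) : ℂ)) ∂(mixLaw α β))) := by
    have hmeas : ∀ᶠ R : ℝ in atTop, AEStronglyMeasurable (fun ζ : ℝ => ∫ k in (-R)..R,
        Complex.exp (Complex.I * k * x) * (Real.exp (-(k ^ 2 * (c * ζ))) : ℂ)) (mixLaw α β) := by
      filter_upwards [eventually_ge_atTop 0] with R hR
      simp_rw [intervalIntegral.integral_of_le (show -R ≤ R by linarith)]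
      have hm : Measurable fun p : ℝ × ℝ => Complex.exp (Complex.I * p.2 * x) *
          (Real.exp (-(p.2 ^ 2 * (c * p.1))) : ℂ) :=
        Measurable.mul (by fun_prop) (Complex.measurable_ofReal.comp (by fun_prop))
      exact (hm.stronglyMeasurable.integral_prod_right'
        (ν := volume.restrict (Ioc (-R) R))).aestronglyMeasurable
    have hpt : ∀ᵐ ζ ∂(mixLaw α β), Tendsto (fun R : ℝ => ∫ k in (-R)..R,
        Complex.exp (Complex.I * k * x) * (Real.exp (-(k ^ 2 * (c * ζ))) : ℂ)) atTop
        (𝓝 (∫ k : ℝ, Complex.exp (Complex.I * k * x) *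
          (Real.exp (-(k ^ 2 * (c * ζ))) : ℂ))) := by
      filter_upwards [ae_pos_mixLaw hα hα2 hβ hβ1] with ζ hζ
      refine intervalIntegral_tendsto_integral ?_ tendsto_neg_atTop_atBot tendsto_id
      exact (integrable_exp_neg_sq_mul (by positivity)).bdd_mul (c := 1)
        (Measurable.aestronglyMeasurable (by fun_prop)) (ae_of_all _ fun k => (hn k).le)
    rcases h with h | h
    · refine tendsto_integral_filter_of_dominated_convergence (fun _ => 6 / |x|) hmeas ?_
        (integrable_const _) hpt
      filter_upwards [eventually_ge_atTop 0] with R hR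
      filter_upwards [ae_pos_mixLaw hα hα2 hβ hβ1] with ζ hζ
      exact norm_intervalIntegral_symm_le h (by positivity) hR
    · refine tendsto_integral_filter_of_dominated_convergence
        (fun ζ => √Real.pi * c ^ (-(1 / 2) : ℝ) * ζ ^ (-(1 / 2) : ℝ)) hmeas ?_
        ((integrable_rpow_mixLaw hα hα2 hβ hβ1 h).const_mul _) hpt
      filter_upwards [eventually_ge_atTop 0] with R hR
      filter_upwards [ae_pos_mixLaw hα hα2 hβ hβ1] with ζ hζ
      refine (norm_intervalIntegral_symm_le_rpow x (by positivity) hR).trans_eq ?_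
      rw [Real.mul_rpow hc.le hζ.le, mul_assoc]
  have hval : (subordinatedKernel α β x t : ℂ) = 1 / (2 * (Real.pi : ℂ)) *
      ∫ ζ, (∫ k : ℝ, Complex.exp (Complex.I * k * x) *
        (Real.exp (-(k ^ 2 * (c * ζ))) : ℂ)) ∂(mixLaw α β) := by
    rw [subordinatedKernel_eq_mix hα hα2 hβ hβ1 ht h, ← integral_complex_ofReal,
      ← integral_const_mul]
    refine integral_congr_ae ?_
    filter_upwards [ae_pos_mixLaw hα hα2 hβ hβ1] with ζ hζ
    exact stableKernel_two_eq_integral x (by positivity)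
  rw [hval]
  refine (hlim.const_mul _).congr' ?_
  filter_upwards [eventually_ge_atTop 0] with R hR
  rw [hswap R hR]

/-- The law with density `u_{α,β}(·, t)`. -/
def kernelLaw (α β t : ℝ) : Measure ℝ :=
  volume.withDensity fun x => ENNReal.ofReal (subordinatedKernel α β x t)

theorem isProbabilityMeasure_kernelLaw (hα : 0 < α) (hα2 : α ≤ 2) (hβ : 0 < β) (hβ1 : β ≤ 1)
    {t : ℝ} (ht : 0 < t) : IsProbabilityMeasure (kernelLaw α β t) := by
  refine ⟨?_⟩
  rw [kernelLaw, withDensity_apply _ MeasurableSet.univ, Measure.restrict_univ,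
    ← ofReal_integral_eq_lintegral_ofReal (integrable_subordinatedKernel hα hα2 hβ hβ1 ht)
      (ae_of_all _ fun x => subordinatedKernel_nonneg hα hα2 hβ hβ1 x ht),
    integral_subordinatedKernel hα hα2 hβ hβ1 ht, ENNReal.ofReal_one]

theorem charFun_kernelLaw (hα : 0 < α) (hα2 : α ≤ 2) (hβ : 0 < β) (hβ1 : β ≤ 1)
    {t : ℝ} (ht : 0 < t) (k : ℝ) :
    charFun (kernelLaw α β t) k = (mittagLeffler β (-(|k| ^ α * t ^ β)) : ℂ) := by
  rw [kernelLaw,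
    charFun_withDensity_ofReal (measurable_subordinatedKernel hα hα2 hβ hβ1 ht),
    ← integral_cexp_mul_subordinatedKernel hα hα2 hβ hβ1 ht]
  simp_rw [fun x => max_eq_left (subordinatedKernel_nonneg hα hα2 hβ hβ1 x ht)]

/-- Self-similarity, read off the characteristic functions. It moves all dependence on t into the
datum, so that continuity down to t = 0 becomes a dominated convergence under one fixed law. -/
theorem kernelLaw_eq_map (hα : 0 < α) (hα2 : α ≤ 2) (hβ : 0 < β) (hβ1 : β ≤ 1)
    {t : ℝ} (ht : 0 < t) :
    kernelLaw α β t = (kernelLaw α β 1).map fun w => t ^ (β / α) * w := by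
  have := isProbabilityMeasure_kernelLaw hα hα2 hβ hβ1 ht
  have := isProbabilityMeasure_kernelLaw hα hα2 hβ hβ1 one_pos
  refine Measure.ext_of_charFun (funext fun k => ?_)
  rw [charFun_map_mul, charFun_kernelLaw hα hα2 hβ hβ1 ht, charFun_kernelLaw hα hα2 hβ hβ1 one_pos,
    abs_mul, Real.abs_rpow_of_nonneg ht.le, abs_of_pos ht, Real.mul_rpow (by positivity)
      (abs_nonneg k), ← Real.rpow_mul ht.le, div_mul_cancel₀ _ hα.ne', Real.one_rpow, mul_one,
    mul_comm]

end green

/-! ### The Beta integral and the Mittag-Leffler relaxation function -/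

theorem integral_sub_rpow_mul_rpow {a b t : ℝ} (ha : 0 < a) (hb : 0 < b) (ht : 0 < t) :
    IntegrableOn (fun τ => (t - τ) ^ (a - 1) * τ ^ (b - 1)) (Ioc 0 t) ∧
    ∫ τ in Ioc 0 t, (t - τ) ^ (a - 1) * τ ^ (b - 1) =
      Real.Gamma a * Real.Gamma b / Real.Gamma (a + b) * t ^ (a + b - 1) := by
  have hval : ∫ τ in Ioc 0 t, (t - τ) ^ (a - 1) * τ ^ (b - 1) =
      Real.Gamma a * Real.Gamma b / Real.Gamma (a + b) * t ^ (a + b - 1) := by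
    have h := Complex.betaIntegral_scaled (b : ℂ) (a : ℂ) ht
    have hG := Complex.Gamma_mul_Gamma_eq_betaIntegral (s := (b : ℂ)) (t := (a : ℂ))
      (by simpa) (by simpa)
    have hGab := Real.Gamma_pos_of_pos (show 0 < a + b by positivity)
    rw [← Complex.ofReal_add, Complex.Gamma_ofReal, Complex.Gamma_ofReal, Complex.Gamma_ofReal,
      add_comm b a] at hG
    have hB : Complex.betaIntegral b a =
        ((Real.Gamma a * Real.Gamma b / Real.Gamma (a + b) : ℝ) : ℂ) := by
      have : (Real.Gamma (a + b) : ℂ) ≠ 0 := by exact_mod_cast hGab.ne'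
      push_cast
      rw [eq_div_iff this, mul_comm, ← hG]
      ring
    rw [hB, intervalIntegral.integral_of_le ht.le] at h
    have e : ∫ x in Ioc 0 t, (x : ℂ) ^ ((b : ℂ) - 1) * ((t : ℂ) - x) ^ ((a : ℂ) - 1) =
        ∫ x in Ioc 0 t, (((t - x) ^ (a - 1) * x ^ (b - 1) : ℝ) : ℂ) := by
      refine setIntegral_congr_fun measurableSet_Ioc fun x hx => ?_
      rw [Complex.ofReal_mul, Complex.ofReal_cpow hx.1.le, Complex.ofReal_cpow
        (by linarith [hx.2])]
      push_cast
      ring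
    rw [e, integral_complex_ofReal] at h
    have e2 : (t : ℂ) ^ ((b : ℂ) + a - 1) = ((t ^ (a + b - 1) : ℝ) : ℂ) := by
      rw [Complex.ofReal_cpow ht.le]
      push_cast
      ring_nf
    rw [e2, ← Complex.ofReal_mul] at h
    rw [Complex.ofReal_inj.1 h]
    ring
  refine ⟨integrable_of_integral_pos ?_, hval⟩
  rw [hval]
  have := Real.Gamma_pos_of_pos ha
  have := Real.Gamma_pos_of_pos hb
  have := Real.Gamma_pos_of_pos (show 0 < a + b by positivity)
  positivity

section ml

variable {β : ℝ}

theorem integrable_exp_mul_inverse (hβ : 0 < β) (hβ1 : β ≤ 1) (z : ℝ) :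
    Integrable (fun x => Real.exp (z * x ^ (-β))) (stableLaw β) := by
  have := isProbabilityMeasure_stableLaw hβ hβ1
  have h : Integrable (fun x => Real.exp (|z| * x ^ (-β))) (stableLaw β) := by
    refine integrable_of_integral_pos ?_
    rw [integral_exp_mul_inverse hβ hβ1]
    have hG : ∀ k : ℕ, 0 < Real.Gamma (β * k + 1) :=
      fun k => Real.Gamma_pos_of_pos (by positivity)
    refine (hasSum_mittagLeffler hβ hβ1 |z|).summable.tsum_pos
      (fun k => by have := hG k; positivity) 0 ?_
    simp
  refine h.mono' (by fun_prop) ?_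
  filter_upwards [ae_pos_stableLaw hβ hβ1] with x hx
  rw [Real.norm_eq_abs, Real.abs_exp]
  gcongr
  exact le_abs_self z

theorem interior_integrableExpSet_inverse (hβ : 0 < β) (hβ1 : β ≤ 1) (z : ℝ) :
    z ∈ interior (integrableExpSet (fun x => x ^ (-β)) (stableLaw β)) := by
  have : integrableExpSet (fun x => x ^ (-β)) (stableLaw β) = univ :=
    eq_univ_of_forall fun z => integrable_exp_mul_inverse hβ hβ1 z
  simp [this]

/-- Analyticity, the bounds on the negative axis, and a moment formula for the derivative all come
from this identification with an everywhere finite moment generating function. -/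
theorem mgf_inverse (hβ : 0 < β) (hβ1 : β ≤ 1) :
    mgf (fun x => x ^ (-β)) (stableLaw β) = mittagLeffler β :=
  funext fun z => integral_exp_mul_inverse hβ hβ1 z

theorem analyticAt_mittagLeffler (hβ : 0 < β) (hβ1 : β ≤ 1) (z : ℝ) :
    AnalyticAt ℝ (mittagLeffler β) z := by
  rw [← mgf_inverse hβ hβ1]
  exact analyticAt_mgf (interior_integrableExpSet_inverse hβ hβ1 z)

theorem continuous_mittagLeffler (hβ : 0 < β) (hβ1 : β ≤ 1) : Continuous (mittagLeffler β) :=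
  continuous_iff_continuousAt.2 fun z => (analyticAt_mittagLeffler hβ hβ1 z).continuousAt

theorem hasDerivAt_mittagLeffler (hβ : 0 < β) (hβ1 : β ≤ 1) (z : ℝ) :
    HasDerivAt (mittagLeffler β) (deriv (mittagLeffler β) z) z :=
  (analyticAt_mittagLeffler hβ hβ1 z).differentiableAt.hasDerivAt

theorem continuous_deriv_mittagLeffler (hβ : 0 < β) (hβ1 : β ≤ 1) :
    Continuous (deriv (mittagLeffler β)) :=
  continuous_iff_continuousAt.2 fun z => (analyticAt_mittagLeffler hβ hβ1 z).deriv.continuousAt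

theorem deriv_mittagLeffler (hβ : 0 < β) (hβ1 : β ≤ 1) (z : ℝ) : deriv (mittagLeffler β) z =
    ∫ x, x ^ (-β) * Real.exp (z * x ^ (-β)) ∂(stableLaw β) := by
  rw [← mgf_inverse hβ hβ1]
  exact deriv_mgf (interior_integrableExpSet_inverse hβ hβ1 z)

theorem abs_mittagLeffler_le (hβ : 0 < β) (hβ1 : β ≤ 1) {z : ℝ} (hz : z ≤ 0) :
    |mittagLeffler β z| ≤ 1 := by
  have := isProbabilityMeasure_stableLaw hβ hβ1
  rw [← integral_exp_mul_inverse hβ hβ1, ← Real.norm_eq_abs]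
  refine (norm_integral_le_of_norm_le_const (C := 1) (μ := stableLaw β) ?_).trans_eq (by simp)
  filter_upwards [ae_pos_stableLaw hβ hβ1] with x hx
  rw [Real.norm_eq_abs, Real.abs_exp, Real.exp_le_one_iff]
  exact mul_nonpos_of_nonpos_of_nonneg hz (by positivity)

theorem integrable_inverse (hβ : 0 < β) (hβ1 : β ≤ 1) :
    Integrable (fun x => x ^ (-β)) (stableLaw β) := by
  simpa using (moment_inverse hβ hβ1 1).1

theorem abs_deriv_mittagLeffler_le (hβ : 0 < β) (hβ1 : β ≤ 1) {z : ℝ} (hz : z ≤ 0) :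
    |deriv (mittagLeffler β) z| ≤ ∫ x, x ^ (-β) ∂(stableLaw β) := by
  rw [deriv_mittagLeffler hβ hβ1, ← Real.norm_eq_abs]
  refine norm_integral_le_of_norm_le (integrable_inverse hβ hβ1) ?_
  filter_upwards [ae_pos_stableLaw hβ hβ1] with x hx
  rw [norm_mul, Real.norm_of_nonneg (by positivity), Real.norm_eq_abs, Real.abs_exp]
  refine mul_le_of_le_one_right (by positivity) ?_
  rw [Real.exp_le_one_iff]
  exact mul_nonpos_of_nonpos_of_nonneg hz (by positivity)

theorem hasSum_deriv_mittagLeffler (hβ : 0 < β) (hβ1 : β ≤ 1) (z : ℝ) :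
    HasSum (fun k : ℕ => z ^ k * (k + 1) / Real.Gamma (β * ((k + 1 : ℕ) : ℝ) + 1))
      (deriv (mittagLeffler β) z) := by
  have hG : ∀ k : ℕ, 0 < Real.Gamma (β * k + 1) := fun k => Real.Gamma_pos_of_pos (by positivity)
  have hF : ∀ k : ℕ, Integrable (fun x => z ^ k / k.factorial * (x ^ (-β)) ^ (k + 1))
      (stableLaw β) := fun k => (moment_inverse hβ hβ1 (k + 1)).1.const_mul _
  have hval : ∀ (c : ℝ) (k : ℕ),
      ∫ x, c ^ k / k.factorial * (x ^ (-β)) ^ (k + 1) ∂(stableLaw β) =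
      c ^ k * (k + 1) / Real.Gamma (β * ((k + 1 : ℕ) : ℝ) + 1) := by
    intro c k
    rw [integral_const_mul, (moment_inverse hβ hβ1 (k + 1)).2, Nat.factorial_succ]
    have := (hG (k + 1)).ne'
    push_cast
    field_simp
  have hnorm : ∀ k : ℕ, ∫ x, ‖z ^ k / k.factorial * (x ^ (-β)) ^ (k + 1)‖ ∂(stableLaw β) =
      |z| ^ k * (k + 1) / Real.Gamma (β * ((k + 1 : ℕ) : ℝ) + 1) := by
    intro k
    rw [← hval]
    refine integral_congr_ae ?_
    filter_upwards [ae_pos_stableLaw hβ hβ1] with x hx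
    rw [norm_mul, norm_div, norm_pow, Real.norm_eq_abs, Real.norm_natCast,
      Real.norm_of_nonneg (by positivity)]
  have hsum : Summable fun k : ℕ =>
      |z| ^ k * (k + 1) / Real.Gamma (β * ((k + 1 : ℕ) : ℝ) + 1) := by
    refine Summable.of_nonneg_of_le (fun k => by have := hG (k + 1); positivity) (fun k => ?_)
      ((summable_nat_add_iff 1).2 (summable_mittagLeffler hβ hβ1 (2 * (1 + |z|))))
    -- The weight `k + 1` from differentiation is absorbed by comparing with the Mittag-Leffler
    -- series at `2 (1 + |z|)`.
    have h1 : ((k : ℝ) + 1) ≤ 2 ^ (k + 1) := by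
      exact_mod_cast (Nat.lt_two_pow_self (n := k + 1)).le
    have h2 : |z| ^ k ≤ (1 + |z|) ^ (k + 1) := by
      calc |z| ^ k ≤ (1 + |z|) ^ k := by gcongr; linarith
        _ ≤ _ := pow_le_pow_right₀ (by linarith [abs_nonneg z]) (Nat.le_succ k)
    have := hG (k + 1)
    rw [abs_of_nonneg (by positivity : 0 ≤ 2 * (1 + |z|)), mul_pow, mul_comm (|z| ^ k)]
    gcongr
  have key := hasSum_integral_of_summable_integral_norm hF (by simp_rw [hnorm]; exact hsum)
  simp_rw [hval] at key
  have e : ∫ x, x ^ (-β) * Real.exp (z * x ^ (-β)) ∂(stableLaw β) =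
      ∫ x, ∑' k : ℕ, z ^ k / k.factorial * (x ^ (-β)) ^ (k + 1) ∂(stableLaw β) := by
    refine integral_congr_ae (ae_of_all _ fun x => ?_)
    simp only [Real.exp_eq_exp_ℝ, NormedSpace.exp_eq_tsum_div]
    rw [← tsum_mul_left]
    exact tsum_congr fun k => by rw [mul_pow, pow_succ]; ring
  rw [deriv_mittagLeffler hβ hβ1, e]
  exact key

/-- The time derivative of `E_β(-l t ^ β)`. -/
def relaxationDeriv (β l t : ℝ) : ℝ :=
  deriv (mittagLeffler β) (-(l * t ^ β)) * -(l * (β * t ^ (β - 1)))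

theorem hasDerivAt_relaxation (hβ : 0 < β) (hβ1 : β ≤ 1) (l : ℝ) {t : ℝ} (ht : 0 < t) :
    HasDerivAt (fun t => mittagLeffler β (-(l * t ^ β))) (relaxationDeriv β l t) t :=
  (hasDerivAt_mittagLeffler hβ hβ1 _).comp t
    ((Real.hasDerivAt_rpow_const (Or.inl ht.ne')).const_mul l).neg

theorem abs_relaxationDeriv_le (hβ : 0 < β) (hβ1 : β ≤ 1) {l t : ℝ} (hl : 0 ≤ l) (ht : 0 < t) :
    |relaxationDeriv β l t| ≤ (∫ x, x ^ (-β) ∂(stableLaw β)) * β * (l * t ^ (β - 1)) := by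
  rw [relaxationDeriv, abs_mul, abs_neg, abs_of_nonneg (by positivity : 0 ≤ l * (β * t ^ (β - 1)))]
  have h := abs_deriv_mittagLeffler_le hβ hβ1 (z := -(l * t ^ β)) (neg_nonpos.2 (by positivity))
  calc _ ≤ (∫ x, x ^ (-β) ∂(stableLaw β)) * (l * (β * t ^ (β - 1))) := by gcongr
    _ = _ := by ring

/-- Termwise, the Beta integral replaces `Γ(β (k+1))` by `Γ(β k + 1)`, lowering the index by one.
The series reproduces itself with the factor `-l`: the relaxation function is a Caputo
eigenfunction. -/
theorem integral_relaxationDeriv (hβ : 0 < β) (hβ1 : β < 1) {l t : ℝ} (hl : 0 ≤ l)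
    (ht : 0 < t) : ∫ τ in Ioc 0 t, (t - τ) ^ (-β) * relaxationDeriv β l τ =
      Real.Gamma (1 - β) * (-l * mittagLeffler β (-(l * t ^ β))) := by
  have hG : ∀ k : ℕ, 0 < Real.Gamma (β * k + 1) := fun k => Real.Gamma_pos_of_pos (by positivity)
  have hG1 : 0 < Real.Gamma (1 - β) := Real.Gamma_pos_of_pos (by linarith)
  set F : ℕ → ℝ → ℝ := fun k τ => (-l) ^ (k + 1) / Real.Gamma (β * (k + 1)) *
    ((t - τ) ^ ((1 - β) - 1) * τ ^ (β * (k + 1) - 1)) with hFdef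
  have hGk : ∀ k : ℕ, 0 < Real.Gamma (β * (k + 1)) := fun k => Real.Gamma_pos_of_pos (by positivity)
  have hbeta := fun k : ℕ => integral_sub_rpow_mul_rpow (a := 1 - β) (b := β * (k + 1))
    (by linarith) (by positivity) ht
  have hval : ∀ k : ℕ, ∫ τ in Ioc 0 t, (t - τ) ^ ((1 - β) - 1) * τ ^ (β * (k + 1) - 1) =
      Real.Gamma (1 - β) * Real.Gamma (β * (k + 1)) / Real.Gamma (β * k + 1) * (t ^ β) ^ k := by
    intro k
    rw [(hbeta k).2, show 1 - β + β * ((k : ℝ) + 1) = β * k + 1 by ring, add_sub_cancel_right,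
      Real.rpow_mul ht.le, Real.rpow_natCast]
  have hF : ∀ k, Integrable (F k) (volume.restrict (Ioc 0 t)) := fun k => (hbeta k).1.const_mul _
  have hint : ∀ k, ∫ τ in Ioc 0 t, F k τ =
      Real.Gamma (1 - β) * -l * ((-(l * t ^ β)) ^ k / Real.Gamma (β * k + 1)) := by
    intro k
    rw [hFdef, integral_const_mul, hval]
    have := (hGk k).ne'
    have := (hG k).ne'
    rw [← neg_mul l, mul_pow]
    field_simp
    ring
  have hnorm : ∀ k, ∫ τ in Ioc 0 t, ‖F k τ‖ =
      Real.Gamma (1 - β) * l * (|-(l * t ^ β)| ^ k / Real.Gamma (β * k + 1)) := by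
    intro k
    have e : ∀ τ ∈ Ioc 0 t, ‖F k τ‖ = l ^ (k + 1) / Real.Gamma (β * (k + 1)) *
        ((t - τ) ^ ((1 - β) - 1) * τ ^ (β * (k + 1) - 1)) := by
      intro τ hτ
      have h1 : 0 ≤ t - τ := by linarith [hτ.2]
      have h2 := hτ.1
      have := hGk k
      rw [hFdef, norm_mul, norm_div, norm_pow, norm_neg, Real.norm_of_nonneg hl,
        Real.norm_of_nonneg this.le, Real.norm_of_nonneg (by positivity)]
    rw [setIntegral_congr_fun measurableSet_Ioc e, integral_const_mul, hval, abs_neg,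
      abs_of_nonneg (by positivity : 0 ≤ l * t ^ β), mul_pow]
    have := (hGk k).ne'
    have := (hG k).ne'
    field_simp
    ring
  have key := hasSum_integral_of_summable_integral_norm hF (by
    simp_rw [hnorm]
    exact (summable_mittagLeffler hβ hβ1.le _).mul_left _)
  simp_rw [hint] at key
  have hs := (hasSum_mittagLeffler hβ hβ1.le (-(l * t ^ β))).mul_left (Real.Gamma (1 - β) * -l)
  rw [← mul_assoc, ← key.unique hs]
  refine setIntegral_congr_fun measurableSet_Ioc fun τ hτ => ?_
  have hτ0 : 0 < τ := hτ.1
  have hd := (hasSum_deriv_mittagLeffler hβ hβ1.le (-(l * τ ^ β))).mul_left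
    ((t - τ) ^ (-β) * -(l * (β * τ ^ (β - 1))))
  have hd2 : (t - τ) ^ (-β) * relaxationDeriv β l τ = (t - τ) ^ (-β) * -(l * (β * τ ^ (β - 1))) *
      deriv (mittagLeffler β) (-(l * τ ^ β)) := by
    rw [relaxationDeriv]
    ring
  rw [hd2, ← hd.tsum_eq]
  refine tsum_congr fun k => ?_
  rw [hFdef]
  simp only
  have h1 : Real.Gamma (β * ((k + 1 : ℕ) : ℝ) + 1) = β * (k + 1) * Real.Gamma (β * (k + 1)) := by
    push_cast
    exact Real.Gamma_add_one (by positivity)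
  have h2 : τ ^ (β * ((k : ℝ) + 1) - 1) = (τ ^ β) ^ k * τ ^ (β - 1) := by
    rw [← Real.rpow_natCast, ← Real.rpow_mul hτ0.le, ← Real.rpow_add hτ0]
    ring_nf
  have := (hGk k).ne'
  rw [h1, h2, show (1 - β) - 1 = -β by ring, ← neg_mul l (τ ^ β), mul_pow]
  field_simp
  ring

theorem deriv_mittagLeffler_one (z : ℝ) :
    deriv (mittagLeffler 1) z = mittagLeffler 1 z := by
  rw [deriv_mittagLeffler one_pos le_rfl, ← integral_exp_mul_inverse one_pos le_rfl, stableLaw,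
    if_pos rfl, integral_dirac, integral_dirac]
  simp

end ml

/-! ### Plane waves as eigenfunctions of the space derivative -/

/-- The plane wave `a k cos (k x) + b k sin (k x)`. -/
def wave (a b : ℝ → ℝ) (x k : ℝ) : ℝ :=
  a k * Real.cos (k * x) + b k * Real.sin (k * x)

section wave

variable {a b : ℝ → ℝ}

theorem abs_wave_le (a b : ℝ → ℝ) (x k : ℝ) : |wave a b x k| ≤ |a k| + |b k| := by
  refine (abs_add_le _ _).trans (add_le_add ?_ ?_)
  · rw [abs_mul]
    exact mul_le_of_le_one_right (abs_nonneg _) (Real.abs_cos_le_one _)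
  · rw [abs_mul]
    exact mul_le_of_le_one_right (abs_nonneg _) (Real.abs_sin_le_one _)

/-- The eigenfunction property at the level of differences; integrating the factor `1 - cos (k y)`
against `y ^ (-1-α)` produces `|k| ^ α`. -/
theorem wave_second_difference (a b : ℝ → ℝ) (x y k : ℝ) :
    (wave a b (x + y) k - wave a b x k) + (wave a b (x - y) k - wave a b x k) =
      -(2 * (1 - Real.cos (k * y))) * wave a b x k := by
  simp only [wave, mul_add, mul_sub, Real.cos_add, Real.sin_add, Real.cos_sub, Real.sin_sub]
  ring

theorem hasDerivAt_wave (a b : ℝ → ℝ) (x k : ℝ) : HasDerivAt (fun x => wave a b x k)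
    (wave (fun k => k * b k) (fun k => -(k * a k)) x k) x := by
  have h : HasDerivAt (fun x => k * x) k x := by simpa using (hasDerivAt_id x).const_mul k
  refine ((h.cos.const_mul (a k)).add (h.sin.const_mul (b k))).congr_deriv ?_
  simp only [wave]
  ring

theorem measurable_wave (ha : Measurable a) (hb : Measurable b) :
    Measurable fun p : ℝ × ℝ => wave a b p.1 p.2 := by
  unfold wave
  fun_prop

theorem measurable_wave_left (ha : Measurable a) (hb : Measurable b) (x : ℝ) :
    Measurable (wave a b x) := by
  unfold wave
  fun_prop

theorem continuous_wave (a b : ℝ → ℝ) (k : ℝ) : Continuous fun x => wave a b x k := by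
  unfold wave
  fun_prop

theorem integrable_wave (ha : Measurable a) (hb : Measurable b)
    (hi : Integrable fun k => |a k| + |b k|) (x : ℝ) : Integrable (wave a b x) :=
  hi.mono' (measurable_wave_left ha hb x).aestronglyMeasurable (ae_of_all _ (abs_wave_le a b x))

theorem continuous_integral_wave (ha : Measurable a) (hb : Measurable b)
    (hi : Integrable fun k => |a k| + |b k|) : Continuous fun x => ∫ k, wave a b x k :=
  continuous_of_dominated (fun x => (measurable_wave_left ha hb x).aestronglyMeasurable)
    (fun x => ae_of_all _ (abs_wave_le a b x)) hi (ae_of_all _ (continuous_wave a b))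

theorem abs_add_abs_wave_deriv (a b : ℝ → ℝ) (k : ℝ) :
    |k * b k| + |-(k * a k)| = |k| * (|a k| + |b k|) := by
  rw [abs_neg, abs_mul, abs_mul]
  ring

theorem hasDerivAt_integral_wave (ha : Measurable a) (hb : Measurable b)
    (hi : Integrable fun k => |a k| + |b k|) (hi1 : Integrable fun k => |k| * (|a k| + |b k|))
    (x : ℝ) : HasDerivAt (fun x => ∫ k, wave a b x k)
      (∫ k, wave (fun k => k * b k) (fun k => -(k * a k)) x k) x := by
  refine (hasDerivAt_integral_of_dominated_loc_of_deriv_le (s := univ)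
    (bound := fun k => |k| * (|a k| + |b k|)) univ_mem
    (Eventually.of_forall fun x => (measurable_wave_left ha hb x).aestronglyMeasurable)
    (integrable_wave ha hb hi x)
    (measurable_wave_left (by fun_prop) (by fun_prop) x).aestronglyMeasurable
    (ae_of_all _ fun k x _ => ?_) hi1 (ae_of_all _ fun k x _ => hasDerivAt_wave a b x k)).2
  rw [← abs_add_abs_wave_deriv]
  exact abs_wave_le _ _ x k

theorem integrable_abs_mul_of_sq (ha : Measurable a) (hb : Measurable b)
    (hi : Integrable fun k => |a k| + |b k|) (hi2 : Integrable fun k => k ^ 2 * (|a k| + |b k|)) :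
    Integrable fun k => |k| * (|a k| + |b k|) := by
  refine (hi.add hi2).mono' (Measurable.aestronglyMeasurable (by fun_prop)) (ae_of_all _ fun k => ?_)
  have h : 0 ≤ |a k| + |b k| := by positivity
  rw [norm_mul, Real.norm_of_nonneg (abs_nonneg k), Real.norm_of_nonneg h, Pi.add_apply]
  nlinarith [sq_nonneg (|k| - 1), sq_abs k]

theorem contDiff_two_integral_wave (ha : Measurable a) (hb : Measurable b)
    (hi : Integrable fun k => |a k| + |b k|) (hi2 : Integrable fun k => k ^ 2 * (|a k| + |b k|)) :
    (ContDiff ℝ 2 fun x => ∫ k, wave a b x k) ∧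
    ∀ x, iteratedDeriv 2 (fun x => ∫ k, wave a b x k) x = -∫ k, k ^ 2 * wave a b x k := by
  have hi1 := integrable_abs_mul_of_sq ha hb hi hi2
  have ha' : Measurable fun k => k * b k := by fun_prop
  have hb' : Measurable fun k => -(k * a k) := by fun_prop
  have hi' : Integrable fun k => |k * b k| + |-(k * a k)| := by
    simp_rw [abs_add_abs_wave_deriv]
    exact hi1
  have e : ∀ k, |k| * (|k * b k| + |-(k * a k)|) = k ^ 2 * (|a k| + |b k|) := by
    intro k
    rw [abs_add_abs_wave_deriv, ← mul_assoc, abs_mul_abs_self, sq]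
  have hi1' : Integrable fun k => |k| * (|k * b k| + |-(k * a k)|) := by
    simp_rw [e]
    exact hi2
  have hd1 : deriv (fun x => ∫ k, wave a b x k) =
      fun x => ∫ k, wave (fun k => k * b k) (fun k => -(k * a k)) x k :=
    funext fun x => (hasDerivAt_integral_wave ha hb hi hi1 x).deriv
  have hd2 := fun x => hasDerivAt_integral_wave ha' hb' hi' hi1' x
  refine ⟨?_, fun x => ?_⟩
  · rw [show (2 : WithTop ℕ∞) = 1 + 1 by norm_num, contDiff_succ_iff_deriv]
    refine ⟨fun x => (hasDerivAt_integral_wave ha hb hi hi1 x).differentiableAt, by simp, ?_⟩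
    rw [hd1, contDiff_one_iff_deriv]
    refine ⟨fun x => (hd2 x).differentiableAt, ?_⟩
    rw [funext fun x => (hd2 x).deriv]
    refine continuous_integral_wave (by fun_prop) (by fun_prop) ?_
    have := hi1'
    simp_rw [← abs_add_abs_wave_deriv (fun k => k * b k) (fun k => -(k * a k))] at this
    exact this
  · rw [iteratedDeriv_succ, iteratedDeriv_one, hd1, (hd2 x).deriv, ← integral_neg]
    refine integral_congr_ae (ae_of_all _ fun k => ?_)
    simp only [wave]
    ring

/-- The Riesz-Feller derivative of a superposition of waves. -/
theorem rieszFeller_integral_wave {α : ℝ} (hα : 0 < α) (hα2 : α < 2) (ha : Measurable a)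
    (hb : Measurable b) (hi : Integrable fun k => |a k| + |b k|)
    (hiα : Integrable fun k => |k| ^ α * (|a k| + |b k|)) (x : ℝ) :
    IntegrableOn (fun y => (((∫ k, wave a b (x + y) k) - ∫ k, wave a b x k) +
      ((∫ k, wave a b (x - y) k) - ∫ k, wave a b x k)) / y ^ (1 + α)) (Ioi 0) ∧
    rieszFellerDeriv α (fun x => ∫ k, wave a b x k) x = -∫ k, |k| ^ α * wave a b x k := by
  have hW := fun x => integrable_wave ha hb hi x
  set C : ℝ := Real.pi / (2 * Real.sin (Real.pi * α / 2)) / Real.Gamma (1 + α) with hC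
  set H : ℝ × ℝ → ℝ :=
    fun p => (1 - Real.cos (p.2 * p.1)) / p.1 ^ (1 + α) * (-2 * wave a b x p.2) with hH
  have e : ∀ y, (((∫ k, wave a b (x + y) k) - ∫ k, wave a b x k) +
      ((∫ k, wave a b (x - y) k) - ∫ k, wave a b x k)) / y ^ (1 + α) = ∫ k, H (y, k) := by
    intro y
    have h := integral_add ((hW (x + y)).sub (hW x)) ((hW (x - y)).sub (hW x))
    simp only [Pi.sub_apply] at h
    rw [← integral_sub (hW _) (hW _), ← integral_sub (hW _) (hW _), ← h, ← integral_div]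
    refine integral_congr_ae (ae_of_all _ fun k => ?_)
    simp only [hH]
    rw [wave_second_difference]
    ring
  have hker := fun k => integral_one_sub_cos_div_rpow hα hα2 k
  have hmH : Measurable H :=
    Measurable.mul (by fun_prop) (((measurable_wave_left ha hb x).comp measurable_snd).const_mul _)
  have hint : Integrable H ((volume.restrict (Ioi 0)).prod volume) := by
    refine (integrable_prod_iff' hmH.aestronglyMeasurable).2 ⟨?_, ?_⟩
    · exact ae_of_all _ fun k => (hker k).1.mul_const (-2 * wave a b x k)
    · refine ((hiα.const_mul (2 * C)).mono' hmH.aestronglyMeasurable.norm.prod_swap.integral_prod_right'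
        (ae_of_all _ fun k => ?_))
      -- Integrating the nonnegative kernel factor in y yields `C * |k| ^ α`, so the assumed
      -- integrability of the weighted coefficients is what Fubini requires.
      have h1 : ∫ y in Ioi (0 : ℝ), ‖H (y, k)‖ = |k| ^ α * C * (2 * |wave a b x k|) := by
        rw [← (hker k).2, ← integral_mul_const]
        refine setIntegral_congr_fun measurableSet_Ioi fun y (hy : 0 < y) => ?_
        have h2 : 0 ≤ (1 - Real.cos (k * y)) / y ^ (1 + α) :=
          div_nonneg (by linarith [Real.cos_le_one (k * y)]) (by positivity)
        simp only [hH]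
        rw [norm_mul, Real.norm_of_nonneg h2, norm_mul, norm_neg, Real.norm_two, Real.norm_eq_abs]
      have hC0 : 0 ≤ C := by
        have := Real.sin_pos_of_pos_of_lt_pi (x := Real.pi * α / 2) (by positivity)
          (by nlinarith [Real.pi_pos])
        have := Real.Gamma_pos_of_pos (show 0 < 1 + α by positivity)
        positivity
      have h3 := abs_wave_le a b x k
      rw [Real.norm_of_nonneg (integral_nonneg fun _ => norm_nonneg _), h1]
      calc _ = 2 * C * |k| ^ α * |wave a b x k| := by ring
        _ ≤ 2 * C * |k| ^ α * (|a k| + |b k|) := by gcongr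
        _ = _ := by ring
  have hval : ∫ y in Ioi (0 : ℝ), ∫ k, H (y, k) = -(2 * C) * ∫ k, |k| ^ α * wave a b x k := by
    rw [integral_integral_swap (f := fun y k => H (y, k)) hint, ← integral_const_mul]
    refine integral_congr_ae (ae_of_all _ fun k => ?_)
    simp only [hH]
    rw [integral_mul_const, (hker k).2]
    ring
  refine ⟨?_, ?_⟩
  · simp_rw [e]
    exact hint.integral_prod_left
  · rw [rieszFellerDeriv, if_neg hα2.ne]
    simp_rw [e]
    have h1 := Real.sin_pos_of_pos_of_lt_pi (x := Real.pi * α / 2) (by positivity)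
      (by nlinarith [Real.pi_pos])
    have h2 := Real.Gamma_pos_of_pos (show 0 < 1 + α by positivity)
    have hpi := Real.pi_pos
    rw [mul_comm Real.pi α] at h1
    rw [hval, hC, mul_comm Real.pi α]
    have h3 := h1.ne'
    field_simp

theorem rieszFeller_integral_wave_two (ha : Measurable a)
    (hb : Measurable b) (hi : Integrable fun k => |a k| + |b k|)
    (hi2 : Integrable fun k => |k| ^ (2 : ℝ) * (|a k| + |b k|)) (x : ℝ) :
    rieszFellerDeriv 2 (fun x => ∫ k, wave a b x k) x = -∫ k, |k| ^ (2 : ℝ) * wave a b x k := by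
  rw [rieszFellerDeriv, if_pos rfl]
  simp only [Real.rpow_two, sq_abs] at hi2 ⊢
  exact (contDiff_two_integral_wave ha hb hi hi2).2 x

end wave

/-! ### Time evolution of wave superpositions -/

section evolution

variable {α β : ℝ} {a b : ℝ → ℝ}

theorem measurable_relaxation (hβ : 0 < β) (hβ1 : β ≤ 1) (α t : ℝ) :
    Measurable fun k : ℝ => mittagLeffler β (-(|k| ^ α * t ^ β)) := by
  have h := (continuous_mittagLeffler hβ hβ1).measurable
  fun_prop

theorem measurable_relaxationDeriv (hβ : 0 < β) (hβ1 : β ≤ 1) (α : ℝ) :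
    Measurable fun p : ℝ × ℝ => relaxationDeriv β (|p.2| ^ α) p.1 := by
  have h := (continuous_deriv_mittagLeffler hβ hβ1).measurable
  unfold relaxationDeriv
  fun_prop

theorem abs_relaxation_le (hβ : 0 < β) (hβ1 : β ≤ 1) (α k : ℝ) {t : ℝ} (ht : 0 ≤ t) :
    |mittagLeffler β (-(|k| ^ α * t ^ β))| ≤ 1 :=
  abs_mittagLeffler_le hβ hβ1 (neg_nonpos.2 (by positivity))

theorem integral_inverse_nonneg (hβ : 0 < β) (hβ1 : β ≤ 1) :
    0 ≤ ∫ x, x ^ (-β) ∂(stableLaw β) := by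
  refine integral_nonneg_of_ae ?_
  filter_upwards [ae_pos_stableLaw hβ hβ1] with x hx
  exact Real.rpow_nonneg hx.le _

theorem abs_wave_mul_relaxationDeriv_le (hβ : 0 < β) (hβ1 : β ≤ 1) (a b : ℝ → ℝ) (x k : ℝ)
    {t : ℝ} (ht : 0 < t) : |wave a b x k * relaxationDeriv β (|k| ^ α) t| ≤
      (∫ x, x ^ (-β) ∂(stableLaw β)) * β * t ^ (β - 1) * (|k| ^ α * (|a k| + |b k|)) := by
  rw [abs_mul]
  have h1 := abs_relaxationDeriv_le hβ hβ1 (l := |k| ^ α) (by positivity) ht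
  have h2 := abs_wave_le a b x k
  calc _ ≤ (|a k| + |b k|) * ((∫ x, x ^ (-β) ∂(stableLaw β)) * β * (|k| ^ α * t ^ (β - 1))) := by
        gcongr
    _ = _ := by ring

/-- The time derivative carries the singular factor `t ^ (β - 1)`, so domination is arranged on
times above `t / 2` only. -/
theorem hasDerivAt_integral_wave_relaxation (hβ : 0 < β) (hβ1 : β ≤ 1)
    (ha : Measurable a) (hb : Measurable b) (hi : Integrable fun k => |a k| + |b k|)
    (hiα : Integrable fun k => |k| ^ α * (|a k| + |b k|)) (x : ℝ) {t : ℝ} (ht : 0 < t) :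
    HasDerivAt (fun t => ∫ k, wave a b x k * mittagLeffler β (-(|k| ^ α * t ^ β)))
      (∫ k, wave a b x k * relaxationDeriv β (|k| ^ α) t) t := by
  have hm := fun t => (measurable_wave_left ha hb x).mul (measurable_relaxation hβ hβ1 α t)
  have hC := integral_inverse_nonneg hβ hβ1
  refine (hasDerivAt_integral_of_dominated_loc_of_deriv_le (s := Ioi (t / 2))
    (F := fun t k => wave a b x k * mittagLeffler β (-(|k| ^ α * t ^ β)))
    (F' := fun t k => wave a b x k * relaxationDeriv β (|k| ^ α) t)
    (bound := fun k => (∫ x, x ^ (-β) ∂(stableLaw β)) * β * (t / 2) ^ (β - 1) *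
      (|k| ^ α * (|a k| + |b k|))) (Ioi_mem_nhds (by linarith))
    (Eventually.of_forall fun t => (hm t).aestronglyMeasurable)
    ((integrable_wave ha hb hi x).mul_bdd (c := 1)
      (measurable_relaxation hβ hβ1 α t).aestronglyMeasurable
      (ae_of_all _ fun k => abs_relaxation_le hβ hβ1 α k ht.le))
    ?_ (ae_of_all _ fun k s hs => ?_) (hiα.const_mul _) (ae_of_all _ fun k s hs => ?_)).2
  · have h := (measurable_relaxationDeriv hβ hβ1 α).comp
      (by fun_prop : Measurable fun k : ℝ => (t, k))
    exact ((measurable_wave_left ha hb x).mul h).aestronglyMeasurable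
  · have hs' : t / 2 < s := hs
    have hs0 : 0 < s := by linarith
    refine (abs_wave_mul_relaxationDeriv_le hβ hβ1 a b x k hs0).trans ?_
    have := Real.rpow_le_rpow_of_nonpos (by linarith : 0 < t / 2) hs'.le
      (by linarith : β - 1 ≤ 0)
    gcongr
  · have hs' : t / 2 < s := hs
    exact (hasDerivAt_relaxation hβ hβ1 _ (by linarith)).const_mul _

theorem continuousOn_integral_wave_relaxationDeriv (hβ : 0 < β) (hβ1 : β ≤ 1)
    (ha : Measurable a) (hb : Measurable b)
    (hiα : Integrable fun k => |k| ^ α * (|a k| + |b k|)) (x : ℝ) :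
    ContinuousOn (fun t => ∫ k, wave a b x k * relaxationDeriv β (|k| ^ α) t) (Ioi 0) := by
  intro t (ht : 0 < t)
  refine ContinuousAt.continuousWithinAt ?_
  have hC := integral_inverse_nonneg hβ hβ1
  refine continuousAt_of_dominated (bound := fun k => (∫ x, x ^ (-β) ∂(stableLaw β)) * β *
    (t / 2) ^ (β - 1) * (|k| ^ α * (|a k| + |b k|))) (Eventually.of_forall fun s => ?_) ?_
    (hiα.const_mul _) (ae_of_all _ fun k => ?_)
  · have h := (measurable_relaxationDeriv hβ hβ1 α).comp
      (by fun_prop : Measurable fun k : ℝ => (s, k))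
    exact ((measurable_wave_left ha hb x).mul h).aestronglyMeasurable
  · filter_upwards [Ioi_mem_nhds (show t / 2 < t by linarith)] with s hs
    have hs' : t / 2 < s := hs
    have hs0 : 0 < s := by linarith
    refine ae_of_all _ fun k => (abs_wave_mul_relaxationDeriv_le hβ hβ1 a b x k hs0).trans ?_
    have := Real.rpow_le_rpow_of_nonpos (by linarith : 0 < t / 2) hs'.le
      (by linarith : β - 1 ≤ 0)
    gcongr
  · have h1 : ContinuousAt (fun t : ℝ => t ^ β) t := Real.continuousAt_rpow_const _ _ (Or.inl ht.ne')
    have h2 : ContinuousAt (fun t : ℝ => t ^ (β - 1)) t :=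
      Real.continuousAt_rpow_const _ _ (Or.inl ht.ne')
    have h3 := continuous_deriv_mittagLeffler hβ hβ1
    unfold relaxationDeriv
    refine continuousAt_const.mul (ContinuousAt.mul ?_ ?_)
    · exact h3.continuousAt.comp (continuousAt_const.mul h1).neg
    · exact (continuousAt_const.mul (continuousAt_const.mul h2)).neg

theorem integrableOn_integral_wave_relaxationDeriv (hβ : 0 < β) (hβ1 : β ≤ 1)
    (ha : Measurable a) (hb : Measurable b)
    (hiα : Integrable fun k => |k| ^ α * (|a k| + |b k|)) (x T : ℝ) :
    IntegrableOn (fun t => ∫ k, wave a b x k * relaxationDeriv β (|k| ^ α) t) (Ioc 0 T) := by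
  rcases le_or_gt T 0 with hT | hT
  · simp [Ioc_eq_empty_of_le hT]
  have h : IntegrableOn (fun t : ℝ => t ^ (β - 1)) (Ioc 0 T) :=
    (intervalIntegrable_iff_integrableOn_Ioc_of_le hT.le).1
      (intervalIntegral.intervalIntegrable_rpow' (by linarith))
  refine ((h.const_mul ((∫ x, x ^ (-β) ∂(stableLaw β)) * β)).mul_const
    (∫ k, |k| ^ α * (|a k| + |b k|))).mono' ?_ ?_
  · exact ((continuousOn_integral_wave_relaxationDeriv hβ hβ1 ha hb hiα x).mono
      fun t ht => ht.1).aestronglyMeasurable measurableSet_Ioc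
  · filter_upwards [ae_restrict_mem measurableSet_Ioc] with t ht
    rw [← integral_const_mul]
    exact norm_integral_le_of_norm_le (hiα.const_mul _)
      (ae_of_all _ fun k => abs_wave_mul_relaxationDeriv_le hβ hβ1 a b x k ht.1)

/-- For `β < 1` Fubini applies because the integrand is dominated by a Beta integrand in time
multiplied by the weighted coefficients in frequency; then each frequency is an eigenfunction. For
`β = 1` the relation is the exponential differential equation. -/
theorem caputo_integral_wave_relaxation (hβ : 0 < β) (hβ1 : β ≤ 1)
    (ha : Measurable a) (hb : Measurable b)
    (hiα : Integrable fun k => |k| ^ α * (|a k| + |b k|)) (x : ℝ) {t : ℝ} (ht : 0 < t)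
    {v : ℝ → ℝ} (hv : ∀ s, 0 < s →
      deriv v s = ∫ k, wave a b x k * relaxationDeriv β (|k| ^ α) s) :
    caputoDeriv β v t =
      -∫ k, |k| ^ α * (wave a b x k * mittagLeffler β (-(|k| ^ α * t ^ β))) := by
  rw [caputoDeriv, ← integral_neg]
  split_ifs with h1
  · rw [hv t ht]
    refine integral_congr_ae (ae_of_all _ fun k => ?_)
    simp only [h1, relaxationDeriv, deriv_mittagLeffler_one, sub_self, Real.rpow_zero]
    ring
  have hβ1' : β < 1 := lt_of_le_of_ne hβ1 h1
  have hC := integral_inverse_nonneg hβ hβ1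
  have hG : 0 < Real.Gamma (1 - β) := Real.Gamma_pos_of_pos (by linarith)
  have hm : Measurable fun p : ℝ × ℝ =>
      (t - p.1) ^ (-β) * (wave a b x p.2 * relaxationDeriv β (|p.2| ^ α) p.1) :=
    Measurable.mul (by fun_prop) (((measurable_wave_left ha hb x).comp measurable_snd).mul
      (measurable_relaxationDeriv hβ hβ1 α))
  have hb1 := (integral_sub_rpow_mul_rpow (a := 1 - β) (b := β) (by linarith) hβ ht).1
  have hint : Integrable (fun p : ℝ × ℝ =>
      (t - p.1) ^ (-β) * (wave a b x p.2 * relaxationDeriv β (|p.2| ^ α) p.1))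
      ((volume.restrict (Ioc 0 t)).prod volume) := by
    refine ((hb1.mul_prod hiα).const_mul ((∫ x, x ^ (-β) ∂(stableLaw β)) * β)).mono'
      hm.aestronglyMeasurable ?_
    have hp : ∀ᵐ p : ℝ × ℝ ∂((volume.restrict (Ioc 0 t)).prod volume), p.1 ∈ Ioc 0 t :=
      Measure.quasiMeasurePreserving_fst.ae (ae_restrict_mem measurableSet_Ioc)
    filter_upwards [hp] with p hp
    have h2 : 0 ≤ t - p.1 := by linarith [hp.2]
    rw [norm_mul, Real.norm_of_nonneg (Real.rpow_nonneg h2 _), Real.norm_eq_abs,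
      show 1 - β - 1 = -β by ring]
    calc _ ≤ (t - p.1) ^ (-β) * ((∫ x, x ^ (-β) ∂(stableLaw β)) * β * p.1 ^ (β - 1) *
          (|p.2| ^ α * (|a p.2| + |b p.2|))) := by
          gcongr
          exact abs_wave_mul_relaxationDeriv_le hβ hβ1 a b x p.2 hp.1
      _ = _ := by ring
  rw [intervalIntegral.integral_of_le ht.le]
  have e : ∫ τ in Ioc 0 t, (t - τ) ^ (-β) * deriv v τ = ∫ τ in Ioc 0 t, ∫ k,
      (t - τ) ^ (-β) * (wave a b x k * relaxationDeriv β (|k| ^ α) τ) := by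
    refine setIntegral_congr_fun measurableSet_Ioc fun τ hτ => ?_
    simp only [hv τ hτ.1]
    rw [integral_const_mul]
  rw [e, integral_integral_swap (f := fun τ k =>
    (t - τ) ^ (-β) * (wave a b x k * relaxationDeriv β (|k| ^ α) τ)) hint, ← integral_const_mul]
  refine integral_congr_ae (ae_of_all _ fun k => ?_)
  have e2 : ∫ τ in Ioc 0 t, (t - τ) ^ (-β) * (wave a b x k * relaxationDeriv β (|k| ^ α) τ) =
      wave a b x k * ∫ τ in Ioc 0 t, (t - τ) ^ (-β) * relaxationDeriv β (|k| ^ α) τ := by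
    rw [← integral_const_mul]
    refine integral_congr_ae (ae_of_all _ fun τ => ?_)
    simp only
    ring
  simp only
  rw [e2, integral_relaxationDeriv hβ hβ1' (by positivity) ht]
  field_simp

theorem wave_mul (a b e : ℝ → ℝ) (x k : ℝ) :
    wave a b x k * e k = wave (fun k => a k * e k) (fun k => b k * e k) x k := by
  simp only [wave]
  ring

/-- The time operator acts on the relaxation factor with the coefficients fixed. The space operator,
at fixed t, absorbs that factor into new coefficients that are no larger. Continuity and decay are
left as hypotheses, as they are easier to see from the convolution. -/
theorem isSolution_of_eq_integral_wave (hα : 0 < α) (hα2 : α ≤ 2) (hβ : 0 < β) (hβ1 : β ≤ 1)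
    (ha : Measurable a) (hb : Measurable b) (hi : Integrable fun k => |a k| + |b k|)
    (hiα : Integrable fun k => |k| ^ α * (|a k| + |b k|)) {f : ℝ → ℝ} {u : ℝ → ℝ → ℝ}
    (hcont : ContinuousOn (fun p : ℝ × ℝ => u p.1 p.2) (univ ×ˢ Ici 0))
    (hinit : ∀ x, u x 0 = f x)
    (hvan : ∀ T : ℝ, TendstoUniformlyOn (fun x t => u x t) 0 (cocompact ℝ) (Icc 0 T))
    (hu : ∀ x t, 0 < t →
      u x t = ∫ k, wave a b x k * mittagLeffler β (-(|k| ^ α * t ^ β))) :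
    IsSolution α β f u := by
  have hev : ∀ x t, 0 < t → u x =ᶠ[𝓝 t] fun t =>
      ∫ k, wave a b x k * mittagLeffler β (-(|k| ^ α * t ^ β)) := by
    intro x t ht
    filter_upwards [Ioi_mem_nhds ht] with s hs
    exact hu x s hs
  have hd : ∀ x t, 0 < t →
      HasDerivAt (u x) (∫ k, wave a b x k * relaxationDeriv β (|k| ^ α) t) t := fun x t ht =>
    (hasDerivAt_integral_wave_relaxation hβ hβ1 ha hb hi hiα x ht).congr_of_eventuallyEq
      (hev x t ht)
  have hm := fun t => measurable_relaxation hβ hβ1 α t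
  have hle : ∀ t, 0 < t → ∀ k, |a k * mittagLeffler β (-(|k| ^ α * t ^ β))| +
      |b k * mittagLeffler β (-(|k| ^ α * t ^ β))| ≤ |a k| + |b k| := by
    intro t ht k
    have h := abs_relaxation_le hβ hβ1 α k ht.le
    rw [abs_mul, abs_mul]
    exact add_le_add (mul_le_of_le_one_right (abs_nonneg _) h)
      (mul_le_of_le_one_right (abs_nonneg _) h)
  have hma := fun t => ha.mul (hm t)
  have hmb := fun t => hb.mul (hm t)
  have hi' : ∀ t, 0 < t → Integrable fun k => |a k * mittagLeffler β (-(|k| ^ α * t ^ β))| +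
      |b k * mittagLeffler β (-(|k| ^ α * t ^ β))| := by
    intro t ht
    refine hi.mono' ((hma t).abs.add (hmb t).abs).aestronglyMeasurable (ae_of_all _ fun k => ?_)
    rw [Real.norm_of_nonneg (by positivity)]
    exact hle t ht k
  have hiα' : ∀ t, 0 < t → Integrable fun k => |k| ^ α *
      (|a k * mittagLeffler β (-(|k| ^ α * t ^ β))| +
      |b k * mittagLeffler β (-(|k| ^ α * t ^ β))|) := by
    intro t ht
    refine hiα.mono' (Measurable.mul (by fun_prop)
      ((hma t).abs.add (hmb t).abs)).aestronglyMeasurable (ae_of_all _ fun k => ?_)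
    rw [Real.norm_of_nonneg (by positivity)]
    exact mul_le_mul_of_nonneg_left (hle t ht k) (by positivity)
  have hu' : ∀ t, 0 < t → (fun x => u x t) = fun x => ∫ k,
      wave (fun k => a k * mittagLeffler β (-(|k| ^ α * t ^ β)))
        (fun k => b k * mittagLeffler β (-(|k| ^ α * t ^ β))) x k := by
    intro t ht
    funext x
    rw [hu x t ht]
    exact integral_congr_ae (ae_of_all _ fun k =>
      wave_mul a b (fun k => mittagLeffler β (-(|k| ^ α * t ^ β))) x k)
  refine ⟨hcont, hinit, hvan, fun x t ht => (hd x t ht).differentiableAt, fun x => ?_,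
    fun x T => ?_, fun h2 t ht => ?_, fun h2 x t ht => ?_, fun x t ht => ?_⟩
  · exact (continuousOn_integral_wave_relaxationDeriv hβ hβ1 ha hb hiα x).congr
      fun t ht => (hd x t ht).deriv
  · exact (integrableOn_integral_wave_relaxationDeriv hβ hβ1 ha hb hiα x T).congr_fun
      (fun t ht => (hd x t ht.1).deriv.symm) measurableSet_Ioc
  · have h := hiα' t ht
    simp only [h2, Real.rpow_two, sq_abs] at h
    rw [hu' t ht]
    have h3 := hma t
    have h4 := hmb t
    have h5 := hi' t ht
    simp only [h2, Real.rpow_two, sq_abs] at h3 h4 h5 ⊢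
    exact (contDiff_two_integral_wave h3 h4 h5 h).1
  · have h := fun z => congrFun (hu' t ht) z
    simp_rw [h]
    exact (rieszFeller_integral_wave hα h2 (hma t) (hmb t) (hi' t ht) (hiα' t ht) x).1
  · rw [caputo_integral_wave_relaxation hβ hβ1 ha hb hiα x ht fun s hs => (hd x s hs).deriv,
      hu' t ht]
    simp_rw [wave_mul a b (fun k => mittagLeffler β (-(|k| ^ α * t ^ β))) x]
    rcases hα2.eq_or_lt with h2 | h2
    · have h3 := hma t
      have h4 := hmb t
      have h5 := hi' t ht
      have h6 := hiα' t ht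
      subst h2
      exact (rieszFeller_integral_wave_two h3 h4 h5 h6 x).symm
    · exact (rieszFeller_integral_wave hα h2 (hma t) (hmb t) (hi' t ht) (hiα' t ht) x).2.symm

end evolution

/-! ### Fourier representation of the datum and of the convolution -/

section representation

variable {α β : ℝ} {f : ℝ → ℝ}

/-- The Fourier transform `∫ exp (i k x) f x dx`. -/
def fourierHat (f : ℝ → ℝ) (k : ℝ) : ℂ :=
  ∫ x : ℝ, Complex.exp (Complex.I * (k : ℂ) * (x : ℂ)) * (f x : ℂ)

theorem norm_cexp_I_mul_mul (k x : ℝ) : ‖Complex.exp (Complex.I * k * x)‖ = 1 := by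
  rw [show Complex.I * (k : ℂ) * x = ((k * x : ℝ) : ℂ) * Complex.I by push_cast; ring]
  exact Complex.norm_exp_ofReal_mul_I _

theorem continuous_fourierHat (hc : Continuous f) (hi : Integrable f) :
    Continuous (fourierHat f) := by
  refine continuous_of_dominated (bound := fun x => ‖f x‖) (fun k => ?_) (fun k => ?_) hi.norm ?_
  · exact (Continuous.aestronglyMeasurable (by fun_prop))
  · refine ae_of_all _ fun x => ?_
    rw [norm_mul, norm_cexp_I_mul_mul, one_mul, Complex.norm_real]
  · exact ae_of_all _ fun x => by fun_prop

theorem integrable_fourierHat_of_weight {w : ℝ → ℝ} (hc : Continuous f) (hi : Integrable f)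
    (hw : Measurable w) (hF : Integrable fun k => (1 + |k| ^ α) * ‖fourierHat f k‖)
    (hle : ∀ k, |w k| ≤ 1 + |k| ^ α) : Integrable fun k => w k * ‖fourierHat f k‖ := by
  have hm := (continuous_fourierHat hc hi).measurable
  refine hF.mono' (Measurable.aestronglyMeasurable (by fun_prop)) (ae_of_all _ fun k => ?_)
  rw [norm_mul, norm_norm]
  exact mul_le_mul_of_nonneg_right (hle k) (norm_nonneg _)

theorem integrable_fourierHat (hc : Continuous f) (hi : Integrable f)
    (hF : Integrable fun k => (1 + |k| ^ α) * ‖fourierHat f k‖) : Integrable (fourierHat f) := by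
  have h := integrable_fourierHat_of_weight (w := fun _ => 1) hc hi (by fun_prop) hF fun k => by
    have : 0 ≤ |k| ^ α := by positivity
    simpa
  simp only [one_mul] at h
  exact (integrable_norm_iff (continuous_fourierHat hc hi).aestronglyMeasurable).1 h

/-- The coefficient of `cos (k x)` in the Fourier representation of `f`. -/
def cosCoeff (f : ℝ → ℝ) (k : ℝ) : ℝ := 1 / (2 * Real.pi) * (fourierHat f k).re

/-- The coefficient of `sin (k x)` in the Fourier representation of `f`. -/
def sinCoeff (f : ℝ → ℝ) (k : ℝ) : ℝ := 1 / (2 * Real.pi) * (fourierHat f k).im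

theorem measurable_cosCoeff (hc : Continuous f) (hi : Integrable f) : Measurable (cosCoeff f) :=
  (Complex.measurable_re.comp (continuous_fourierHat hc hi).measurable).const_mul _

theorem measurable_sinCoeff (hc : Continuous f) (hi : Integrable f) : Measurable (sinCoeff f) :=
  (Complex.measurable_im.comp (continuous_fourierHat hc hi).measurable).const_mul _

theorem abs_coeff_le (f : ℝ → ℝ) (k : ℝ) :
    |cosCoeff f k| + |sinCoeff f k| ≤ ‖fourierHat f k‖ := by
  have hpi := Real.pi_gt_three
  have h1 := Complex.abs_re_le_norm (fourierHat f k)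
  have h2 := Complex.abs_im_le_norm (fourierHat f k)
  have h3 : 0 ≤ 1 / (2 * Real.pi) := by positivity
  rw [cosCoeff, sinCoeff, abs_mul, abs_mul, abs_of_nonneg h3, ← mul_add, one_div_mul_eq_div,
    div_le_iff₀ (by positivity)]
  nlinarith [norm_nonneg (fourierHat f k)]

theorem integrable_weight_coeff {w : ℝ → ℝ} (hc : Continuous f) (hi : Integrable f)
    (hw : Measurable w) (hF : Integrable fun k => (1 + |k| ^ α) * ‖fourierHat f k‖)
    (hle : ∀ k, |w k| ≤ 1 + |k| ^ α) :
    Integrable fun k => w k * (|cosCoeff f k| + |sinCoeff f k|) := by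
  refine (integrable_fourierHat_of_weight hc hi hw hF hle).mono
    (hw.mul ((measurable_cosCoeff hc hi).abs.add
      (measurable_sinCoeff hc hi).abs)).aestronglyMeasurable (ae_of_all _ fun k => ?_)
  rw [norm_mul, norm_mul, norm_norm, Real.norm_of_nonneg (by positivity :
    0 ≤ |cosCoeff f k| + |sinCoeff f k|)]
  exact mul_le_mul_of_nonneg_left (abs_coeff_le f k) (norm_nonneg _)

theorem integrable_coeff (hc : Continuous f) (hi : Integrable f)
    (hF : Integrable fun k => (1 + |k| ^ α) * ‖fourierHat f k‖) :
    Integrable fun k => |cosCoeff f k| + |sinCoeff f k| := by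
  have h := integrable_weight_coeff (w := fun _ => 1) hc hi (by fun_prop) hF fun k => by
    have : 0 ≤ |k| ^ α := by positivity
    simpa
  simpa using h

theorem integrable_rpow_coeff (hc : Continuous f) (hi : Integrable f)
    (hF : Integrable fun k => (1 + |k| ^ α) * ‖fourierHat f k‖) :
    Integrable fun k => |k| ^ α * (|cosCoeff f k| + |sinCoeff f k|) :=
  integrable_weight_coeff (w := fun k => |k| ^ α) hc hi (by fun_prop) hF fun k => by
    have : 0 ≤ |k| ^ α := by positivity
    rw [abs_of_nonneg this]
    linarith

theorem ofReal_eq_integral_fourierHat (hc : Continuous f) (hi : Integrable f)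
    (hF : Integrable fun k => (1 + |k| ^ α) * ‖fourierHat f k‖) (x : ℝ) :
    (f x : ℂ) = 1 / (2 * (Real.pi : ℂ)) *
      ∫ k : ℝ, Complex.exp (-(Complex.I * k * x)) * fourierHat f k :=
  eq_integral_of_integrable_fourier (g := fun x => (f x : ℂ)) (by fun_prop) hi.ofReal
    (integrable_fourierHat hc hi hF) x

theorem eq_integral_wave (hc : Continuous f) (hi : Integrable f)
    (hF : Integrable fun k => (1 + |k| ^ α) * ‖fourierHat f k‖) (x : ℝ) :
    f x = ∫ k, wave (cosCoeff f) (sinCoeff f) x k := by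
  have hint : Integrable fun k : ℝ => 1 / (2 * (Real.pi : ℂ)) *
      (Complex.exp (-(Complex.I * k * x)) * fourierHat f k) := by
    refine Integrable.const_mul ((integrable_fourierHat hc hi hF).bdd_mul (c := 1)
      (Continuous.aestronglyMeasurable (by fun_prop)) (ae_of_all _ fun k => ?_)) _
    have := norm_cexp_I_mul_mul (-k) x
    push_cast at this
    rw [← this]
    ring_nf
    rfl
  have h := ofReal_eq_integral_fourierHat hc hi hF x
  rw [← integral_const_mul] at h
  have h2 := Complex.reCLM.integral_comp_comm hint
  rw [← h] at h2
  simp only [Complex.reCLM_apply, Complex.ofReal_re] at h2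
  rw [← h2]
  refine integral_congr_ae (ae_of_all _ fun k => ?_)
  have e1 : Complex.exp (-(Complex.I * k * x)) =
      (Real.cos (k * x) : ℂ) - (Real.sin (k * x) : ℂ) * Complex.I := by
    rw [show -(Complex.I * (k : ℂ) * x) = ((-(k * x) : ℝ) : ℂ) * Complex.I by push_cast; ring,
      Complex.exp_mul_I, ← Complex.ofReal_cos, ← Complex.ofReal_sin, Real.cos_neg, Real.sin_neg]
    push_cast
    ring
  have e2 : (1 : ℂ) / (2 * (Real.pi : ℂ)) = ((1 / (2 * Real.pi) : ℝ) : ℂ) := by push_cast; rfl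
  simp only [wave, cosCoeff, sinCoeff]
  rw [e1, e2, Complex.re_ofReal_mul]
  simp only [Complex.mul_re, Complex.sub_re, Complex.sub_im, Complex.mul_im, Complex.ofReal_re,
    Complex.ofReal_im, Complex.I_re, Complex.I_im]
  ring

theorem abs_le_of_coeff (hc : Continuous f) (hi : Integrable f)
    (hF : Integrable fun k => (1 + |k| ^ α) * ‖fourierHat f k‖) (x : ℝ) :
    |f x| ≤ ∫ k, |cosCoeff f k| + |sinCoeff f k| := by
  rw [eq_integral_wave hc hi hF x, ← Real.norm_eq_abs]
  exact norm_integral_le_of_norm_le (integrable_coeff hc hi hF) (ae_of_all _ (abs_wave_le _ _ x))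

/-- The Riemann-Lebesgue lemma, applied to the inverse transform of `fourierHat f`. -/
theorem tendsto_zero_cocompact (hc : Continuous f) (hi : Integrable f)
    (hF : Integrable fun k => (1 + |k| ^ α) * ‖fourierHat f k‖) :
    Tendsto f (cocompact ℝ) (𝓝 0) := by
  have hpi := Real.pi_pos
  have h1 := Real.tendsto_integral_exp_smul_cocompact (fourierHat f)
  have h2 : Tendsto (fun x : ℝ => (2 * Real.pi)⁻¹ * x) (cocompact ℝ) (cocompact ℝ) :=
    (Homeomorph.mulLeft₀ (2 * Real.pi)⁻¹ (by positivity)).isClosedEmbedding.tendsto_cocompact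
  have h3 := (h1.comp h2).const_mul (1 / (2 * (Real.pi : ℂ)))
  have h4 : Tendsto (fun x => (f x : ℂ)) (cocompact ℝ) (𝓝 0) := by
    rw [mul_zero] at h3
    refine h3.congr fun x => ?_
    rw [ofReal_eq_integral_fourierHat hc hi hF x]
    congr 1
    refine integral_congr_ae (ae_of_all _ fun k => ?_)
    simp only [Circle.smul_def, smul_eq_mul, Real.fourierChar_apply]
    congr 2
    have : (Real.pi : ℂ) ≠ 0 := by exact_mod_cast hpi.ne'
    push_cast
    field_simp
  have h5 := (Complex.continuous_re.tendsto 0).comp h4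
  simpa [Function.comp_def] using h5

/-! ### The solution -/

theorem integral_cos_sin_kernelLaw (hα : 0 < α) (hα2 : α ≤ 2) (hβ : 0 < β) (hβ1 : β ≤ 1)
    {t : ℝ} (ht : 0 < t) (k : ℝ) :
    ∫ y, Real.cos (k * y) ∂(kernelLaw α β t) = mittagLeffler β (-(|k| ^ α * t ^ β)) ∧
    ∫ y, Real.sin (k * y) ∂(kernelLaw α β t) = 0 := by
  have := isProbabilityMeasure_kernelLaw hα hα2 hβ hβ1 ht
  have h := charFun_kernelLaw hα hα2 hβ hβ1 ht k
  rw [charFun_apply_real] at h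
  have hint : Integrable (fun x : ℝ => Complex.exp (k * x * Complex.I)) (kernelLaw α β t) := by
    refine Integrable.of_bound (C := 1) (Continuous.aestronglyMeasurable (by fun_prop))
      (ae_of_all _ fun y => ?_)
    rw [show (k * y * Complex.I : ℂ) = ((k * y : ℝ) : ℂ) * Complex.I by push_cast; ring,
      Complex.norm_exp_ofReal_mul_I]
  have hre := Complex.reCLM.integral_comp_comm hint
  have him := Complex.imCLM.integral_comp_comm hint
  rw [h] at hre him
  simp only [Complex.reCLM_apply, Complex.imCLM_apply, Complex.ofReal_re, Complex.ofReal_im,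
    ← Complex.ofReal_mul, Complex.exp_ofReal_mul_I_re, Complex.exp_ofReal_mul_I_im] at hre him
  exact ⟨hre, him⟩

/-- The addition formulas split off a multiple of the sine average, which vanishes because the
characteristic function of the law is real. -/
theorem integral_wave_sub_kernelLaw (hα : 0 < α) (hα2 : α ≤ 2) (hβ : 0 < β) (hβ1 : β ≤ 1)
    {t : ℝ} (ht : 0 < t) (a b : ℝ → ℝ) (x k : ℝ) :
    ∫ y, wave a b (x - y) k ∂(kernelLaw α β t) =
      wave a b x k * mittagLeffler β (-(|k| ^ α * t ^ β)) := by
  have := isProbabilityMeasure_kernelLaw hα hα2 hβ hβ1 ht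
  obtain ⟨h1, h2⟩ := integral_cos_sin_kernelLaw hα hα2 hβ hβ1 ht k
  have hc : Integrable (fun y => Real.cos (k * y)) (kernelLaw α β t) :=
    Integrable.of_bound (C := 1) (Continuous.aestronglyMeasurable (by fun_prop))
      (ae_of_all _ fun y => Real.abs_cos_le_one _)
  have hs : Integrable (fun y => Real.sin (k * y)) (kernelLaw α β t) :=
    Integrable.of_bound (C := 1) (Continuous.aestronglyMeasurable (by fun_prop))
      (ae_of_all _ fun y => Real.abs_sin_le_one _)
  have e : ∀ y, wave a b (x - y) k = wave a b x k * Real.cos (k * y) +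
      (a k * Real.sin (k * x) - b k * Real.cos (k * x)) * Real.sin (k * y) := by
    intro y
    simp only [wave, mul_sub, Real.cos_sub, Real.sin_sub]
    ring
  simp_rw [e]
  rw [integral_add (hc.const_mul _) (hs.const_mul _), integral_const_mul, integral_const_mul, h1,
    h2, mul_zero, add_zero]

theorem integral_sub_kernelLaw_eq_wave (hα : 0 < α) (hα2 : α ≤ 2) (hβ : 0 < β) (hβ1 : β ≤ 1)
    (hc : Continuous f) (hi : Integrable f)
    (hF : Integrable fun k => (1 + |k| ^ α) * ‖fourierHat f k‖) (x : ℝ) {t : ℝ} (ht : 0 < t) :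
    ∫ y, f (x - y) ∂(kernelLaw α β t) = ∫ k, wave (cosCoeff f) (sinCoeff f) x k *
      mittagLeffler β (-(|k| ^ α * t ^ β)) := by
  have := isProbabilityMeasure_kernelLaw hα hα2 hβ hβ1 ht
  simp_rw [fun y => eq_integral_wave hc hi hF (x - y)]
  rw [integral_integral_swap]
  · exact integral_congr_ae (ae_of_all _ fun k => integral_wave_sub_kernelLaw hα hα2 hβ hβ1 ht _ _ x k)
  · refine ((integrable_coeff hc hi hF).comp_snd (kernelLaw α β t)).mono' ?_
      (ae_of_all _ fun p => abs_wave_le _ _ _ _)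
    exact ((measurable_wave (measurable_cosCoeff hc hi) (measurable_sinCoeff hc hi)).comp
      (by fun_prop : Measurable fun p : ℝ × ℝ => (x - p.1, p.2))).aestronglyMeasurable

theorem integral_subordinatedKernel_mul (hα : 0 < α) (hα2 : α ≤ 2) (hβ : 0 < β) (hβ1 : β ≤ 1)
    (f : ℝ → ℝ) (x : ℝ) {t : ℝ} (ht : 0 < t) :
    ∫ y, subordinatedKernel α β (x - y) t * f y = ∫ y, f (x - y) ∂(kernelLaw α β t) := by
  rw [kernelLaw, integral_withDensity_eq_integral_toReal_smul
    (measurable_subordinatedKernel hα hα2 hβ hβ1 ht).ennreal_ofReal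
    (ae_of_all _ fun _ => ENNReal.ofReal_lt_top),
    ← integral_sub_left_eq_self _ _ x]
  refine integral_congr_ae (ae_of_all _ fun y => ?_)
  simp only [smul_eq_mul, sub_sub_cancel]
  rw [ENNReal.toReal_ofReal (subordinatedKernel_nonneg hα hα2 hβ hβ1 _ ht)]

theorem integral_sub_kernelLaw_eq_scale (hα : 0 < α) (hα2 : α ≤ 2) (hβ : 0 < β) (hβ1 : β ≤ 1)
    (hc : Continuous f) (x : ℝ) {t : ℝ} (ht : 0 < t) :
    ∫ y, f (x - y) ∂(kernelLaw α β t) =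
      ∫ w, f (x - t ^ (β / α) * w) ∂(kernelLaw α β 1) := by
  rw [kernelLaw_eq_map hα hα2 hβ hβ1 ht, integral_map (by fun_prop)
    (Continuous.aestronglyMeasurable (by fun_prop))]

/-- After rescaling, `u x t` is the mean of `f (x - t ^ (β/α) * w)` under the law at time 1. Since f
is continuous, bounded and vanishes at infinity, dominated convergence gives continuity up to t = 0
and uniform decay on bounded time intervals. The equation comes from the wave representation. -/
theorem isSolution_of_convolution (hα : 0 < α) (hα2 : α ≤ 2) (hβ : 0 < β) (hβ1 : β ≤ 1)
    (hc : Continuous f) (hi : Integrable f)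
    (hF : Integrable fun k => (1 + |k| ^ α) * ‖fourierHat f k‖) {u : ℝ → ℝ → ℝ}
    (h0 : ∀ x, u x 0 = f x)
    (hu : ∀ x t, 0 < t → u x t = ∫ y, subordinatedKernel α β (x - y) t * f y) :
    IsSolution α β f u := by
  have := isProbabilityMeasure_kernelLaw hα hα2 hβ hβ1 one_pos
  have hpos : 0 < β / α := by positivity
  have hpow := Real.continuous_rpow_const hpos.le
  have hU : ∀ x t, 0 ≤ t → u x t = ∫ w, f (x - t ^ (β / α) * w) ∂(kernelLaw α β 1) := by
    intro x t ht
    rcases ht.eq_or_lt with rfl | ht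
    -- At t = 0 the rescaled variable is 0, and the total mass 1 gives back f.
    · rw [h0, Real.zero_rpow hpos.ne']
      simp
    · rw [hu x t ht, integral_subordinatedKernel_mul hα hα2 hβ hβ1 f x ht,
        integral_sub_kernelLaw_eq_scale hα hα2 hβ hβ1 hc x ht]
  have hbd := abs_le_of_coeff hc hi hF
  refine isSolution_of_eq_integral_wave hα hα2 hβ hβ1 (measurable_cosCoeff hc hi)
    (measurable_sinCoeff hc hi) (integrable_coeff hc hi hF) (integrable_rpow_coeff hc hi hF) ?_ h0
    ?_ fun x t ht => ?_
  · have h1 : Continuous fun p : ℝ × ℝ => ∫ w, f (p.1 - p.2 ^ (β / α) * w) ∂(kernelLaw α β 1) := by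
      refine continuous_of_dominated (bound := fun _ => ∫ k, |cosCoeff f k| + |sinCoeff f k|)
        (fun p => Continuous.aestronglyMeasurable (by fun_prop))
        (fun p => ae_of_all _ fun w => hbd _) (integrable_const _) (ae_of_all _ fun w => ?_)
      have h2 : Continuous fun p : ℝ × ℝ => p.2 ^ (β / α) := hpow.comp continuous_snd
      fun_prop
    exact h1.continuousOn.congr fun p hp => hU p.1 p.2 hp.2
  · intro T
    rw [Metric.tendstoUniformlyOn_iff]
    intro ε hε
    rw [← eventually_prod_principal_iff (p := fun q : ℝ × ℝ =>
      dist ((0 : ℝ → ℝ) q.2) (u q.1 q.2) < ε)]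
    -- Dominated convergence along a filter needs a countable basis.
    have hgen : (cocompact ℝ).IsCountablyGenerated := by
      rw [cocompact_eq_atBot_atTop]
      infer_instance
    have h1 : Tendsto (fun q : ℝ × ℝ => ∫ w, f (q.1 - q.2 ^ (β / α) * w) ∂(kernelLaw α β 1))
        (cocompact ℝ ×ˢ 𝓟 (Icc 0 T)) (𝓝 (∫ _, (0 : ℝ) ∂(kernelLaw α β 1))) := by
      refine tendsto_integral_filter_of_dominated_convergence
        (fun _ => ∫ k, |cosCoeff f k| + |sinCoeff f k|)
        (Eventually.of_forall fun p => Continuous.aestronglyMeasurable (by fun_prop))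
        (Eventually.of_forall fun p => ae_of_all _ fun w => hbd _) (integrable_const _)
        (ae_of_all _ fun w => ?_)
      refine (tendsto_zero_cocompact hc hi hF).comp ?_
      refine tendsto_cocompact_of_tendsto_dist_comp_atTop 0 ?_
      have h2 : Tendsto (fun q : ℝ × ℝ => ‖q.1‖ - T ^ (β / α) * |w|)
          (cocompact ℝ ×ˢ 𝓟 (Icc 0 T)) atTop :=
        tendsto_atTop_add_const_right _ _ (tendsto_norm_cocompact_atTop.comp tendsto_fst)
      refine tendsto_atTop_mono' _ ?_ h2
      rw [EventuallyLE, eventually_prod_principal_iff]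
      refine Eventually.of_forall fun x t ht => ?_
      rw [dist_zero_right]
      have h3 : ‖t ^ (β / α) * w‖ ≤ T ^ (β / α) * |w| := by
        rw [norm_mul, Real.norm_of_nonneg (Real.rpow_nonneg ht.1 _)]
        exact mul_le_mul_of_nonneg_right (Real.rpow_le_rpow ht.1 ht.2 hpos.le) (abs_nonneg w)
      exact (sub_le_sub_left h3 _).trans (norm_sub_norm_le _ _)
    rw [integral_zero] at h1
    filter_upwards [h1.eventually (Metric.ball_mem_nhds 0 hε),
      (eventually_prod_principal_iff (p := fun q : ℝ × ℝ => 0 ≤ q.2)).2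
        (Eventually.of_forall fun x t ht => ht.1)] with q hq hq2
    rw [hU _ _ hq2, Pi.zero_apply, dist_comm]
    exact hq
  · rw [hu x t ht, integral_subordinatedKernel_mul hα hα2 hβ hβ1 f x ht,
      integral_sub_kernelLaw_eq_wave hα hα2 hβ hβ1 hc hi hF x ht]

end representation

/-! ### Maximum principle and uniqueness -/

section uniqueness

variable {α β : ℝ}

/-- Split at `t / 2`: on the left the kernel is bounded and g integrable; on the right g is bounded
and the kernel integrable. -/
theorem integrableOn_caputo_integrand (hβ1 : β < 1) {g : ℝ → ℝ} {t : ℝ} (ht : 0 < t)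
    (hβ : 0 < β) (hc : ContinuousOn g (Ioi 0)) (hi : IntegrableOn g (Ioc 0 t)) :
    IntegrableOn (fun τ => (t - τ) ^ (-β) * g τ) (Ioc 0 t) := by
  rw [← Ioc_union_Ioc_eq_Ioc (show 0 ≤ t / 2 by linarith) (show t / 2 ≤ t by linarith)]
  refine IntegrableOn.union ?_ ?_
  · have hi' := hi.mono_set (Ioc_subset_Ioc_right (show t / 2 ≤ t by linarith))
    refine Integrable.bdd_mul (c := (t / 2) ^ (-β)) hi'
      (Measurable.aestronglyMeasurable (by fun_prop)) ?_
    filter_upwards [ae_restrict_mem measurableSet_Ioc] with τ hτ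
    have h : t / 2 ≤ t - τ := by linarith [hτ.2]
    rw [Real.norm_of_nonneg (Real.rpow_nonneg (by linarith) _)]
    exact Real.rpow_le_rpow_of_nonpos (by linarith) h (by linarith)
  · have h1 := (integral_sub_rpow_mul_rpow (a := 1 - β) (b := 1) (by linarith) one_pos ht).1
    simp only [sub_self, Real.rpow_zero, mul_one, show 1 - β - 1 = -β by ring] at h1
    have h2 := h1.mono_set (Ioc_subset_Ioc_left (show 0 ≤ t / 2 by linarith))
    have hsub : Icc (t / 2) t ⊆ Ioi 0 := fun τ hτ => lt_of_lt_of_le (by linarith) hτ.1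
    obtain ⟨C, hC⟩ := isCompact_Icc.exists_bound_of_continuousOn (hc.mono hsub)
    refine Integrable.mul_bdd (c := C) h2
      ((hc.mono (Ioc_subset_Icc_self.trans hsub)).aestronglyMeasurable measurableSet_Ioc) ?_
    filter_upwards [ae_restrict_mem measurableSet_Ioc] with τ hτ
    exact hC τ (Ioc_subset_Icc_self hτ)

/-- For `β < 1`, integrate by parts. The derivative of `(t - τ) ^ (-β) * (v τ - v t)` is the Caputo
integrand plus a term that is nonpositive by maximality, so the integral is at least `t ^ (-β) * (v
t - v 0)`, which is positive. For `β = 1` the left difference quotients are at least δ. -/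
theorem caputoDeriv_pos_of_max (hβ : 0 < β) (hβ1 : β ≤ 1) {v : ℝ → ℝ} {t δ : ℝ} (ht : 0 < t)
    (hδ : 0 < δ) (hcont : ContinuousOn v (Icc 0 t)) (hd : ∀ s, 0 < s → DifferentiableAt ℝ v s)
    (hc : ContinuousOn (deriv v) (Ioi 0)) (hi : IntegrableOn (deriv v) (Ioc 0 t))
    (hmax : ∀ τ ∈ Icc 0 t, v τ ≤ v t - δ * (t - τ)) : 0 < caputoDeriv β v t := by
  rw [caputoDeriv]
  split_ifs with h1
  · refine hδ.trans_le ?_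
    have hs := (hasDerivAt_iff_tendsto_slope.1 (hd t ht).hasDerivAt).mono_left
      (nhdsWithin_mono t (show Iio t ⊆ {t}ᶜ from fun x hx => ne_of_lt hx))
    refine ge_of_tendsto hs ?_
    filter_upwards [self_mem_nhdsWithin, nhdsWithin_le_nhds (Ioi_mem_nhds ht)] with τ hτ hτ0
    have hτ' : τ < t := hτ
    have hτ0' : 0 < τ := hτ0
    have := hmax τ ⟨hτ0'.le, hτ'.le⟩
    rw [slope_comm, slope_def_field, le_div_iff₀ (by linarith)]
    linarith
  have hβ1' : β < 1 := lt_of_le_of_ne hβ1 h1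
  have hG : 0 < Real.Gamma (1 - β) := Real.Gamma_pos_of_pos (by linarith)
  refine mul_pos (by positivity) ?_
  set F : ℝ → ℝ := fun τ => (t - τ) ^ (-β) * (v τ - v t) with hF
  have hFt : F t = 0 := by simp [hF]
  have hcpow : ∀ τ, τ < t → ContinuousAt (fun τ : ℝ => (t - τ) ^ (-β)) τ := by
    intro τ hτ
    exact ContinuousAt.rpow_const (by fun_prop) (Or.inl (by linarith))
  have hFcont : ContinuousOn F (Icc 0 t) := by
    intro τ hτ
    rcases hτ.2.lt_or_eq with hlt | rfl
    · exact (hcpow τ hlt).continuousWithinAt.mul ((hcont τ hτ).sub continuousWithinAt_const)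
    · rw [ContinuousWithinAt, hFt]
      -- Differentiability at the endpoint bounds the increment linearly, which beats the
      -- singularity and leaves the power `1 - β`.
      obtain ⟨C, hC⟩ := (hd τ ht).hasDerivAt.isBigO_sub.bound
      have hlim : Tendsto (fun s : ℝ => |C| * |τ - s| ^ (1 - β)) (𝓝[Icc 0 τ] τ) (𝓝 0) := by
        have h2 : Continuous fun s : ℝ => |C| * |τ - s| ^ (1 - β) := by
          have := Real.continuous_rpow_const (q := 1 - β) (by linarith)
          fun_prop
        have h3 := h2.tendsto τ
        simp only [sub_self, abs_zero, Real.zero_rpow (show 1 - β ≠ 0 by linarith), mul_zero] at h3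
        exact h3.mono_left nhdsWithin_le_nhds
      refine squeeze_zero_norm' ?_ hlim
      filter_upwards [self_mem_nhdsWithin, nhdsWithin_le_nhds hC] with s hs hCs
      rcases hs.2.lt_or_eq with hlt | rfl
      · have h4 : 0 < τ - s := by linarith
        rw [hF, norm_mul, Real.norm_of_nonneg (Real.rpow_nonneg h4.le _), abs_of_pos h4,
          sub_eq_add_neg 1 β, Real.rpow_add h4, Real.rpow_one]
        rw [norm_sub_rev s τ, Real.norm_of_nonneg h4.le] at hCs
        calc _ ≤ (τ - s) ^ (-β) * (|C| * (τ - s)) := by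
              gcongr
              exact hCs.trans (mul_le_mul_of_nonneg_right (le_abs_self C) h4.le)
          _ = _ := by ring
      · rw [hFt, norm_zero]
        positivity
  -- The inequality form of the fundamental theorem of calculus requires integrability of the upper
  -- bound only, not of the more singular term with power `-β - 1`.
  have key := intervalIntegral.sub_le_integral_of_hasDeriv_right_of_le (a := 0) (b := t)
    (g := F) (g' := fun τ => (β * (t - τ) ^ (-β - 1)) * (v τ - v t) + (t - τ) ^ (-β) * deriv v τ)
    (φ := fun τ => (t - τ) ^ (-β) * deriv v τ) ht.le hFcont (fun τ hτ => ?_) ?_ fun τ hτ => ?_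
  · have h0 := hmax 0 ⟨le_rfl, ht.le⟩
    have hF0 : F 0 < 0 := by
      have : 0 < t ^ (-β) := by positivity
      rw [hF]
      simp only [sub_zero]
      refine mul_neg_of_pos_of_neg this ?_
      nlinarith [mul_pos hδ ht]
    rw [hFt] at key
    linarith
  · have h2 : 0 < t - τ := by linarith [hτ.2]
    have h3 : HasDerivAt (fun τ : ℝ => (t - τ) ^ (-β)) (β * (t - τ) ^ (-β - 1)) τ :=
      (((hasDerivAt_id τ).const_sub t).rpow_const (p := -β) (Or.inl h2.ne')).congr_deriv (by simp)
    exact (h3.mul ((hd τ hτ.1).hasDerivAt.sub_const (v t))).hasDerivWithinAt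
  · rw [integrableOn_Icc_iff_integrableOn_Ioc]
    exact integrableOn_caputo_integrand hβ1' ht hβ hc hi
  · have h2 : 0 < t - τ := by linarith [hτ.2]
    have h3 := hmax τ ⟨hτ.1.le, hτ.2.le⟩
    have h4 : v τ - v t ≤ 0 := by nlinarith [mul_pos hδ h2]
    have h5 : (β * (t - τ) ^ (-β - 1)) * (v τ - v t) ≤ 0 :=
      mul_nonpos_of_nonneg_of_nonpos (by positivity) h4
    linarith

/-- A positive second derivative would make the point a local minimum as well; v would then be
locally constant and its second derivative zero. -/
theorem iteratedDeriv_two_nonpos_of_max {v : ℝ → ℝ} {x : ℝ} (hv : Continuous v)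
    (hmax : ∀ y, v y ≤ v x) : iteratedDeriv 2 v x ≤ 0 := by
  rw [iteratedDeriv_succ, iteratedDeriv_one]
  by_contra! h
  have hM : IsLocalMax v x := Eventually.of_forall hmax
  have hm : IsLocalMin v x :=
    isLocalMin_of_deriv_deriv_pos h hM.deriv_eq_zero hv.continuousAt
  have he : v =ᶠ[𝓝 x] fun _ => v x := by
    filter_upwards [hm] with y hy
    exact le_antisymm (hmax y) hy
  have h2 := he.deriv.deriv_eq
  simp at h2
  linarith

theorem rieszFellerDeriv_nonpos_of_max (hα : 0 < α) (hα2 : α ≤ 2) {v : ℝ → ℝ} {x : ℝ}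
    (hv : Continuous v) (hmax : ∀ y, v y ≤ v x) : rieszFellerDeriv α v x ≤ 0 := by
  rw [rieszFellerDeriv]
  split_ifs with h
  · exact iteratedDeriv_two_nonpos_of_max hv hmax
  have hα2' : α < 2 := lt_of_le_of_ne hα2 h
  have h1 : 0 < Real.sin (α * Real.pi / 2) :=
    Real.sin_pos_of_pos_of_lt_pi (by positivity) (by nlinarith [Real.pi_pos])
  have h2 := Real.Gamma_pos_of_pos (show 0 < 1 + α by positivity)
  refine mul_nonpos_of_nonneg_of_nonpos (by positivity) ?_
  refine setIntegral_nonpos measurableSet_Ioi fun y (hy : 0 < y) => ?_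
  refine div_nonpos_of_nonpos_of_nonneg ?_ (by positivity)
  linarith [hmax (x + y), hmax (x - y)]

/-- Linearity of the two nonlocal operators uses the convergence of each integral separately, which
the definition of a solution provides. -/
theorem IsSolution.sub {f g : ℝ → ℝ} {u v : ℝ → ℝ → ℝ} (hβ : 0 < β) (hβ1 : β ≤ 1) (hα2 : α ≤ 2)
    (hu : IsSolution α β f u) (hv : IsSolution α β g v) :
    IsSolution α β (fun x => f x - g x) (fun x t => u x t - v x t) := by
  have hd : ∀ x t, 0 < t → deriv (fun t => u x t - v x t) t = deriv (u x) t - deriv (v x) t :=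
    fun x t ht => deriv_fun_sub (hu.differentiableAt x t ht) (hv.differentiableAt x t ht)
  have hint : ∀ x y t, (u (x + y) t - v (x + y) t - (u x t - v x t) +
      (u (x - y) t - v (x - y) t - (u x t - v x t))) / y ^ (1 + α) =
      ((u (x + y) t - u x t) + (u (x - y) t - u x t)) / y ^ (1 + α) -
      ((v (x + y) t - v x t) + (v (x - y) t - v x t)) / y ^ (1 + α) := by
    intro x y t
    rw [← sub_div]
    congr 1
    ring
  refine ⟨hu.continuousOn.sub hv.continuousOn, fun x => ?_, fun T => ?_, fun x t ht => ?_,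
    fun x => ?_, fun x T => ?_, fun h t ht => ?_, fun h x t ht => ?_, fun x t ht => ?_⟩
  · rw [hu.initial, hv.initial]
  · have h := (hu.vanishing T).sub (hv.vanishing T)
    rw [sub_zero] at h
    exact h
  · exact (hu.differentiableAt x t ht).sub (hv.differentiableAt x t ht)
  · exact ((hu.continuousOn_deriv x).sub (hv.continuousOn_deriv x)).congr fun t ht => hd x t ht
  · exact ((hu.integrableOn_deriv x T).sub (hv.integrableOn_deriv x T)).congr_fun
      (fun t ht => (hd x t ht.1).symm) measurableSet_Ioc
  · exact (hu.contDiff_space h t ht).sub (hv.contDiff_space h t ht)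
  · simp_rw [hint]
    exact (hu.integrable_space h x t ht).sub (hv.integrable_space h x t ht)
  · have h1 : caputoDeriv β (fun t => u x t - v x t) t =
        caputoDeriv β (u x) t - caputoDeriv β (v x) t := by
      simp only [caputoDeriv]
      split_ifs with h
      · exact hd x t ht
      have hβ1' : β < 1 := lt_of_le_of_ne hβ1 h
      simp only [intervalIntegral.integral_of_le ht.le]
      rw [← mul_sub, ← integral_sub (integrableOn_caputo_integrand hβ1' ht hβ
        (hu.continuousOn_deriv x) (hu.integrableOn_deriv x t))
        (integrableOn_caputo_integrand hβ1' ht hβ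
        (hv.continuousOn_deriv x) (hv.integrableOn_deriv x t))]
      congr 1
      refine setIntegral_congr_fun measurableSet_Ioc fun τ hτ => ?_
      simp only [hd x τ hτ.1]
      ring
    have h2 : rieszFellerDeriv α (fun z => u z t - v z t) x =
        rieszFellerDeriv α (fun z => u z t) x - rieszFellerDeriv α (fun z => v z t) x := by
      simp only [rieszFellerDeriv]
      split_ifs with h
      · exact iteratedDeriv_fun_sub (n := 2) (hu.contDiff_space h t ht).contDiffAt
          (hv.contDiff_space h t ht).contDiffAt
      have hα2' : α < 2 := lt_of_le_of_ne hα2 h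
      rw [← mul_sub, ← integral_sub (hu.integrable_space hα2' x t ht)
        (hv.integrable_space hα2' x t ht)]
      simp_rw [hint]
    rw [h1, h2, hu.equation x t ht, hv.equation x t ht]

theorem IsSolution.continuous_space {f : ℝ → ℝ} {u : ℝ → ℝ → ℝ} (h : IsSolution α β f u) {t : ℝ}
    (ht : 0 ≤ t) : Continuous fun x => u x t :=
  h.continuousOn.comp_continuous (by fun_prop : Continuous fun x : ℝ => (x, t))
    fun x => ⟨mem_univ _, ht⟩

theorem IsSolution.continuousOn_time {f : ℝ → ℝ} {u : ℝ → ℝ → ℝ} (h : IsSolution α β f u) (x : ℝ) :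
    ContinuousOn (u x) (Ici 0) :=
  h.continuousOn.comp (by fun_prop : ContinuousOn (fun t : ℝ => (x, t)) (Ici 0))
    fun t ht => ⟨mem_univ _, ht⟩

/-- A positive value of u makes `u - δ t` attain a positive global maximum on the time strip, by
decay at infinity. It occurs at a positive time because the initial datum is zero, and there the two
sides of the equation have incompatible signs. -/
theorem IsSolution.nonpos {u : ℝ → ℝ → ℝ} (hα : 0 < α) (hα2 : α ≤ 2) (hβ : 0 < β) (hβ1 : β ≤ 1)
    (h : IsSolution α β (fun _ => 0) u) (x : ℝ) {T : ℝ} (hT : 0 ≤ T) : u x T ≤ 0 := by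
  by_contra! hpos
  have hT' : 0 < T := by
    refine hT.lt_of_ne fun h0 => ?_
    rw [← h0, h.initial] at hpos
    exact lt_irrefl _ hpos
  -- With `δ T = m` the perturbed function still equals m at `(x, T)`. This exceeds its value 0 at
  -- time 0 and its values outside K, where `|u| < m`; x is adjoined to K so that this point takes
  -- part in the compact maximum.
  set m := u x T / 2 with hm
  have hm0 : 0 < m := by positivity
  set δ := m / T with hδ
  have hδ0 : 0 < δ := by positivity
  have hδT : δ * T = m := by rw [hδ]; field_simp
  have hv := Metric.tendstoUniformlyOn_iff.1 (h.vanishing T) m hm0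
  obtain ⟨K, hK, hKs⟩ := mem_cocompact.1 hv
  have hK' : IsCompact (insert x K ×ˢ Icc 0 T) := (hK.insert x).prod isCompact_Icc
  have hmem : (x, T) ∈ insert x K ×ˢ Icc 0 T := ⟨mem_insert _ _, hT, le_rfl⟩
  have hwc : ContinuousOn (fun p : ℝ × ℝ => u p.1 p.2 - δ * p.2) (insert x K ×ˢ Icc 0 T) :=
    (h.continuousOn.mono (prod_mono (subset_univ _) Icc_subset_Ici_self)).sub (by fun_prop)
  obtain ⟨⟨x1, t1⟩, hp1, hp2⟩ := hK'.exists_isMaxOn ⟨_, hmem⟩ hwc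
  have hge : m ≤ u x1 t1 - δ * t1 := by
    have := hp2 hmem
    simp only [mem_ofPred_eq] at this
    linarith
  have ht1 : t1 ∈ Icc 0 T := hp1.2
  have hglob : ∀ y, ∀ s ∈ Icc 0 T, u y s - δ * s ≤ u x1 t1 - δ * t1 := by
    intro y s hs
    by_cases hy : y ∈ insert x K
    · exact hp2 (a := (y, s)) ⟨hy, hs⟩
    · have h2 := hKs (fun hyK => hy (mem_insert_of_mem x hyK)) s hs
      rw [Pi.zero_apply, dist_zero_left, Real.norm_eq_abs] at h2
      have h3 := (le_abs_self (u y s)).trans h2.le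
      have : 0 ≤ δ * s := mul_nonneg hδ0.le hs.1
      linarith
  have ht1pos : 0 < t1 := by
    refine ht1.1.lt_of_ne fun h0 => ?_
    rw [← h0, h.initial] at hge
    linarith
  have hpos := caputoDeriv_pos_of_max hβ hβ1 ht1pos hδ0
    ((h.continuousOn_time x1).mono Icc_subset_Ici_self) (h.differentiableAt x1)
    (h.continuousOn_deriv x1) (h.integrableOn_deriv x1 t1) (fun τ hτ => by
      have := hglob x1 τ ⟨hτ.1, hτ.2.trans ht1.2⟩
      linarith)
  have hnonpos := rieszFellerDeriv_nonpos_of_max hα hα2 (h.continuous_space ht1pos.le) (x := x1)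
    fun y => by
      have := hglob y t1 ht1
      linarith
  rw [h.equation x1 t1 ht1pos] at hpos
  linarith

theorem IsSolution.unique {f : ℝ → ℝ} {u v : ℝ → ℝ → ℝ} (hα : 0 < α) (hα2 : α ≤ 2) (hβ : 0 < β)
    (hβ1 : β ≤ 1) (hu : IsSolution α β f u) (hv : IsSolution α β f v) (x : ℝ) {t : ℝ}
    (ht : 0 ≤ t) : u x t = v x t := by
  have h1 := hu.sub hβ hβ1 hα2 hv
  have h2 := hv.sub hβ hβ1 hα2 hu
  simp only [sub_self] at h1 h2
  exact le_antisymm (sub_nonpos.1 (h1.nonpos hα hα2 hβ hβ1 x ht))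
    (sub_nonpos.1 (h2.nonpos hα hα2 hβ hβ1 x ht))

/-- Values at negative times are unconstrained by the notion of solution, so the characterisation
concerns `t ≥ 0` only. -/
theorem isSolution_iff {f : ℝ → ℝ} (hα : 0 < α) (hα2 : α ≤ 2) (hβ : 0 < β) (hβ1 : β ≤ 1)
    (hc : Continuous f) (hi : Integrable f)
    (hF : Integrable fun k => (1 + |k| ^ α) * ‖fourierHat f k‖) (u : ℝ → ℝ → ℝ) :
    IsSolution α β f u ↔ (∀ x, u x 0 = f x) ∧
      ∀ x t, 0 < t → u x t = ∫ y, subordinatedKernel α β (x - y) t * f y := by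
  refine ⟨fun h => ⟨h.initial, fun x t ht => ?_⟩,
    fun h => isSolution_of_convolution hα hα2 hβ hβ1 hc hi hF h.1 h.2⟩
  have hv : IsSolution α β f fun x t => if t = 0 then f x else
      ∫ y, subordinatedKernel α β (x - y) t * f y :=
    isSolution_of_convolution hα hα2 hβ hβ1 hc hi hF (fun x => by simp)
      fun x t ht => by simp [ht.ne']
  rw [h.unique hα hα2 hβ hβ1 hv x ht.le, if_neg ht.ne']

end uniqueness

/-! ### Processes evaluated at independent random times -/

section randomTime

variable {Ω : Type*} [MeasurableSpace Ω] {P : Measure Ω}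

theorem aemeasurable_comp_nat {E : Type*} [MeasurableSpace E] {X : ℕ → Ω → E} {K : Ω → ℕ}
    (hX : ∀ k, AEMeasurable (X k) P) (hK : Measurable K) : AEMeasurable (fun ω => X (K ω) ω) P := by
  refine ⟨fun ω => (hX (K ω)).mk _ ω, ?_, ?_⟩
  · have h : Measurable fun p : Ω × ℕ => (hX p.2).mk _ p.1 :=
      measurable_from_prod_countable_left fun k => (hX k).measurable_mk
    exact h.comp (measurable_id.prodMk hK)
  · filter_upwards [ae_all_iff.2 fun k => (hX k).ae_eq_mk] with ω hω
    exact hω (K ω)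

/-- Conditioning on a discrete time: decompose over the events `K = k` and use independence on each
of them. -/
theorem integral_comp_nat [IsProbabilityMeasure P] {F : ℕ → Ω → ℂ} {K : Ω → ℕ}
    (hF : ∀ k, AEMeasurable (F k) P) (hK : Measurable K) (hb : ∀ k ω, ‖F k ω‖ ≤ 1)
    (hind : ∀ k, IndepFun (F k) K P) :
    ∫ ω, F (K ω) ω ∂P = ∫ ω, (∫ ω', F (K ω) ω' ∂P) ∂P := by
  have hs : ∀ k, MeasurableSet (K ⁻¹' {k}) := fun k => hK (measurableSet_singleton k)
  have hd : Pairwise (Function.onFun Disjoint fun k => K ⁻¹' {k}) := fun i j hij =>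
    (disjoint_singleton.2 hij).preimage K
  have hU : ⋃ k, K ⁻¹' {k} = univ := by
    ext ω
    simp
  have hFint : ∀ k, Integrable (F k) P := fun k =>
    Integrable.of_bound (C := 1) (hF k).aestronglyMeasurable (ae_of_all _ (hb k))
  have hi1 : Integrable (fun ω => F (K ω) ω) P :=
    Integrable.of_bound (C := 1) (aemeasurable_comp_nat hF hK).aestronglyMeasurable
      (ae_of_all _ fun ω => hb _ ω)
  have hm2 : Measurable fun ω => ∫ ω', F (K ω) ω' ∂P :=
    (measurable_of_countable fun k : ℕ => ∫ ω', F k ω' ∂P).comp hK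
  have hi2 : Integrable (fun ω => ∫ ω', F (K ω) ω' ∂P) P := by
    refine Integrable.of_bound (C := 1) hm2.aestronglyMeasurable (ae_of_all _ fun ω => ?_)
    exact (norm_integral_le_of_norm_le_const (ae_of_all _ (hb (K ω)))).trans_eq (by simp)
  have h1 := hasSum_integral_iUnion hs hd (f := fun ω => F (K ω) ω) (μ := P) hi1.integrableOn
  have h2 := hasSum_integral_iUnion hs hd (f := fun ω => ∫ ω', F (K ω) ω' ∂P) (μ := P)
    hi2.integrableOn
  rw [hU, Measure.restrict_univ] at h1 h2
  refine h1.unique (h2.congr_fun fun k => ?_)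
  have e1 : ∫ ω in K ⁻¹' {k}, F (K ω) ω ∂P = ∫ ω in K ⁻¹' {k}, F k ω ∂P :=
    setIntegral_congr_fun (hs k) fun ω (hω : K ω = k) => by simp only [hω]
  have e2 : ∫ ω in K ⁻¹' {k}, (∫ ω', F (K ω) ω' ∂P) ∂P =
      ∫ ω in K ⁻¹' {k}, (∫ ω', F k ω' ∂P) ∂P :=
    setIntegral_congr_fun (hs k) fun ω (hω : K ω = k) => by simp only [hω]
  have hφ : Measurable (fun j : ℕ => if j = k then (1 : ℂ) else 0) := measurable_of_countable _
  have e3 := ((hind k).comp measurable_id hφ).integral_fun_mul_eq_mul_integral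
    (hF k).aestronglyMeasurable (hφ.comp hK).aestronglyMeasurable
  have e4 : ∀ G : Ω → ℂ, ∫ ω in K ⁻¹' {k}, G ω ∂P =
      ∫ ω, G ω * (if K ω = k then (1 : ℂ) else 0) ∂P := by
    intro G
    rw [← integral_indicator (hs k)]
    refine integral_congr_ae (ae_of_all _ fun ω => ?_)
    by_cases h : K ω = k
    · simp [indicator, h]
    · simp [indicator, h]
  rw [e1, e2, e4, e4, integral_const_mul]
  simpa [Function.comp_def] using e3

/-- The smallest dyadic number of level `n` above `r`. -/
def dyadicAbove (n k : ℕ) : ℝ≥0 := ((k : ℝ≥0) + 1) / 2 ^ n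

theorem measurable_dyadicIndex (n : ℕ) : Measurable fun r : ℝ≥0 => ⌊2 ^ n * r⌋₊ :=
  Nat.measurable_floor.comp (measurable_const_mul _)

theorem lt_dyadicAbove (n : ℕ) (r : ℝ≥0) : r < dyadicAbove n ⌊2 ^ n * r⌋₊ := by
  rw [dyadicAbove, lt_div_iff₀ (by positivity), mul_comm]
  exact Nat.lt_floor_add_one _

theorem dyadicAbove_le (n : ℕ) (r : ℝ≥0) : dyadicAbove n ⌊2 ^ n * r⌋₊ ≤ r + (1 / 2) ^ n := by
  rw [dyadicAbove, div_le_iff₀ (by positivity), add_mul, ← mul_pow]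
  simp only [one_div, inv_mul_cancel₀ (two_ne_zero' ℝ≥0), one_pow]
  rw [mul_comm r]
  gcongr
  exact Nat.floor_le (by positivity)

theorem tendsto_dyadicAbove (r : ℝ≥0) :
    Tendsto (fun n : ℕ => dyadicAbove n ⌊2 ^ n * r⌋₊) atTop (𝓝[≥] r) := by
  refine tendsto_nhdsWithin_iff.2 ⟨?_, Eventually.of_forall fun n => (lt_dyadicAbove n r).le⟩
  have h : Tendsto (fun n : ℕ => r + (1 / 2 : ℝ≥0) ^ n) atTop (𝓝 (r + 0)) :=
    (NNReal.tendsto_pow_atTop_nhds_zero_of_lt_one (by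
      rw [div_lt_one (by norm_num)]
      norm_num)).const_add r
  rw [add_zero] at h
  exact tendsto_of_tendsto_of_tendsto_of_le_of_le tendsto_const_nhds h
    (fun n => (lt_dyadicAbove n r).le) fun n => dyadicAbove_le n r

/-- A right-continuous process at a random time is the limit of its values at discrete times from
above, so no joint measurability is needed. -/
theorem aemeasurable_comp_randomTime {E : Type*} [MeasurableSpace E] [TopologicalSpace E]
    [TopologicalSpace.PseudoMetrizableSpace E] [BorelSpace E] {X : ℝ≥0 → Ω → E} {R : Ω → ℝ≥0}
    (hX : ∀ r, AEMeasurable (X r) P) (hR : Measurable R)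
    (hc : ∀ᵐ ω ∂P, ∀ r, ContinuousWithinAt (fun s => X s ω) (Ici r) r) :
    AEMeasurable (fun ω => X (R ω) ω) P := by
  refine aemeasurable_of_tendsto_metrizable_ae'
    (f := fun n ω => X (dyadicAbove n ⌊2 ^ n * R ω⌋₊) ω) (fun n => ?_) ?_
  · exact aemeasurable_comp_nat (X := fun k => X (dyadicAbove n k)) (fun k => hX _)
      ((measurable_dyadicIndex n).comp hR)
  · filter_upwards [hc] with ω hω
    exact (hω (R ω)).tendsto.comp (tendsto_dyadicAbove (R ω))

/-- The discrete case at dyadic times from above, followed by dominated convergence on both sides.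
The mean m inherits right-continuity from F. -/
theorem integral_comp_randomTime [IsProbabilityMeasure P] {F : ℝ≥0 → Ω → ℂ} {R : Ω → ℝ≥0}
    (hF : ∀ r, AEMeasurable (F r) P) (hR : Measurable R) (hb : ∀ r ω, ‖F r ω‖ ≤ 1)
    (hind : ∀ r, IndepFun (F r) R P)
    (hc : ∀ᵐ ω ∂P, ∀ r, ContinuousWithinAt (fun s => F s ω) (Ici r) r)
    {m : ℝ≥0 → ℂ} (hm : ∀ r, ∫ ω, F r ω ∂P = m r) :
    ∫ ω, F (R ω) ω ∂P = ∫ ω, m (R ω) ∂P := by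
  have hmb : ∀ r, ‖m r‖ ≤ 1 := by
    intro r
    rw [← hm]
    exact (norm_integral_le_of_norm_le_const (ae_of_all _ (hb r))).trans_eq (by simp)
  have hmc : ∀ r, ContinuousWithinAt m (Ici r) r := by
    intro r
    rw [ContinuousWithinAt, ← funext hm]
    refine tendsto_integral_filter_of_dominated_convergence (fun _ => 1)
      (Eventually.of_forall fun s => (hF s).aestronglyMeasurable)
      (Eventually.of_forall fun s => ae_of_all _ (hb s)) (integrable_const _) ?_
    filter_upwards [hc] with ω hω
    exact (hω r).tendsto
  have hidx := fun n => (measurable_dyadicIndex n).comp hR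
  have h1 : Tendsto (fun n : ℕ => ∫ ω, F (dyadicAbove n ⌊2 ^ n * R ω⌋₊) ω ∂P) atTop
      (𝓝 (∫ ω, F (R ω) ω ∂P)) := by
    refine tendsto_integral_of_dominated_convergence (fun _ => 1) (fun n => ?_)
      (integrable_const _) (fun n => ae_of_all _ fun ω => hb _ ω) ?_
    · exact (aemeasurable_comp_nat (X := fun k => F (dyadicAbove n k)) (fun k => hF _)
        (hidx n)).aestronglyMeasurable
    · filter_upwards [hc] with ω hω
      exact (hω (R ω)).tendsto.comp (tendsto_dyadicAbove (R ω))
  have h2 : Tendsto (fun n : ℕ => ∫ ω, m (dyadicAbove n ⌊2 ^ n * R ω⌋₊) ∂P) atTop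
      (𝓝 (∫ ω, m (R ω) ∂P)) := by
    refine tendsto_integral_of_dominated_convergence (fun _ => 1) (fun n => ?_)
      (integrable_const _) (fun n => ae_of_all _ fun ω => hmb _) (ae_of_all _ fun ω => ?_)
    · exact ((measurable_of_countable fun k : ℕ => m (dyadicAbove n k)).comp
        (hidx n)).aestronglyMeasurable
    · exact (hmc (R ω)).tendsto.comp (tendsto_dyadicAbove (R ω))
  refine tendsto_nhds_unique h1 (h2.congr fun n => ?_)
  have h3 := integral_comp_nat (F := fun k => F (dyadicAbove n k)) (fun k => hF _) (hidx n)
    (fun k => hb _) fun k => (hind _).comp measurable_id (measurable_dyadicIndex n)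
  simp only [Function.comp_apply, hm] at h3
  exact h3.symm

theorem measure_Iic_le_of_Iio_le {μ ν : Measure ℝ} [IsFiniteMeasure ν]
    (h : ∀ s, 0 < s → μ (Iio s) ≤ ν (Iic s)) {s : ℝ} (hs : 0 ≤ s) : μ (Iic s) ≤ ν (Iic s) := by
  have hI : Iic s = ⋂ n : ℕ, Iic (s + 1 / ((n : ℝ) + 1)) := by
    ext x
    simp only [mem_Iic, mem_iInter]
    refine ⟨fun hx n => hx.trans (by linarith [Nat.one_div_pos_of_nat (α := ℝ) (n := n)]),
      fun hx => ?_⟩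
    refine ge_of_tendsto (x := atTop) (f := fun n : ℕ => s + 1 / ((n : ℝ) + 1)) ?_
      (Eventually.of_forall hx)
    simpa using (tendsto_one_div_add_atTop_nhds_zero_nat (𝕜 := ℝ)).const_add s
  have ht := tendsto_measure_iInter_atTop (μ := ν)
    (s := fun n : ℕ => Iic (s + 1 / ((n : ℝ) + 1)))
    (fun n => measurableSet_Iic.nullMeasurableSet)
    (fun m n hmn => Iic_subset_Iic.2 (by gcongr)) ⟨0, measure_ne_top _ _⟩
  rw [← hI] at ht
  refine ge_of_tendsto ht (Eventually.of_forall fun n => ?_)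
  have hp := Nat.one_div_pos_of_nat (α := ℝ) (n := n)
  exact (measure_mono (Iic_subset_Iio.2 (by linarith))).trans (h _ (by linarith))

/-- The gap between open and closed rays suits first passage times, which are known only up to
strict versus weak inequality; it is removed by approaching s from above. -/
theorem eq_of_Iio_le_of_Iio_le {μ ν : Measure ℝ} [IsFiniteMeasure μ] [IsFiniteMeasure ν]
    (hμ : μ (Iio 0) = 0) (hν : ν (Iio 0) = 0) (h : ∀ s, 0 < s → μ (Iio s) ≤ ν (Iic s))
    (h' : ∀ s, 0 < s → ν (Iio s) ≤ μ (Iic s)) : μ = ν := by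
  refine Measure.ext_of_Iic μ ν fun s => ?_
  rcases lt_or_ge s 0 with hs | hs
  · rw [measure_mono_null (Iic_subset_Iio.2 hs) hμ, measure_mono_null (Iic_subset_Iio.2 hs) hν]
  · exact le_antisymm (measure_Iic_le_of_Iio_le h hs) (measure_Iic_le_of_Iio_le h' hs)

end randomTime

/-! ### Stable subordinators and the law of their first passage times -/

section subordinator

variable {Ω : Type*} [MeasurableSpace Ω] {P : Measure Ω}

theorem stableSymbol_mul {γ c : ℝ} (hγ : 0 < γ) (hc : 0 ≤ c) (θ y : ℝ) :
    stableSymbol γ θ (c * y) = ((c ^ γ : ℝ) : ℂ) * stableSymbol γ θ y := by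
  rcases hc.eq_or_lt with rfl | hc
  · simp [stableSymbol, Real.zero_rpow hγ.ne']
  have hs : Real.sign (c * y) = Real.sign y := by
    rcases lt_trichotomy y 0 with hy | rfl | hy
    · rw [Real.sign_of_neg hy, Real.sign_of_neg (mul_neg_of_pos_of_neg hc hy)]
    · simp
    · rw [Real.sign_of_pos hy, Real.sign_of_pos (mul_pos hc hy)]
  rw [stableSymbol, stableSymbol, hs, abs_mul, abs_of_pos hc, Real.mul_rpow hc.le (abs_nonneg y)]
  push_cast
  ring

theorem IsStableSubordinator.map_eq [IsProbabilityMeasure P] {γ : ℝ} (hγ : 0 < γ) (hγ1 : γ ≤ 1)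
    {S : ℝ≥0 → Ω → ℝ≥0} (hS : IsStableSubordinator γ S P) (t : ℝ≥0) :
    P.map (fun ω => (S t ω : ℝ)) = (stableLaw γ).map fun x => (t : ℝ) ^ (1 / γ) * x := by
  have := isProbabilityMeasure_stableLaw hγ hγ1
  have := Measure.isProbabilityMeasure_map (μ := P)
    (hS.measurable t).coe_nnreal_real.aemeasurable
  refine Measure.ext_of_charFun (funext fun y => ?_)
  rw [hS.charFun_eq, charFun_map_mul, charFun_stableLaw hγ hγ1,
    stableSymbol_mul hγ (by positivity), ← Real.rpow_mul t.coe_nonneg, one_div_mul_cancel hγ.ne',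
    Real.rpow_one, mul_comm]

theorem IsStableSubordinator.integral_exp [IsProbabilityMeasure P] {γ : ℝ} (hγ : 0 < γ)
    (hγ1 : γ ≤ 1) {S : ℝ≥0 → Ω → ℝ≥0} (hS : IsStableSubordinator γ S P) (t : ℝ≥0) {l : ℝ}
    (hl : 0 ≤ l) : ∫ ω, Real.exp (-(l * S t ω)) ∂P = Real.exp (-(l ^ γ * t)) := by
  have h := integral_map (μ := P) (φ := fun ω => (S t ω : ℝ)) (f := fun x => Real.exp (-(l * x)))
    (hS.measurable t).coe_nnreal_real.aemeasurable (by fun_prop)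
  rw [hS.map_eq hγ hγ1, integral_map (by fun_prop) (by fun_prop)] at h
  rw [← h]
  simp_rw [← mul_assoc]
  rw [integral_exp_neg_stableLaw hγ hγ1 (by positivity), Real.mul_rpow hl (by positivity),
    ← Real.rpow_mul t.coe_nonneg, one_div_mul_cancel hγ.ne', Real.rpow_one]

/-- By self-similarity `S s` is distributed as `s ^ (1/β) * X`, and `t < s ^ (1/β) * X` is the same
event as `t ^ β * X ^ (-β) < s`. -/
theorem IsStableSubordinator.measure_lt [IsProbabilityMeasure P] {β : ℝ} (hβ : 0 < β)
    (hβ1 : β ≤ 1) {S : ℝ≥0 → Ω → ℝ≥0} (hS : IsStableSubordinator β S P) (t : ℝ≥0) {s : ℝ≥0}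
    (hs : 0 < s) :
    P {ω | t < S s ω} = stableLaw β {x | (t : ℝ) ^ β * x ^ (-β) < s} := by
  have h1 : P {ω | t < S s ω} = P.map (fun ω => (S s ω : ℝ)) (Ioi (t : ℝ)) := by
    rw [Measure.map_apply (hS.measurable s).coe_nnreal_real measurableSet_Ioi]
    rfl
  rw [h1, hS.map_eq hβ hβ1, Measure.map_apply (by fun_prop) measurableSet_Ioi]
  refine measure_congr ?_
  filter_upwards [ae_pos_stableLaw hβ hβ1] with x hx
  have hs' : (0 : ℝ) < s := hs
  have hp : 0 < x ^ β := by positivity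
  refine propext ?_
  change (t : ℝ) < (s : ℝ) ^ (1 / β) * x ↔ (t : ℝ) ^ β * x ^ (-β) < s
  rw [← Real.rpow_lt_rpow_iff t.coe_nonneg (by positivity) hβ, Real.mul_rpow (by positivity) hx.le,
    ← Real.rpow_mul hs'.le, one_div_mul_cancel hβ.ne', Real.rpow_one, Real.rpow_neg hx.le,
    ← div_eq_mul_inv, div_lt_iff₀ hp]

/-- The first passage time of a path above the level `t`, computed along a countable dense set. -/
def firstPassage (t : ℝ≥0) (s : ℝ≥0 → ℝ≥0) : ℝ≥0 :=
  sInf {r | r ∈ range (TopologicalSpace.denseSeq ℝ≥0) ∧ t < s r}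

theorem exists_denseSeq_mem_Ioo {a b : ℝ≥0} (h : a < b) :
    ∃ q ∈ range (TopologicalSpace.denseSeq ℝ≥0), a < q ∧ q < b := by
  obtain ⟨q, hq, hq'⟩ := (TopologicalSpace.denseRange_denseSeq ℝ≥0).exists_mem_open isOpen_Ioo
    (nonempty_Ioo.2 h)
  exact ⟨_, ⟨q, rfl⟩, hq, hq'⟩

/-- Countability of the index set is the point: the passage time becomes a measurable function of
the whole path, so independence of paths passes to it. -/
theorem measurable_firstPassage (t : ℝ≥0) : Measurable (firstPassage t) := by
  refine measurable_of_Iio fun c => ?_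
  have hm : ∀ r : ℝ≥0, MeasurableSet {s : ℝ≥0 → ℝ≥0 | t < s r} := fun r =>
    measurableSet_lt measurable_const (measurable_pi_apply r)
  set D := range (TopologicalSpace.denseSeq ℝ≥0)
  have hD : D.Countable := countable_range _
  -- The second set accounts for paths that never exceed t, to which the infimum of the empty set
  -- assigns the value 0.
  have e : firstPassage t ⁻¹' Iio c = (⋃ r ∈ D ∩ Iio c, {s : ℝ≥0 → ℝ≥0 | t < s r}) ∪
      ((⋂ r ∈ D, {s : ℝ≥0 → ℝ≥0 | t < s r}ᶜ) ∩ {_s | 0 < c}) := by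
    ext s
    simp only [mem_preimage, mem_Iio, mem_union, mem_iUnion, mem_inter_iff, mem_iInter,
      mem_compl_iff, mem_ofPred_eq, exists_prop]
    by_cases hne : {r | r ∈ D ∧ t < s r}.Nonempty
    · constructor
      · intro h
        obtain ⟨r, hr, hrc⟩ := exists_lt_of_csInf_lt hne h
        exact Or.inl ⟨r, ⟨hr.1, hrc⟩, hr.2⟩
      · rintro (⟨r, ⟨hr, hrc⟩, hrt⟩ | ⟨h, -⟩)
        · exact (csInf_le (OrderBot.bddBelow _)
            (show r ∈ {r | r ∈ D ∧ t < s r} from ⟨hr, hrt⟩)).trans_lt hrc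
        · obtain ⟨r, hr, hrt⟩ := hne
          exact absurd hrt (h r hr)
    · have h0 : firstPassage t s = 0 := by
        rw [firstPassage, not_nonempty_iff_eq_empty.1 hne, NNReal.sInf_empty]
      rw [h0]
      constructor
      · exact fun h => Or.inr ⟨fun r hr hrt => hne ⟨r, hr, hrt⟩, h⟩
      · rintro (⟨r, ⟨hr, -⟩, hrt⟩ | ⟨-, h⟩)
        · exact absurd ⟨r, hr, hrt⟩ hne
        · exact h
  rw [e]
  exact (MeasurableSet.biUnion (hD.mono inter_subset_left) fun r _ => hm r).union
    ((MeasurableSet.biInter hD fun r _ => (hm r).compl).inter (MeasurableSet.const _))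

/-- A monotone path above t at r stays above t at the points of the dense set just after r. -/
theorem firstPassage_eq {t : ℝ≥0} {s : ℝ≥0 → ℝ≥0} (hs : Monotone s) :
    sInf {r | t < s r} = firstPassage t s := by
  rcases {r | t < s r}.eq_empty_or_nonempty with h | ⟨r0, hr0⟩
  · have : {r | r ∈ range (TopologicalSpace.denseSeq ℝ≥0) ∧ t < s r} = ∅ :=
      subset_empty_iff.1 fun r hr => h ▸ hr.2
    rw [firstPassage, h, this]
  · have hex : ∀ r, t < s r → ∀ r', r < r' → firstPassage t s < r' := by
      intro r hr r' hrr'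
      obtain ⟨q, hqD, hrq, hqr'⟩ := exists_denseSeq_mem_Ioo hrr'
      exact (csInf_le (OrderBot.bddBelow _)
        (show q ∈ {r | r ∈ range (TopologicalSpace.denseSeq ℝ≥0) ∧ t < s r} from
          ⟨hqD, lt_of_lt_of_le hr (hs hrq.le)⟩)).trans_lt hqr'
    obtain ⟨q, hqD, hrq, -⟩ := exists_denseSeq_mem_Ioo (show r0 < r0 + 1 from lt_add_one r0)
    have hne : {r | r ∈ range (TopologicalSpace.denseSeq ℝ≥0) ∧ t < s r}.Nonempty :=
      ⟨q, hqD, lt_of_lt_of_le hr0 (hs hrq.le)⟩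
    refine le_antisymm (csInf_le_csInf (OrderBot.bddBelow _) hne fun r hr => hr.2) ?_
    refine le_csInf ⟨r0, hr0⟩ fun r hr => ?_
    exact le_of_forall_gt fun r' hr' => hex r hr r' hr'

/-- This excludes the paths for which the infimum would be the conventional value 0. -/
theorem IsStableSubordinator.ae_exists_lt [IsProbabilityMeasure P] {β : ℝ} (hβ : 0 < β)
    (hβ1 : β ≤ 1) {S : ℝ≥0 → Ω → ℝ≥0} (hS : IsStableSubordinator β S P) (t : ℝ≥0) :
    ∀ᵐ ω ∂P, ∃ r, t < S r ω := by
  have := isProbabilityMeasure_stableLaw hβ hβ1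
  have hU : ⋃ n : ℕ, {x : ℝ | (t : ℝ) ^ β * x ^ (-β) < (n : ℝ) + 1} = univ := by
    refine eq_univ_of_forall fun x => mem_iUnion.2 ?_
    obtain ⟨n, hn⟩ := exists_nat_gt ((t : ℝ) ^ β * x ^ (-β))
    exact ⟨n, hn.trans (lt_add_one _)⟩
  have hmono : Monotone fun n : ℕ => {x : ℝ | (t : ℝ) ^ β * x ^ (-β) < (n : ℝ) + 1} := by
    intro m n hmn x hx
    simp only [mem_ofPred_eq] at hx ⊢
    exact hx.trans_le (by gcongr)
  have ht := tendsto_measure_iUnion_atTop (μ := stableLaw β) hmono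
  rw [hU, measure_univ] at ht
  have hm : MeasurableSet (⋃ n : ℕ, {ω | t < S ((n : ℝ≥0) + 1) ω}) :=
    MeasurableSet.iUnion fun n => measurableSet_lt measurable_const (hS.measurable _)
  have h1 : (1 : ℝ≥0∞) ≤ P (⋃ n : ℕ, {ω | t < S ((n : ℝ≥0) + 1) ω}) := by
    refine le_of_tendsto ht (Eventually.of_forall fun n => ?_)
    have h2 := hS.measure_lt hβ hβ1 t (s := (n : ℝ≥0) + 1) (by positivity)
    push_cast at h2
    rw [Function.comp_apply, ← h2]
    exact measure_mono (subset_iUnion (fun n : ℕ => {ω | t < S ((n : ℝ≥0) + 1) ω}) n)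
  filter_upwards [(mem_ae_iff_prob_eq_one hm).2 (le_antisymm prob_le_one h1)] with ω hω
  obtain ⟨n, hn⟩ := mem_iUnion.1 hω
  exact ⟨_, hn⟩

theorem IsStableSubordinator.ae_inverse_eq {β : ℝ} {S : ℝ≥0 → Ω → ℝ≥0}
    (hS : IsStableSubordinator β S P) (t : ℝ≥0) :
    ∀ᵐ ω ∂P, inverseSubordinator S t ω = firstPassage t fun r => S r ω := by
  filter_upwards [hS.monotone] with ω hω
  exact firstPassage_eq hω

theorem IsStableSubordinator.measurable_firstPassage {β : ℝ} {S : ℝ≥0 → Ω → ℝ≥0}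
    (hS : IsStableSubordinator β S P) (t : ℝ≥0) :
    Measurable fun ω => firstPassage t fun r => S r ω :=
  (FracHeat.measurable_firstPassage t).comp (measurable_pi_iff.2 hS.measurable)

/-- Almost surely `T < s` implies `S s > t`, which implies `T ≤ s`. The middle event has the
probability that `t ^ β * X ^ (-β) < s`, and the one-sided comparisons determine the law. -/
theorem IsStableSubordinator.map_firstPassage [IsProbabilityMeasure P] {β : ℝ} (hβ : 0 < β)
    (hβ1 : β ≤ 1) {S : ℝ≥0 → Ω → ℝ≥0} (hS : IsStableSubordinator β S P) (t : ℝ≥0) :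
    P.map (fun ω => ((firstPassage t fun r => S r ω : ℝ≥0) : ℝ)) =
      (stableLaw β).map fun x => (t : ℝ) ^ β * x ^ (-β) := by
  have := isProbabilityMeasure_stableLaw hβ hβ1
  have hT : Measurable fun ω => ((firstPassage t fun r => S r ω : ℝ≥0) : ℝ) :=
    (hS.measurable_firstPassage t).coe_nnreal_real
  have hU : Measurable fun x : ℝ => (t : ℝ) ^ β * x ^ (-β) := by fun_prop
  have := Measure.isProbabilityMeasure_map (μ := P) hT.aemeasurable
  have := Measure.isProbabilityMeasure_map (μ := stableLaw β) hU.aemeasurable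
  refine eq_of_Iio_le_of_Iio_le ?_ ?_ (fun s hs => ?_) fun s hs => ?_
  · rw [Measure.map_apply hT measurableSet_Iio]
    have : (fun ω => ((firstPassage t fun r => S r ω : ℝ≥0) : ℝ)) ⁻¹' Iio 0 = ∅ :=
      eq_empty_of_forall_notMem fun ω hω => not_lt.2 (NNReal.coe_nonneg _) hω
    rw [this, measure_empty]
  · rw [Measure.map_apply hU measurableSet_Iio]
    refine measure_mono_null (t := {x | ¬ 0 < x}) (fun x hx hx0 => ?_)
      (ae_pos_stableLaw hβ hβ1)
    have hx0' : (0 : ℝ) < x := hx0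
    exact absurd (show (t : ℝ) ^ β * x ^ (-β) < 0 from hx) (not_lt.2 (by positivity))
  · lift s to ℝ≥0 using hs.le
    rw [Measure.map_apply hT measurableSet_Iio, Measure.map_apply hU measurableSet_Iic]
    calc _ ≤ P {ω | t < S s ω} := by
          refine measure_mono_ae ?_
          filter_upwards [hS.ae_inverse_eq t, hS.ae_exists_lt hβ hβ1 t, hS.monotone] with ω h1 h2 h3
          intro (h4 : ((firstPassage t fun r => S r ω : ℝ≥0) : ℝ) < s)
          rw [← h1, NNReal.coe_lt_coe] at h4
          obtain ⟨r, hr, hrs⟩ := exists_lt_of_csInf_lt h2 h4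
          exact lt_of_lt_of_le hr (h3 hrs.le)
      _ = _ := hS.measure_lt hβ hβ1 t hs
      _ ≤ _ := measure_mono fun x hx =>
          le_of_lt (show (t : ℝ) ^ β * x ^ (-β) < s from hx)
  · lift s to ℝ≥0 using hs.le
    rw [Measure.map_apply hT measurableSet_Iic, Measure.map_apply hU measurableSet_Iio]
    calc _ = P {ω | t < S s ω} := (hS.measure_lt hβ hβ1 t hs).symm
      _ ≤ _ := by
          refine measure_mono_ae ?_
          filter_upwards [hS.ae_inverse_eq t] with ω h1
          intro (h4 : t < S s ω)
          change ((firstPassage t fun r => S r ω : ℝ≥0) : ℝ) ≤ s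
          rw [← h1, NNReal.coe_le_coe]
          exact csInf_le (OrderBot.bddBelow _) h4

theorem IsStableSubordinator.integral_exp_firstPassage [IsProbabilityMeasure P] {β : ℝ}
    (hβ : 0 < β) (hβ1 : β ≤ 1) {S : ℝ≥0 → Ω → ℝ≥0} (hS : IsStableSubordinator β S P) (t : ℝ≥0)
    (l : ℝ) : ∫ ω, Real.exp (-(l * ((firstPassage t fun r => S r ω : ℝ≥0) : ℝ))) ∂P =
      mittagLeffler β (-(l * (t : ℝ) ^ β)) := by
  have h := integral_map (μ := P)
    (φ := fun ω => ((firstPassage t fun r => S r ω : ℝ≥0) : ℝ))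
    (f := fun x => Real.exp (-(l * x)))
    (hS.measurable_firstPassage t).coe_nnreal_real.aemeasurable (by fun_prop)
  rw [hS.map_firstPassage hβ hβ1, integral_map (by fun_prop) (by fun_prop)] at h
  rw [← h, ← integral_exp_mul_inverse hβ hβ1]
  refine integral_congr_ae (ae_of_all _ fun x => ?_)
  simp only
  ring_nf

/-- Almost surely S is positive at all the times `1/(n+1)`, because at level 0 the event in
`measure_lt` is the whole line. -/
theorem IsStableSubordinator.ae_inverse_zero [IsProbabilityMeasure P] {β : ℝ} (hβ : 0 < β)
    (hβ1 : β ≤ 1) {S : ℝ≥0 → Ω → ℝ≥0} (hS : IsStableSubordinator β S P) :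
    ∀ᵐ ω ∂P, inverseSubordinator S 0 ω = 0 := by
  have := isProbabilityMeasure_stableLaw hβ hβ1
  have h : ∀ n : ℕ, ∀ᵐ ω ∂P, 0 < S (1 / ((n : ℝ≥0) + 1)) ω := by
    intro n
    have h1 := hS.measure_lt hβ hβ1 0 (s := 1 / ((n : ℝ≥0) + 1)) (by positivity)
    have h2 : {x : ℝ | ((0 : ℝ≥0) : ℝ) ^ β * x ^ (-β) < ((1 / ((n : ℝ≥0) + 1) : ℝ≥0) : ℝ)} = univ := by
      refine eq_univ_of_forall fun x => ?_
      simp only [NNReal.coe_zero, Real.zero_rpow hβ.ne', zero_mul, mem_ofPred_eq, NNReal.coe_pos]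
      positivity
    rw [h2, measure_univ] at h1
    exact (mem_ae_iff_prob_eq_one (measurableSet_lt measurable_const (hS.measurable _))).2 h1
  filter_upwards [ae_all_iff.2 h] with ω hω
  refine le_antisymm (le_of_forall_pos_le_add fun ε hε => ?_) bot_le
  obtain ⟨n, hn⟩ := exists_nat_one_div_lt (K := ℝ≥0) hε
  rw [zero_add]
  exact (csInf_le (OrderBot.bddBelow _)
    (show 1 / ((n : ℝ≥0) + 1) ∈ {r | 0 < S r ω} from hω n)).trans hn.le

end subordinator

/-! ### Brownian motion at the composed random time -/

section process

variable {Ω : Type*} [MeasurableSpace Ω] {P : Measure Ω}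
  {W : ℝ≥0 → Ω → ℝ} {L S : ℝ≥0 → Ω → ℝ≥0} {α β : ℝ}

theorem integral_cexp_brownian (hW : IsBrownianReal W P) (y : ℝ) (r : ℝ≥0) :
    ∫ ω, Complex.exp (y * (Real.sqrt 2 * W r ω : ℝ) * Complex.I) ∂P =
      (Real.exp (-(y ^ 2 * r)) : ℂ) := by
  have h := charFun_gaussianReal (μ := 0) (v := r) (y * Real.sqrt 2)
  rw [← (hW.hasLaw_eval r).map_eq, charFun_apply_real,
    integral_map (hW.aemeasurable r) (Continuous.aestronglyMeasurable (by fun_prop))] at h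
  have hs : ((Real.sqrt 2 : ℝ) : ℂ) ^ 2 = 2 := by
    rw [← Complex.ofReal_pow, Real.sq_sqrt zero_le_two]
    norm_num
  calc _ = ∫ ω, Complex.exp (((y * Real.sqrt 2 : ℝ) : ℂ) * (W r ω : ℂ) * Complex.I) ∂P := by
        refine integral_congr_ae (ae_of_all _ fun ω => ?_)
        simp only
        push_cast
        ring_nf
    _ = _ := by
        rw [h]
        push_cast
        rw [mul_pow, hs]
        congr 1
        ring

/-- Conditioning on the inverse time T, the Laplace exponent of L gives `exp (-|y| ^ α * T)`, whose
mean is the Mittag-Leffler value. -/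
theorem integral_exp_subordinated_time [IsProbabilityMeasure P] (hα : 0 < α) (hα2 : α ≤ 2) (hβ : 0 < β) (hβ1 : β ≤ 1)
    (hL : IsStableSubordinator (α / 2) L P) (hS : IsStableSubordinator β S P)
    (hLS : IndepFun (fun ω t => L t ω) (fun ω t => S t ω) P) (y : ℝ) (t : ℝ≥0) :
    ∫ ω, (Real.exp (-(y ^ 2 * L (firstPassage t fun r => S r ω) ω)) : ℂ) ∂P =
      (mittagLeffler β (-(|y| ^ α * (t : ℝ) ^ β)) : ℂ) := by
  have hφ : ∀ r : ℝ≥0, Measurable fun l : ℝ≥0 → ℝ≥0 => (Real.exp (-(y ^ 2 * (l r : ℝ))) : ℂ) := by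
    intro r
    have h1 : Measurable fun l : ℝ≥0 → ℝ≥0 => (l r : ℝ) := (measurable_pi_apply r).coe_nnreal_real
    exact Complex.measurable_ofReal.comp (by fun_prop)
  have h := integral_comp_randomTime (P := P)
    (F := fun r ω => (Real.exp (-(y ^ 2 * (L r ω : ℝ))) : ℂ))
    (R := fun ω => firstPassage t fun r => S r ω)
    (m := fun r => (Real.exp (-(|y| ^ α * (r : ℝ))) : ℂ))
    (fun r => ((hφ r).comp (measurable_pi_iff.2 hL.measurable)).aemeasurable)
    (hS.measurable_firstPassage t) (fun r ω => ?_)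
    (fun r => hLS.comp (hφ r) (measurable_firstPassage t)) ?_ fun r => ?_
  · rw [h, integral_complex_ofReal, hS.integral_exp_firstPassage hβ hβ1]
  · rw [Complex.norm_real, Real.norm_eq_abs, Real.abs_exp, Real.exp_le_one_iff]
    exact neg_nonpos.2 (by positivity)
  · filter_upwards [hL.rightContinuous] with ω hω r
    have h2 : Continuous fun z : ℝ≥0 => (Real.exp (-(y ^ 2 * (z : ℝ))) : ℂ) := by fun_prop
    exact h2.continuousAt.comp_continuousWithinAt (hω r)
  · rw [integral_complex_ofReal,
      hL.integral_exp (by linarith) (by linarith) r (sq_nonneg y), ← sq_abs, ← Real.rpow_natCast,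
      ← Real.rpow_mul (abs_nonneg y), Nat.cast_two, mul_div_cancel₀ _ (two_ne_zero' ℝ)]

/-- The subordinator `L` at the dyadic approximation from above of the first passage time. -/
def approxTime (t : ℝ≥0) (n : ℕ) (p : (ℝ≥0 → ℝ≥0) × (ℝ≥0 → ℝ≥0)) : ℝ≥0 :=
  p.1 (dyadicAbove n ⌊2 ^ n * firstPassage t p.2⌋₊)

theorem measurable_approxTime (t : ℝ≥0) (n : ℕ) : Measurable (approxTime t n) := by
  have h : Measurable fun q : (ℝ≥0 → ℝ≥0) × ℕ => q.1 (dyadicAbove n q.2) :=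
    measurable_from_prod_countable_left fun k => measurable_pi_apply (dyadicAbove n k)
  exact h.comp (measurable_fst.prodMk
    (((measurable_dyadicIndex n).comp (measurable_firstPassage t)).comp measurable_snd))

theorem tendsto_approxTime {l s : ℝ≥0 → ℝ≥0} (t : ℝ≥0)
    (hl : ∀ r, ContinuousWithinAt l (Ici r) r) :
    Tendsto (fun n => approxTime t n (l, s)) atTop (𝓝 (l (firstPassage t s))) :=
  (hl _).tendsto.comp (tendsto_dyadicAbove _)

/-- The characteristic function is found by conditioning W on the pair (L, S), then L on S. The time
`L (T)` is replaced by its approximations, each a measurable function of the pair, and the limit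
uses continuity of W and right-continuity of L. -/
theorem hasLaw_subordinated [IsProbabilityMeasure P] (hα : 0 < α) (hα2 : α ≤ 2) (hβ : 0 < β) (hβ1 : β ≤ 1)
    (hW : IsBrownianReal W P) (hL : IsStableSubordinator (α / 2) L P)
    (hS : IsStableSubordinator β S P) (hLS : IndepFun (fun ω t => L t ω) (fun ω t => S t ω) P)
    (hWLS : IndepFun (fun ω t => W t ω) (fun ω => ((fun t => L t ω), fun t => S t ω)) P)
    {t : ℝ≥0} (ht : 0 < t) :
    HasLaw (fun ω => Real.sqrt 2 * W (L (inverseSubordinator S t ω) ω) ω) (kernelLaw α β t) P := by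
  have ht' : (0 : ℝ) < t := ht
  have := isProbabilityMeasure_kernelLaw hα hα2 hβ hβ1 ht'
  set X : Ω → ℝ := fun ω => Real.sqrt 2 * W (L (firstPassage t fun r => S r ω) ω) ω with hX
  -- L is right-continuous only almost surely, so measurability in the pair of paths is available
  -- for these approximations rather than for the limiting time itself.
  set R : ℕ → Ω → ℝ≥0 := fun n ω => approxTime t n ((fun r => L r ω), fun r => S r ω) with hRdef
  have hpair : Measurable fun ω => ((fun r => L r ω), fun r => S r ω) :=
    (measurable_pi_iff.2 hL.measurable).prodMk (measurable_pi_iff.2 hS.measurable)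
  have hR : ∀ n, Measurable (R n) := fun n => (measurable_approxTime t n).comp hpair
  have hRlim : ∀ᵐ ω ∂P, Tendsto (fun n => R n ω) atTop
      (𝓝 (L (firstPassage t fun r => S r ω) ω)) := by
    filter_upwards [hL.rightContinuous] with ω hω
    exact tendsto_approxTime t hω
  have hXlim : ∀ᵐ ω ∂P, Tendsto (fun n => Real.sqrt 2 * W (R n ω) ω) atTop (𝓝 (X ω)) := by
    filter_upwards [hRlim, hW.cont] with ω h1 h2
    exact ((h2.tendsto _).comp h1).const_mul _
  have hXn : ∀ n, AEMeasurable (fun ω => Real.sqrt 2 * W (R n ω) ω) P := by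
    intro n
    refine (aemeasurable_comp_randomTime hW.aemeasurable (hR n) ?_).const_mul _
    filter_upwards [hW.cont] with ω hω r
    exact hω.continuousWithinAt
  have hXm : AEMeasurable X P := aemeasurable_of_tendsto_metrizable_ae' hXn hXlim
  have hae : (fun ω => Real.sqrt 2 * W (L (inverseSubordinator S t ω) ω) ω) =ᵐ[P] X := by
    filter_upwards [hS.ae_inverse_eq t] with ω hω
    rw [hX, hω]
  refine ⟨hXm.congr hae.symm, ?_⟩
  rw [Measure.map_congr hae]
  have := Measure.isProbabilityMeasure_map hXm
  refine Measure.ext_of_charFun (funext fun y => ?_)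
  rw [charFun_kernelLaw hα hα2 hβ hβ1 ht', charFun_apply_real,
    integral_map hXm (Continuous.aestronglyMeasurable (by fun_prop)),
    ← integral_exp_subordinated_time hα hα2 hβ hβ1 hL hS hLS]
  have hnorm : ∀ z : ℝ, ‖Complex.exp (y * z * Complex.I)‖ ≤ 1 := fun z => by
    rw [← Complex.ofReal_mul, Complex.norm_exp_ofReal_mul_I]
  have hcont : Continuous fun z : ℝ => Complex.exp (y * z * Complex.I) := by fun_prop
  have hstep : ∀ n, ∫ ω, Complex.exp (y * (Real.sqrt 2 * W (R n ω) ω : ℝ) * Complex.I) ∂P =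
      ∫ ω, (Real.exp (-(y ^ 2 * R n ω)) : ℂ) ∂P := by
    intro n
    have hmeas : Measurable fun z : ℝ => Complex.exp (y * (Real.sqrt 2 * z : ℝ) * Complex.I) :=
      Continuous.measurable (by fun_prop)
    refine integral_comp_randomTime (P := P)
      (F := fun r ω => Complex.exp (y * (Real.sqrt 2 * W r ω : ℝ) * Complex.I))
      (m := fun r => (Real.exp (-(y ^ 2 * (r : ℝ))) : ℂ))
      (fun r => hmeas.comp_aemeasurable (hW.aemeasurable r)) (hR n) (fun r ω => hnorm _)
      (fun r => hWLS.comp (hmeas.comp (measurable_pi_apply r)) (measurable_approxTime t n)) ?_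
      fun r => integral_cexp_brownian hW y r
    filter_upwards [hW.cont] with ω hω r
    exact (hcont.comp (hω.const_mul (Real.sqrt 2))).continuousWithinAt
  have h1 : Tendsto (fun n => ∫ ω, Complex.exp (y * (Real.sqrt 2 * W (R n ω) ω : ℝ) *
      Complex.I) ∂P) atTop (𝓝 (∫ ω, Complex.exp (y * X ω * Complex.I) ∂P)) := by
    refine tendsto_integral_of_dominated_convergence (fun _ => 1)
      (fun n => (hcont.measurable.comp_aemeasurable (hXn n)).aestronglyMeasurable)
      (integrable_const _) (fun n => ae_of_all _ fun ω => hnorm _) ?_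
    filter_upwards [hXlim] with ω hω
    exact (hcont.tendsto _).comp hω
  have hcont2 : Continuous fun z : ℝ≥0 => (Real.exp (-(y ^ 2 * (z : ℝ))) : ℂ) := by fun_prop
  have h2 : Tendsto (fun n => ∫ ω, (Real.exp (-(y ^ 2 * R n ω)) : ℂ) ∂P) atTop
      (𝓝 (∫ ω, (Real.exp (-(y ^ 2 * L (firstPassage t fun r => S r ω) ω)) : ℂ) ∂P)) := by
    refine tendsto_integral_of_dominated_convergence (fun _ => 1)
      (fun n => (hcont2.measurable.comp (hR n)).aestronglyMeasurable)
      (integrable_const _) (fun n => ae_of_all _ fun ω => ?_) ?_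
    · rw [Complex.norm_real, Real.norm_eq_abs, Real.abs_exp, Real.exp_le_one_iff]
      exact neg_nonpos.2 (by positivity)
    · filter_upwards [hRlim] with ω hω
      exact (hcont2.tendsto _).comp hω
  exact tendsto_nhds_unique h1 (h2.congr fun n => (hstep n).symm)

theorem hasLaw_subordinated_zero [IsProbabilityMeasure P] (hβ : 0 < β) (hβ1 : β ≤ 1)
    (hW : IsBrownianReal W P) (hL : IsStableSubordinator (α / 2) L P)
    (hS : IsStableSubordinator β S P) :
    HasLaw (fun ω => Real.sqrt 2 * W (L (inverseSubordinator S 0 ω) ω) ω) (Measure.dirac 0) P := by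
  have hae : (fun ω => Real.sqrt 2 * W (L (inverseSubordinator S 0 ω) ω) ω) =ᵐ[P]
      fun _ => (0 : ℝ) := by
    filter_upwards [hS.ae_inverse_zero hβ hβ1, hL.start_zero, hW.eval_zero_ae_eq_zero] with ω h1 h2 h3
    rw [h1, h2, h3, mul_zero]
  refine ⟨aemeasurable_const.congr hae.symm, ?_⟩
  rw [Measure.map_congr hae, Measure.map_const, measure_univ, one_smul]

end process

end FracHeat

end

/-! ### Assembly of the Green function, Cauchy problem and process claims -/

theorem mainTheorem4 (α β : ℝ) (hα : 0 < α) (hα2 : α ≤ 2) (hβ : 0 < β) (hβ1 : β ≤ 1) :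
    -- `L_2^0(x; τ)` is the heat kernel
    (∀ x τ : ℝ, 0 < τ → FracHeat.stableKernel 2 0 x τ =
      1 / Real.sqrt (4 * Real.pi * τ) * Real.exp (-x ^ 2 / (4 * τ))) ∧
    -- in the nondegenerate range `u_{α,β}` is the double integral
    (α < 2 → β < 1 → ∀ x t : ℝ, FracHeat.subordinatedKernel α β x t =
      ∫ s in Ioi (0 : ℝ), (∫ τ in Ioi (0 : ℝ), FracHeat.stableKernel 2 0 x τ *
        FracHeat.stableKernel (α / 2) (-(α / 2)) τ s) * FracHeat.wrightDensity β s t) ∧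
    -- absolute convergence of the integrals
    (∀ x t : ℝ, 0 < t → (x ≠ 0 ∨ 1 < α ∨ β = 1) →
      (α < 2 → β < 1 → IntegrableOn (fun p : ℝ × ℝ => FracHeat.stableKernel 2 0 x p.1 *
        FracHeat.stableKernel (α / 2) (-(α / 2)) p.1 p.2 * FracHeat.wrightDensity β p.2 t)
        (Ioi 0 ×ˢ Ioi 0)) ∧
      (α < 2 → β = 1 → IntegrableOn (fun τ => FracHeat.stableKernel 2 0 x τ *
        FracHeat.stableKernel (α / 2) (-(α / 2)) τ t) (Ioi 0)) ∧
      (α = 2 → β < 1 → IntegrableOn (fun s => FracHeat.stableKernel 2 0 x s *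
        FracHeat.wrightDensity β s t) (Ioi 0))) ∧
    -- `u_{α,β}(·,t)` is a probability density
    (∀ t : ℝ, 0 < t → (∀ x, 0 ≤ FracHeat.subordinatedKernel α β x t) ∧
      Integrable (fun x => FracHeat.subordinatedKernel α β x t) ∧
      ∫ x, FracHeat.subordinatedKernel α β x t = 1) ∧
    -- `u_{α,β}` is the Green function `(2π)⁻¹ ∫ exp(i k x) E_β(-|k| ^ α t ^ β) dk`
    (∀ x t : ℝ, 0 < t → (x ≠ 0 ∨ 1 < α ∨ β = 1) →
      Tendsto (fun R : ℝ => 1 / (2 * (Real.pi : ℂ)) * ∫ k in (-R)..R,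
        Complex.exp (Complex.I * (k : ℂ) * (x : ℂ)) *
          (FracHeat.mittagLeffler β (-(|k| ^ α * t ^ β)) : ℂ))
        atTop (𝓝 (FracHeat.subordinatedKernel α β x t : ℂ))) ∧
    -- it solves the Cauchy problem, and gives the only solution
    (∀ f : ℝ → ℝ, Continuous f → Integrable f →
      Integrable (fun k : ℝ => (1 + |k| ^ α) * ‖∫ x : ℝ,
        Complex.exp (Complex.I * (k : ℂ) * (x : ℂ)) * (f x : ℂ)‖) →
      ∀ u : ℝ → ℝ → ℝ, FracHeat.IsSolution α β f u ↔
        (∀ x, u x 0 = f x) ∧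
        ∀ x t, 0 < t → u x t = ∫ y, FracHeat.subordinatedKernel α β (x - y) t * f y) ∧
    -- it is the law of subordinated Brownian motion run on the inverse stable time
    (∀ (Ω : Type*) [MeasurableSpace Ω] (P : Measure Ω) [IsProbabilityMeasure P]
      (W : ℝ≥0 → Ω → ℝ) (L S : ℝ≥0 → Ω → ℝ≥0),
      IsBrownianReal W P →
      FracHeat.IsStableSubordinator (α / 2) L P →
      FracHeat.IsStableSubordinator β S P →
      IndepFun (fun ω t => L t ω) (fun ω t => S t ω) P →
      IndepFun (fun ω t => W t ω) (fun ω => ((fun t => L t ω), fun t => S t ω)) P →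
      HasLaw (fun ω => Real.sqrt 2 * W (L (FracHeat.inverseSubordinator S 0 ω) ω) ω)
        (Measure.dirac 0) P ∧
      ∀ t : ℝ≥0, 0 < t →
        HasLaw (fun ω => Real.sqrt 2 * W (L (FracHeat.inverseSubordinator S t ω) ω) ω)
          (volume.withDensity fun x =>
            ENNReal.ofReal (FracHeat.subordinatedKernel α β x t)) P) := by
  refine ⟨fun x τ hτ => FracHeat.stableKernel_two hτ, fun h1 h2 x t => ?_, fun x t ht h =>
    ⟨fun h1 h2 => FracHeat.integrableOn_triple hα h1 hβ h2 ht h,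
      fun h1 _ => FracHeat.integrableOn_kernel_subordinator hα h1 x ht,
      fun _ h2 => FracHeat.integrableOn_kernel_wright hβ h2 ht⟩,
    fun t ht => ⟨fun x => FracHeat.subordinatedKernel_nonneg hα hα2 hβ hβ1 x ht,
      FracHeat.integrable_subordinatedKernel hα hα2 hβ hβ1 ht,
      FracHeat.integral_subordinatedKernel hα hα2 hβ hβ1 ht⟩,
    fun x t ht h => FracHeat.tendsto_green hα hα2 hβ hβ1 ht h,
    fun f hc hi hF u => FracHeat.isSolution_iff hα hα2 hβ hβ1 hc hi hF u,
    fun Ω _ P _ W L S hW hL hS hLS hWLS =>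
      ⟨FracHeat.hasLaw_subordinated_zero hβ hβ1 hW hL hS, fun t ht =>
        FracHeat.hasLaw_subordinated hα hα2 hβ hβ1 hW hL hS hLS hWLS ht⟩⟩
  rw [FracHeat.subordinatedKernel, FracHeat.wrightAverage, if_neg h2.ne]
  refine setIntegral_congr_fun measurableSet_Ioi fun s _ => ?_
  simp only [FracHeat.stableAverage]
  rw [if_neg (by linarith)]
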